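/- **Setting.** Let $d\ge 1$, let $\Omega\subset\mathbb R^d$ be an open polytope and $T>0$; an open polytope is a nonempty bounded open set that equals the interior of its closure and whose boundary lies in finitely many hyperplanes (it need not be convex). Let $\boldsymbol\kappa$ be a measurable, bounded, symmetric matrix field on $Q_T=\Omega\times(0,T)$ with $y^T\boldsymbol\kappa y\ge\theta|y|^2$ for all $y \in \mathbb R^d$ and some constant $\theta>0$. Let $\mathcal T_h$ be a finite nonoverlapping partition of $Q_T$ into prisms $K=K_x\times K_t$, with $K_x\subset\Omega$ an open polytope and $K_t\subset(0,T)$ an open interval (hanging facets are allowed). Space-like facets (on which time is constant) make up $\mathcal F_h^0$ (at $t=0$), $\mathcal F_h^T$ (at $t=T$) and $\mathcal F_h^{\rm space}$ (the internal ones); time-like facets make up $\mathcal F_h^{\rm D}$ (those on $\partial\Omega\times(0,T)$) and $\mathcal F_h^{\rm time}$ (the internal ones, each shared by two elements $K_1,K_2$ in a fixed order). Let $n_K$ be the spatial outward unit normal of $K$ on its time-like facets and $n_\Omega$ that of $\Omega$. With traces taken from the two sides, put $[\![w]\!]_{\sf N}=w_{|K_1}n_{K_1}+w_{|K_2}n_{K_2}$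 and $\{\!\{r\}\!\}_{\beta}=(1-\beta)r_{|K_1}+\beta r_{|K_2}$ on $\mathcal F_h^{\rm time}$, and $[\![w]\!]_t=w^--w^+$ on $\mathcal F_h^{\rm space}$, where $w^-$ and $w^+$ are the traces from before and after the facet. For each $K$ let $V(K)\subset H^1(K)$ and $M(K)\subset H^1(K)^d$ be finite-dimensional spaces with $\nabla_xV(K)\subset M(K)$, and set $V_h=\prod_KV(K)$, $M_h=\prod_KM(K)$. Let $\alpha$, with values in $[0,1]$, be a measurable function on the facets (for instance constant on each facet) and let $\eta\in L^\infty(\mathcal F_h^{\rm time}\cup\mathcal F_h^{\rm D})$ satisfy $\operatorname{ess\,inf}\eta>0$. For $u \in V_h$ the lifting $\mathcal Lu\in M_h$ is defined by $$\int_{Q_T}\mathcal Lu\cdot r\,dV=\int_{\mathcal F_h^{\rm time}}[\![u]\!]_{\sf N}\cdot\{\!\{r\}\!\}_{1-\alpha}\,dS+\int_{\mathcal F_h^{\rm D}}u\,r\cdot n_\Omega\,dS\qquad\forall r\in M_h,$$ and $\nabla^{\rm LDG}u:=\nabla_xu-\mathcal Lu$ on each $K$. For $u, v\in V_h$ let $$m_h(u,v)=\sum_K\int_K\partial_tu\,v\,dV-\int_{\mathcal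 F_h^{\rm space}}v^+[\![u]\!]_t\,dx+\int_{\mathcal F_h^0}uv\,dx,$$ $$\mathcal A_h(u,v)=\sum_K\int_K\boldsymbol\kappa\nabla^{\rm LDG}u\cdot\nabla^{\rm LDG}v\,dV+\int_{\mathcal F_h^{\rm time}}\eta[\![u]\!]_{\sf N}\cdot[\![v]\!]_{\sf N}\,dS+\int_{\mathcal F_h^{\rm D}}\eta uv\,dS,\qquad \mathcal B_h=m_h+\mathcal A_h,$$ $$|u|_{\rm J}^2=\tfrac12\big(\|u\|_{L^2(\mathcal F_h^T)}^2+\|[\![u]\!]_t\|^2_{L^2(\mathcal F_h^{\rm space})}+\|u\|^2_{L^2(\mathcal F_h^0)}\big),$$ $$|||u|||_{\rm LDG}^2=\|\sqrt{\boldsymbol\kappa}\,\nabla^{\rm LDG}u\|^2_{L^2(Q_T)^d}+\|\eta^{1/2}[\![u]\!]_{\sf N}\|^2_{L^2(\mathcal F_h^{\rm time})^d}+\|\eta^{1/2}u\|^2_{L^2(\mathcal F_h^{\rm D})}.$$ The discrete Newton potential $\mathcal N_hu\in V_h$ is defined by $\mathcal A_h(\mathcal N_hu,w)=m_h(u,w)$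 for all $w\in V_h$, and $$|||u|||^2_{{\rm LDG},\mathcal N}=|u|_{\rm J}^2+|||u|||_{\rm LDG}^2+|||\mathcal N_hu|||_{\rm LDG}^2.$$ **Theorem (inf-sup stability).** For every $u_h\in V_h$ the lifting $\mathcal Lu_h$ and the discrete Newton potential $\mathcal N_hu_h$ exist and are unique, $|||v_h|||_{\rm LDG}>0$ for every $0\ne v_h\in V_h$, and for every $u_h\in V_h$ the supremum below is finite and $$\frac1{2\sqrt2}\,|||u_h|||_{{\rm LDG},\mathcal N}\le\sup_{v_h\in V_h\setminus\{0\}}\frac{\mathcal B_h(u_h,v_h)}{|||v_h|||_{\rm LDG}}$$ (with $\sup\emptyset:=0$ in the trivial case $V_h=\{0\}$). -/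

import Mathlib

open MeasureTheory Set Filter Topology
open scoped ContDiff

/-- Physical space `ℝᵈ` with its Euclidean structure. -/
abbrev Space (d : ℕ) := EuclideanSpace ℝ (Fin d)

/-- Space-time `ℝᵈ × ℝ`; points are pairs `(x, t)` and `volume` is the Lebesgue measure. -/
abbrev SpaceTime (d : ℕ) := Space d × ℝ

/-- Space-time direction of the `k`-th space coordinate. -/
noncomputable def spaceDir {d : ℕ} (k : Fin d) : SpaceTime d := (EuclideanSpace.single k 1, 0)

/-- Space-time direction of time. -/
def timeDir (d : ℕ) : SpaceTime d := (0, 1)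

/-- An open `d`-dimensional polytope (not necessarily convex or connected): a nonempty bounded
open set which is the interior of its closure and whose boundary lies in finitely many
hyperplanes. -/
def IsPolytope {d : ℕ} (P : Set (Space d)) : Prop :=
  P.Nonempty ∧ IsOpen P ∧ Bornology.IsBounded P ∧ interior (closure P) = P ∧
    ∃ H : Finset (Space d × ℝ), (∀ h ∈ H, h.1 ≠ 0) ∧
      frontier P ⊆ ⋃ h ∈ H, {x : Space d | inner ℝ h.1 x = h.2}

/-- `n` is the outward unit normal of `P` at the boundary point `x`, around which the boundary is
flat. On the boundary of a polytope this happens at all points outside a set of dimension at most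
`d - 2`, and then `n` is unique. -/
def IsOutwardNormal {d : ℕ} (P : Set (Space d)) (x n : Space d) : Prop :=
  ‖n‖ = 1 ∧ ∃ r > 0, ∀ y ∈ Metric.ball x r, (y ∈ P ↔ inner ℝ n (y - x) < 0)

open Classical in
/-- The outward unit normal field of a polytope (zero where there is none). -/
noncomputable def outwardNormal {d : ℕ} (P : Set (Space d)) (x : Space d) : Space d :=
  if h : ∃ n, IsOutwardNormal P x n then h.choose else 0

/-! ### Sobolev functions on a space-time element and their traces -/

/-- `L²(K)` -/
noncomputable abbrev L2 {d : ℕ} (K : Set (SpaceTime d)) := Lp ℝ 2 (volume.restrict K)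

/-- `g` is the weak derivative of `u` on `K` in the direction `e`. -/
def HasWeakDeriv {d : ℕ} (K : Set (SpaceTime d)) (e : SpaceTime d) (u g : L2 K) : Prop :=
  ∀ φ : SpaceTime d → ℝ, ContDiff ℝ ∞ φ → HasCompactSupport φ → tsupport φ ⊆ K →
    ∫ z in K, u z * fderiv ℝ φ z e = - ∫ z in K, g z * φ z

/-- `H¹(K)`: all first-order weak derivatives exist in `L²(K)`. -/
def H1 {d : ℕ} (K : Set (SpaceTime d)) : Set (L2 K) :=
  {u | ∀ e : SpaceTime d, ∃ g : L2 K, HasWeakDeriv K e u g}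

open Classical in
/-- The weak derivative of `u ∈ H¹(K)` in the direction `e`, an element of `L²(K)`. -/
noncomputable def weakDeriv {d : ℕ} (K : Set (SpaceTime d)) (e : SpaceTime d) (u : L2 K) : L2 K :=
  if h : ∃ g : L2 K, HasWeakDeriv K e u g then h.choose else 0

/-- The weak spatial gradient. -/
noncomputable def weakGrad {d : ℕ} (K : Set (SpaceTime d)) (u : L2 K) : Fin d → L2 K :=
  fun k => weakDeriv K (spaceDir k) u

/-- The trace of `u` at a boundary point `z` of an element, from inside the element, where the
boundary is flat near `z` and `ν` is the outward unit normal at `z`: the limit of the averages of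
`u` over the segments `[z - ε ν, z]` as `ε → 0⁺`. For `u ∈ H¹(K)` the limit exists at almost every
point of the flat parts of the boundary of `K`, does not depend on the representative of `u`, and
is the usual Sobolev trace. -/
noncomputable def trace {d : ℕ} (u : SpaceTime d → ℝ) (z ν : SpaceTime d) : ℝ :=
  limUnder (𝓝[>] (0 : ℝ)) fun ε : ℝ => ε⁻¹ * ∫ s in (0 : ℝ)..ε, u (z - s • ν)

/-! ### Data: diffusion tensor, mesh, discrete spaces -/

/-- A measurable, bounded, symmetric, uniformly positive definite diffusion tensor on
`Ω × (0,T)`. -/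
structure IsDiffusionTensor {d : ℕ} (Ω : Set (Space d)) (T : ℝ)
    (κ : SpaceTime d → Matrix (Fin d) (Fin d) ℝ) : Prop where
  measurable : ∀ k l, Measurable fun z => κ z k l
  bounded : ∃ C : ℝ, ∀ z ∈ Ω ×ˢ Ioo 0 T, ∀ k l, |κ z k l| ≤ C
  symm : ∀ z ∈ Ω ×ˢ Ioo 0 T, (κ z).IsSymm
  elliptic : ∃ θ > 0, ∀ z ∈ Ω ×ˢ Ioo 0 T, ∀ y : Fin d → ℝ,
    θ * (y ⬝ᵥ y) ≤ y ⬝ᵥ ((κ z).mulVec y)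

/-- A nonoverlapping partition of `Ω × (0,T)` into finitely many prisms
`base i × (tMin i, tMax i)` over polytopes. Hanging facets of both kinds are allowed. -/
structure PrismaticMesh {d : ℕ} (Ω : Set (Space d)) (T : ℝ) where
  N : ℕ
  base : Fin N → Set (Space d)
  tMin : Fin N → ℝ
  tMax : Fin N → ℝ
  base_polytope : ∀ i, IsPolytope (base i)
  base_subset : ∀ i, base i ⊆ Ω
  tMin_nonneg : ∀ i, 0 ≤ tMin i
  tMin_lt_tMax : ∀ i, tMin i < tMax i
  tMax_le : ∀ i, tMax i ≤ T
  disjoint : Pairwise fun i j =>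
    Disjoint (base i ×ˢ Ioo (tMin i) (tMax i)) (base j ×ˢ Ioo (tMin j) (tMax j))
  cover : ⋃ i, closure (base i ×ˢ Ioo (tMin i) (tMax i)) = closure (Ω ×ˢ Ioo 0 T)

/-- Integration over a lateral surface `S × J`, `S ⊆ ℝᵈ` a `(d-1)`-dimensional surface and `J` a
set of times: surface measure times Lebesgue measure. -/
noncomputable def lateralMeasure {d : ℕ} (S : Set (Space d)) (J : Set ℝ) :
    Measure (SpaceTime d) :=
  ((Measure.euclideanHausdorffMeasure (d - 1)).restrict S).prod (volume.restrict J)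

namespace PrismaticMesh

variable {d : ℕ} {Ω : Set (Space d)} {T : ℝ} (𝒯 : PrismaticMesh Ω T)

/-- The time interval `K_t` of the `i`-th element. -/
def interval (i : Fin 𝒯.N) : Set ℝ := Ioo (𝒯.tMin i) (𝒯.tMax i)

/-- The `i`-th element `K = K_x × K_t`. -/
def elem (i : Fin 𝒯.N) : Set (SpaceTime d) := 𝒯.base i ×ˢ 𝒯.interval i

/-- Surface measure on the internal time-like facets shared by the elements `i` and `j`. -/
noncomputable def timeFacet (i j : Fin 𝒯.N) : Measure (SpaceTime d) :=
  lateralMeasure (frontier (𝒯.base i) ∩ frontier (𝒯.base j)) (𝒯.interval i ∩ 𝒯.interval j)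

/-- Surface measure on the Dirichlet facets of the element `i`, i.e. its time-like facets on
`∂Ω × (0,T)`. -/
noncomputable def dirichletFacet (i : Fin 𝒯.N) : Measure (SpaceTime d) :=
  lateralMeasure (frontier (𝒯.base i) ∩ frontier Ω) (𝒯.interval i)

/-- Surface measure on the union of all internal time-like and all Dirichlet facets. -/
noncomputable def lateralSkeleton : Measure (SpaceTime d) :=
  ∑ i, ∑ j ∈ Finset.Ioi i, 𝒯.timeFacet i j + ∑ i, 𝒯.dirichletFacet i

/-- Piecewise `L²` scalar functions. -/
abbrev Broken := ∀ i : Fin 𝒯.N, L2 (𝒯.elem i)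

/-- Piecewise `L²` vector fields. -/
abbrev BrokenVec := ∀ i : Fin 𝒯.N, Fin d → L2 (𝒯.elem i)

variable {𝒯}

/-- Spatial outward unit normal of the element `i` at a lateral boundary point. -/
noncomputable def normal (𝒯 : PrismaticMesh Ω T) (i : Fin 𝒯.N) (z : SpaceTime d) : Space d :=
  outwardNormal (𝒯.base i) z.1

/-- Trace from the element `i` at a lateral boundary point `z`. -/
noncomputable def sideTrace (u : 𝒯.Broken) (i : Fin 𝒯.N) (z : SpaceTime d) : ℝ :=
  trace (u i) z (𝒯.normal i z, 0)

/-- Trace of a vector field from the element `i` at a lateral boundary point `z`. -/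
noncomputable def sideTraceVec (r : 𝒯.BrokenVec) (i : Fin 𝒯.N) (z : SpaceTime d) : Space d :=
  WithLp.toLp 2 fun k => trace (r i k) z (𝒯.normal i z, 0)

/-- Trace on the top `K_x × {tMax}` of the element `i`. -/
noncomputable def topTrace (u : 𝒯.Broken) (i : Fin 𝒯.N) (x : Space d) : ℝ :=
  trace (u i) (x, 𝒯.tMax i) (0, 1)

/-- Trace on the bottom `K_x × {tMin}` of the element `i`. -/
noncomputable def bottomTrace (u : 𝒯.Broken) (i : Fin 𝒯.N) (x : Space d) : ℝ :=
  trace (u i) (x, 𝒯.tMin i) (0, -1)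

/-- Spatial normal jump on a time-like facet shared by the elements `i` and `j`. -/
noncomputable def normalJump (u : 𝒯.Broken) (i j : Fin 𝒯.N) (z : SpaceTime d) : Space d :=
  sideTrace u i z • 𝒯.normal i z + sideTrace u j z • 𝒯.normal j z

/-- Weighted average `(1 - β) r_i + β r_j` on a time-like facet shared by `i` and `j`. -/
noncomputable def average (β : ℝ) (r : 𝒯.BrokenVec) (i j : Fin 𝒯.N) (z : SpaceTime d) : Space d :=
  (1 - β) • sideTraceVec r i z + β • sideTraceVec r j z

/-- Temporal jump `u⁻ - u⁺` on a space-like facet below which lies the element `i` and above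
which lies the element `j`. -/
noncomputable def timeJump (u : 𝒯.Broken) (i j : Fin 𝒯.N) (x : Space d) : ℝ :=
  topTrace u i x - bottomTrace u j x

/-- The form `m_h(u,v) = Σ_K ∫_K ∂ₜu v - ∫_{F^space} v⁺ ⟦u⟧ₜ + ∫_{F⁰} u v`. The internal space-like
facets are the sets `(K_x ∩ K'_x) × {t}`, where `K` ends and `K'` starts at time `t`. -/
noncomputable def mForm (u v : 𝒯.Broken) : ℝ :=
  (∑ i, ∫ z in 𝒯.elem i, weakDeriv (𝒯.elem i) (timeDir d) (u i) z * v i z)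
  - (∑ i, ∑ j, if 𝒯.tMax i = 𝒯.tMin j then
      ∫ x in 𝒯.base i ∩ 𝒯.base j, bottomTrace v j x * timeJump u i j x else 0)
  + ∑ i, if 𝒯.tMin i = 0 then
      ∫ x in 𝒯.base i, bottomTrace u i x * bottomTrace v i x else 0

/-- The upwind-jump functional `|u|_J`. -/
noncomputable def jumpFunctional (T : ℝ) {𝒯 : PrismaticMesh Ω T} (u : 𝒯.Broken) : ℝ :=
  √(1 / 2 * ((∑ i, if 𝒯.tMax i = T then ∫ x in 𝒯.base i, topTrace u i x ^ 2 else 0)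
    + (∑ i, ∑ j, if 𝒯.tMax i = 𝒯.tMin j then
        ∫ x in 𝒯.base i ∩ 𝒯.base j, timeJump u i j x ^ 2 else 0)
    + ∑ i, if 𝒯.tMin i = 0 then ∫ x in 𝒯.base i, bottomTrace u i x ^ 2 else 0))

end PrismaticMesh

open PrismaticMesh

/-- Finite-dimensional local spaces `V(K) ⊆ H¹(K)` and `M(K) ⊆ H¹(K)ᵈ`. -/
structure DiscreteSpaces {d : ℕ} {Ω : Set (Space d)} {T : ℝ} (𝒯 : PrismaticMesh Ω T) where
  V : ∀ i, Submodule ℝ (L2 (𝒯.elem i))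
  M : ∀ i, Submodule ℝ (Fin d → L2 (𝒯.elem i))
  finite_V : ∀ i, FiniteDimensional ℝ (V i)
  finite_M : ∀ i, FiniteDimensional ℝ (M i)
  V_subset : ∀ i, ∀ u ∈ V i, u ∈ H1 (𝒯.elem i)
  M_subset : ∀ i, ∀ r ∈ M i, ∀ k, r k ∈ H1 (𝒯.elem i)

namespace DiscreteSpaces

variable {d : ℕ} {Ω : Set (Space d)} {T : ℝ} {𝒯 : PrismaticMesh Ω T} (D : DiscreteSpaces 𝒯)

/-- Local compatibility condition `∇ₓ V(K) ⊆ M(K)`. -/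
def LocallyCompatible : Prop :=
  ∀ i, ∀ u ∈ D.V i, weakGrad (𝒯.elem i) u ∈ D.M i

/-- The global broken space `∏ V(K)`. -/
noncomputable def Vh : Submodule ℝ 𝒯.Broken := Submodule.pi univ D.V

/-- The global broken space `∏ M(K)`. -/
noncomputable def Mh : Submodule ℝ 𝒯.BrokenVec := Submodule.pi univ D.M

variable (κ : SpaceTime d → Matrix (Fin d) (Fin d) ℝ) (α η : SpaceTime d → ℝ)

/-- Right-hand side of the definition of the lifting:
`∫_{F^time} ⟦u⟧_N · {{r}}_{1-α} + ∫_{F^D} u r·n_Ω`. A facet shared by two elements is written with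
the element of smaller index as first one; `α` is constant on each facet in the standard setting. -/
noncomputable def liftingRhs (α : SpaceTime d → ℝ) (u : 𝒯.Broken) (r : 𝒯.BrokenVec) : ℝ :=
  (∑ i, ∑ j ∈ Finset.Ioi i,
    ∫ z, inner ℝ (normalJump u i j z) (average (1 - α z) r i j z) ∂(𝒯.timeFacet i j))
  + ∑ i, ∫ z, sideTrace u i z * inner ℝ (sideTraceVec r i z) (outwardNormal Ω z.1)
      ∂(𝒯.dirichletFacet i)

/-- `L` is the lifting of `u`. -/
def IsLifting (u : 𝒯.Broken) (L : 𝒯.BrokenVec) : Prop :=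
  L ∈ D.Mh ∧ ∀ r ∈ D.Mh,
    ∑ i, ∫ z in 𝒯.elem i, ∑ k, L i k z * r i k z = liftingRhs α u r

open Classical in
/-- The lifting operator. -/
noncomputable def lifting (u : 𝒯.Broken) : 𝒯.BrokenVec :=
  if h : ∃ L, D.IsLifting α u L then h.choose else 0

/-- The LDG spatial gradient `∇ₓu - Lu`, element by element. -/
noncomputable def ldgGrad (u : 𝒯.Broken) : 𝒯.BrokenVec :=
  fun i => weakGrad (𝒯.elem i) (u i) - D.lifting α u i

/-- The form `A_h`. -/
noncomputable def aForm (u v : 𝒯.Broken) : ℝ :=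
  (∑ i, ∫ z in 𝒯.elem i,
    (κ z).mulVec (fun k => D.ldgGrad α u i k z) ⬝ᵥ fun k => D.ldgGrad α v i k z)
  + (∑ i, ∑ j ∈ Finset.Ioi i,
      ∫ z, η z * inner ℝ (normalJump u i j z) (normalJump v i j z) ∂(𝒯.timeFacet i j))
  + ∑ i, ∫ z, η z * (sideTrace u i z * sideTrace v i z) ∂(𝒯.dirichletFacet i)

/-- The form `B_h = m_h + A_h`. -/
noncomputable def bForm (u v : 𝒯.Broken) : ℝ := mForm u v + D.aForm κ α η u v

open scoped MatrixOrder Matrix.Norms.L2Operator in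
/-- The LDG norm; `CFC.sqrt (κ z)` is the symmetric positive definite square root of `κ z`. -/
noncomputable def ldgNorm (u : 𝒯.Broken) : ℝ :=
  √((∑ i, ∫ z in 𝒯.elem i,
      ‖(WithLp.toLp 2 ((CFC.sqrt (κ z)).mulVec fun k => D.ldgGrad α u i k z) : Space d)‖ ^ 2)
    + (∑ i, ∑ j ∈ Finset.Ioi i,
        ∫ z, ‖√(η z) • normalJump u i j z‖ ^ 2 ∂(𝒯.timeFacet i j))
    + ∑ i, ∫ z, (√(η z) * sideTrace u i z) ^ 2 ∂(𝒯.dirichletFacet i))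

/-- `w` is the discrete Newton potential of `u`. -/
def IsNewton (u w : 𝒯.Broken) : Prop :=
  w ∈ D.Vh ∧ ∀ v ∈ D.Vh, D.aForm κ α η w v = mForm u v

open Classical in
/-- The discrete Newton potential operator. -/
noncomputable def newton (u : 𝒯.Broken) : 𝒯.Broken :=
  if h : ∃ w, D.IsNewton κ α η u w then h.choose else 0

/-- The norm of LDG type with the jump functional and the Newton potential. -/
noncomputable def ldgNewtonNorm (u : 𝒯.Broken) : ℝ :=
  √(jumpFunctional T u ^ 2 + D.ldgNorm κ α η u ^ 2 + D.ldgNorm κ α η (D.newton κ α η u) ^ 2)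

end DiscreteSpaces

/-!
The argument has an algebraic and an analytic half.

Algebraically, `A_h` is a symmetric positive definite bilinear form on the finite-dimensional space
`V_h` whose square root is the LDG norm, so the functional `m_h(u, ·)` is represented by a unique
`N u`, and `B_h(u, v) = A_h(u + N u, v)`. By Cauchy–Schwarz the supremum over `v` is the norm of
`u + N u`, attained at `v = u + N u`, and
`|||u + N u|||² = |||u|||² + 2 m_h(u, u) + |||N u|||²`. Integration by parts in time gives
`m_h(u, u) = |u|_J²` (`mForm_self`), hence the supremum bounds the whole norm of `u`, even with the
constant `1` in place of `1 / (2√2)`.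

Analytically, this rests on properties of traces, which are limits of means along normal segments.
A weak derivative in one direction makes a function absolutely continuous along almost all segments
of that direction (`HasWeakDeriv.ae_shear`, `IsCollar.exists_trace`), so that the limits exist and
are square integrable on every part of the boundary from which the direction points inwards
uniformly; finitely many such parts cover the boundary of a polytope
(`IsPolytope.exists_slanted_cover`), and on its flat parts the limit does not depend on the
direction (`hasRightMean_oblique_iff`). Consequently lateral traces are square integrable
(`memLp_trace_lateral`), all forms are bilinear, and integration by parts in time holds on each
element; the space-like facets match because the elements partition the cylinder.

Definiteness of `A_h` (`eq_zero_of_aForm_self_eq_zero`): if `A_h(u, u) = 0`, the jumps and the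
Dirichlet traces vanish, hence so does the lifting, hence so does the spatial gradient. Choose a
spatial direction transversal to all facets. Almost every line in this direction crosses the mesh
at flat boundary points only, where the traces from both sides are the constant values of `u` on the
adjacent pieces of the line, or zero on the boundary of the domain. So `u` is constant along such a
line, and it vanishes outside of the bounded domain (`eq_zero_of_spatial_gradient_eq_zero`).
-/

/-! ### Sobolev functions along shears -/

/-- The extension by zero of `u ∈ L²(K)`. -/
noncomputable def zeroExt {d : ℕ} (K : Set (SpaceTime d)) (u : L2 K) : SpaceTime d → ℝ :=
  K.indicator u

/-- The shear `w ↦ w + r (ℓ w + c) e`. It preserves volume when `ℓ e = 0`. -/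
def shear {d : ℕ} (e : SpaceTime d) (ℓ : SpaceTime d →L[ℝ] ℝ) (c r : ℝ) (w : SpaceTime d) :
    SpaceTime d := w + (r * (ℓ w + c)) • e

section Shear

theorem isOpen_forall_mem_Icc {X Z : Type*} [TopologicalSpace X] [TopologicalSpace Z]
    {F : X × ℝ → Z} (hF : Continuous F) {K : Set Z} (hK : IsOpen K) :
    IsOpen {x | ∀ r ∈ Icc (0 : ℝ) 1, F (x, r) ∈ K} := by
  rw [← isClosed_compl_iff]
  have : {x | ∀ r ∈ Icc (0 : ℝ) 1, F (x, r) ∈ K}ᶜ =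
      Prod.fst '' {p : X × Icc (0 : ℝ) 1 | F (p.1, p.2) ∉ K} := by
    ext w
    simp [and_assoc]
  rw [this]
  apply isClosedMap_fst_of_compactSpace
  exact hK.isClosed_compl.preimage
    (hF.comp (continuous_fst.prodMk (continuous_subtype_val.comp continuous_snd)))

instance {d : ℕ} : (volume : Measure (SpaceTime d)).IsAddHaarMeasure :=
  Measure.prod.instIsAddHaarMeasure volume volume

variable {d : ℕ} {K : Set (SpaceTime d)} {e : SpaceTime d}

theorem zeroExt_of_mem (u : L2 K) {z : SpaceTime d} (hz : z ∈ K) : zeroExt K u z = u z :=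
  indicator_of_mem hz _

theorem stronglyMeasurable_zeroExt (hK : MeasurableSet K) (u : L2 K) :
    StronglyMeasurable (zeroExt K u) :=
  (Lp.stronglyMeasurable u).indicator hK

theorem memLp_zeroExt (hK : MeasurableSet K) (u : L2 K) : MemLp (zeroExt K u) 2 volume :=
  (memLp_indicator_iff_restrict hK).2 (Lp.memLp u)

theorem integrable_zeroExt (hK : MeasurableSet K) (hfin : volume K ≠ ⊤) (u : L2 K) :
    Integrable (zeroExt K u) := by
  have : IsFiniteMeasure (volume.restrict K) := ⟨by simpa using hfin.lt_top⟩
  exact (integrable_indicator_iff hK).2 ((Lp.memLp u).integrable (by norm_num))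

theorem zeroExt_smul_add (hK : MeasurableSet K) (k : ℝ) (u v : L2 K) :
    ∀ᵐ w, zeroExt K (k • u + v) w = k * zeroExt K u w + zeroExt K v w := by
  have h1 := (ae_restrict_iff' hK).1 (Lp.coeFn_add (k • u) v)
  have h2 := (ae_restrict_iff' hK).1 (Lp.coeFn_smul k u)
  filter_upwards [h1, h2] with w h1 h2
  by_cases hw : w ∈ K
  · simp only [zeroExt_of_mem _ hw]
    rw [h1 hw, Pi.add_apply, h2 hw, Pi.smul_apply, smul_eq_mul]
  · simp [zeroExt, hw]

theorem HasWeakDeriv.integral_zeroExt (hK : MeasurableSet K) {u g : L2 K}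
    (h : HasWeakDeriv K e u g) {φ : SpaceTime d → ℝ} (h1 : ContDiff ℝ ∞ φ)
    (h2 : HasCompactSupport φ) (h3 : tsupport φ ⊆ K) :
    ∫ z, zeroExt K u z * fderiv ℝ φ z e = - ∫ z, zeroExt K g z * φ z := by
  have := h φ h1 h2 h3
  rw [← integral_indicator hK, ← integral_indicator hK] at this
  simpa only [zeroExt, indicator_mul_left] using this

variable (ℓ : SpaceTime d →L[ℝ] ℝ) (c r : ℝ)

theorem shear_neg_shear (hℓ : ℓ e = 0) (w : SpaceTime d) :
    shear e ℓ c (-r) (shear e ℓ c r w) = w := by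
  simp [shear, hℓ]

theorem contDiff_shear : ContDiff ℝ ∞ (shear e ℓ c r) := by
  unfold shear
  fun_prop

theorem continuous_shear_uncurry :
    Continuous fun p : SpaceTime d × ℝ => shear e ℓ c p.2 p.1 := by
  unfold shear
  fun_prop

theorem continuous_shear : Continuous (shear e ℓ c r) := (contDiff_shear ℓ c r).continuous

theorem measurePreserving_shear (hℓ : ℓ e = 0) :
    MeasurePreserving (shear e ℓ c r) volume volume := by
  have h1 : MeasurePreserving (LinearMap.transvection (r • (ℓ : SpaceTime d →ₗ[ℝ] ℝ)) e :
      SpaceTime d →ₗ[ℝ] SpaceTime d) volume volume := by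
    refine ⟨(LinearMap.continuous_of_finiteDimensional _).measurable, ?_⟩
    have hdet : LinearMap.det (LinearMap.transvection (r • (ℓ : SpaceTime d →ₗ[ℝ] ℝ)) e) = 1 := by
      simp [LinearMap.transvection.det, hℓ]
    rw [Measure.map_linearMap_addHaar_eq_smul_addHaar _ (by rw [hdet]; norm_num), hdet]
    simp
  have h2 := (measurePreserving_add_right (volume : Measure (SpaceTime d)) ((r * c) • e)).comp h1
  convert h2 using 1
  funext w
  simp [shear, LinearMap.transvection.apply]
  module

theorem shear_integral_comp (hℓ : ℓ e = 0) (f : SpaceTime d → ℝ) :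
    ∫ w, f (shear e ℓ c r w) = ∫ w, f w := by
  have hemb : MeasurableEmbedding (shear e ℓ c r) := by
    refine Continuous.measurableEmbedding (continuous_shear ℓ c r) ?_
    exact Function.LeftInverse.injective (g := shear e ℓ c (-r)) (shear_neg_shear ℓ c r hℓ)
  exact (measurePreserving_shear ℓ c r hℓ).integral_comp hemb f

theorem integrable_zeroExt_shear (hK : MeasurableSet K) (hfin : volume K ≠ ⊤) (hℓ : ℓ e = 0)
    (g : L2 K) : Integrable (fun p : SpaceTime d × ℝ => zeroExt K g (shear e ℓ c p.2 p.1))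
      (volume.prod (volume.restrict (Ioc 0 1))) := by
  have hm : StronglyMeasurable (fun p : SpaceTime d × ℝ => zeroExt K g (shear e ℓ c p.2 p.1)) :=
    (stronglyMeasurable_zeroExt hK g).comp_measurable (continuous_shear_uncurry ℓ c).measurable
  rw [integrable_prod_iff' hm.aestronglyMeasurable]
  refine ⟨Eventually.of_forall fun r => ?_, ?_⟩
  · exact (measurePreserving_shear ℓ c r hℓ).integrable_comp_of_integrable
      (integrable_zeroExt hK hfin g)
  · simp_rw [shear_integral_comp ℓ c _ hℓ (fun w => ‖zeroExt K g w‖)]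
    exact integrable_const _

/-- The difference between the values of a Sobolev function at `w` and at its image under a shear
is the integral of the weak derivative in between. Tested against a smooth function, this is the
change of variables formula and the fundamental theorem of calculus for the test function. -/
theorem HasWeakDeriv.ae_shear (hK : IsOpen K) (hfin : volume K ≠ ⊤) {u g : L2 K}
    (h : HasWeakDeriv K e u g) (hℓ : ℓ e = 0) :
    ∀ᵐ w : SpaceTime d, (∀ r ∈ Icc (0 : ℝ) 1, shear e ℓ c r w ∈ K) →
      zeroExt K u (shear e ℓ c 1 w) - zeroExt K u w =
        (ℓ w + c) * ∫ r in (0 : ℝ)..1, zeroExt K g (shear e ℓ c r w) := by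
  set V : Set (SpaceTime d) := {w | ∀ r ∈ Icc (0 : ℝ) 1, shear e ℓ c r w ∈ K}
  have hVo : IsOpen V := isOpen_forall_mem_Icc (continuous_shear_uncurry ℓ c) hK
  have hKm := hK.measurableSet
  have hu := integrable_zeroExt hKm hfin u
  have hg := integrable_zeroExt_shear ℓ c hKm hfin hℓ g
  have hgi : Integrable fun w => ∫ r in (0 : ℝ)..1, zeroExt K g (shear e ℓ c r w) := by
    simp_rw [intervalIntegral.integral_of_le zero_le_one]
    exact hg.integral_prod_left
  have hus : Integrable fun w => zeroExt K u (shear e ℓ c 1 w) :=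
    (measurePreserving_shear ℓ c 1 hℓ).integrable_comp_of_integrable hu
  have hθ : Continuous fun w : SpaceTime d => ℓ w + c := by fun_prop
  have hloc : LocallyIntegrable (fun w => zeroExt K u (shear e ℓ c 1 w) - zeroExt K u w -
        (ℓ w + c) * ∫ r in (0 : ℝ)..1, zeroExt K g (shear e ℓ c r w)) := by
    refine (hus.sub hu).locallyIntegrable.sub ?_
    have := (hgi.locallyIntegrable.locallyIntegrableOn univ).continuousOn_mul hθ.continuousOn
      isOpen_univ.isLocallyClosed
    exact locallyIntegrableOn_univ.1 this
  have key := hVo.ae_eq_zero_of_integral_contDiff_smul_eq_zero (hloc.locallyIntegrableOn V) ?_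
  · filter_upwards [key] with w hw hwV
    exact sub_eq_zero.1 (hw hwV)
  intro φ h1 h2 h3
  -- the four integrals after expanding
  have hφb : ∃ C, ∀ w, ‖φ w‖ ≤ C := h1.continuous.bounded_above_of_compact_support h2
  obtain ⟨C, hC⟩ := hφb
  have hG : Continuous fun w => (ℓ w + c) * fderiv ℝ φ w e := by
    have := (h1.continuous_fderiv (by simp)).clm_apply (continuous_const (y := e))
    exact hθ.mul this
  have hGs : HasCompactSupport fun w => (ℓ w + c) * fderiv ℝ φ w e :=
    (h2.fderiv_apply ℝ e).mul_left
  obtain ⟨C', hC'⟩ := hG.bounded_above_of_compact_support hGs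
  have hθφ : Continuous fun w => (ℓ w + c) * φ w := hθ.mul h1.continuous
  obtain ⟨C'', hC''⟩ := hθφ.bounded_above_of_compact_support h2.mul_left
  have hθs : ∀ r w, ℓ (shear e ℓ c r w) + c = ℓ w + c := by
    intro r w; simp [shear, hℓ]
  -- change of variables in the term with `u ∘ shear`
  have e1 : ∫ w, φ w * zeroExt K u (shear e ℓ c 1 w) =
      ∫ w, zeroExt K u w * φ (shear e ℓ c (-1) w) := by
    rw [← shear_integral_comp ℓ c 1 hℓ fun w => zeroExt K u w * φ (shear e ℓ c (-1) w)]
    refine integral_congr_ae (Eventually.of_forall fun w => ?_)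
    simp only
    rw [shear_neg_shear ℓ c 1 hℓ, mul_comm]
  -- fundamental theorem of calculus for the test function
  have e2 : ∀ w, φ (shear e ℓ c (-1) w) - φ w =
      ∫ r in (0 : ℝ)..1, -((ℓ (shear e ℓ c (-r) w) + c) * fderiv ℝ φ (shear e ℓ c (-r) w) e) := by
    intro w
    have hd : ∀ r : ℝ, HasDerivAt (fun r => φ (shear e ℓ c (-r) w))
        (-((ℓ (shear e ℓ c (-r) w) + c) * fderiv ℝ φ (shear e ℓ c (-r) w) e)) r := by
      intro r
      have hs : HasDerivAt (fun r => shear e ℓ c (-r) w) (-((ℓ w + c) • e)) r := by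
        have : HasDerivAt (fun r : ℝ => -r * (ℓ w + c)) (-(ℓ w + c)) r := by
          simpa using (hasDerivAt_id r).neg.mul_const (ℓ w + c)
        have h' := (this.smul_const e).const_add w
        rw [neg_smul] at h'
        exact h'
      have := ((h1.differentiable (by simp)) (shear e ℓ c (-r) w)).hasFDerivAt.comp_hasDerivAt r hs
      rw [hθs]
      simpa [Function.comp_def] using this
    rw [intervalIntegral.integral_eq_sub_of_hasDerivAt (fun r _ => hd r)]
    · simp [shear]
    · apply Continuous.intervalIntegrable
      exact (hG.comp ((continuous_shear_uncurry ℓ c).comp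
        (by fun_prop : Continuous fun r : ℝ => (w, -r)))).neg
  -- testing the weak derivative with `θ φ ∘ shear`
  have e3 : ∀ r ∈ Icc (0 : ℝ) 1, ∫ w, zeroExt K u w *
      ((ℓ (shear e ℓ c (-r) w) + c) * fderiv ℝ φ (shear e ℓ c (-r) w) e) =
      - ∫ w, zeroExt K g (shear e ℓ c r w) * ((ℓ w + c) * φ w) := by
    intro r hr
    set ψ : SpaceTime d → ℝ := fun w => (ℓ w + c) * φ (shear e ℓ c (-r) w) with hψ
    have hψ1 : ContDiff ℝ ∞ ψ := by
      have : ContDiff ℝ ∞ fun w : SpaceTime d => ℓ w + c := by fun_prop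
      exact this.mul (h1.comp (contDiff_shear ℓ c (-r)))
    have hsub : tsupport ψ ⊆ shear e ℓ c r '' tsupport φ := by
      have hcl : IsClosed (shear e ℓ c r '' tsupport φ) :=
        (h2.isCompact.image (continuous_shear ℓ c r)).isClosed
      refine closure_minimal ?_ hcl
      intro w hw
      refine ⟨shear e ℓ c (-r) w, subset_tsupport _ ?_, ?_⟩
      · exact right_ne_zero_of_mul hw
      · simpa using shear_neg_shear ℓ c (-r) hℓ w
    have hψ2 : HasCompactSupport ψ :=
      (h2.isCompact.image (continuous_shear ℓ c r)).of_isClosed_subset (isClosed_tsupport ψ) hsub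
    have hψ3 : tsupport ψ ⊆ K := by
      refine hsub.trans ?_
      rintro _ ⟨w, hw, rfl⟩
      exact h3 hw r hr
    have hder : ∀ w, fderiv ℝ ψ w e =
        (ℓ (shear e ℓ c (-r) w) + c) * fderiv ℝ φ (shear e ℓ c (-r) w) e := by
      intro w
      have hs : HasDerivAt (fun t : ℝ => shear e ℓ c (-r) (w + t • e)) e 0 := by
        have : (fun t : ℝ => shear e ℓ c (-r) (w + t • e)) =
            fun t => shear e ℓ c (-r) w + t • e := by
          funext t; simp [shear, hℓ]; abel
        rw [this]
        simpa using ((hasDerivAt_id (0 : ℝ)).smul_const e).const_add (shear e ℓ c (-r) w)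
      have hl : HasDerivAt (fun t : ℝ => ψ (w + t • e))
          ((ℓ w + c) * fderiv ℝ φ (shear e ℓ c (-r) w) e) 0 := by
        have hf := ((h1.differentiable (by simp)) (shear e ℓ c (-r) (w + (0 : ℝ) • e))).hasFDerivAt
          |>.comp_hasDerivAt (0 : ℝ) hs
        have := hf.const_mul (ℓ w + c)
        simpa [hψ, hℓ, Function.comp_def] using this
      have hr : HasDerivAt (fun t : ℝ => ψ (w + t • e)) (fderiv ℝ ψ w e) 0 := by
        have hs' : HasDerivAt (fun t : ℝ => w + t • e) e 0 := by
          simpa using ((hasDerivAt_id (0 : ℝ)).smul_const e).const_add w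
        have := ((hψ1.differentiable (by simp)) (w + (0 : ℝ) • e)).hasFDerivAt.comp_hasDerivAt
          (0 : ℝ) hs'
        simpa [Function.comp_def] using this
      rw [hr.unique hl, hθs]
    have := h.integral_zeroExt hKm hψ1 hψ2 hψ3
    simp_rw [hder] at this
    rw [this, ← shear_integral_comp ℓ c r hℓ]
    have hsr : ∀ w, shear e ℓ c (-r) (shear e ℓ c r w) = w := shear_neg_shear ℓ c r hℓ
    simp only [hψ, hsr, hθs]
  have hm1 : Continuous fun p : SpaceTime d × ℝ =>
      (ℓ (shear e ℓ c (-p.2) p.1) + c) * fderiv ℝ φ (shear e ℓ c (-p.2) p.1) e :=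
    hG.comp ((continuous_shear_uncurry ℓ c).comp
        (by fun_prop : Continuous fun p : SpaceTime d × ℝ => (p.1, -p.2)))
  have i1 : Integrable (fun p : SpaceTime d × ℝ => zeroExt K u p.1 *
      ((ℓ (shear e ℓ c (-p.2) p.1) + c) * fderiv ℝ φ (shear e ℓ c (-p.2) p.1) e))
      (volume.prod (volume.restrict (Ioc 0 1))) :=
    (hu.comp_fst _).mul_bdd (c := C') hm1.aestronglyMeasurable
      (Eventually.of_forall fun p => hC' _)
  have i2 : Integrable (fun p : SpaceTime d × ℝ => zeroExt K g (shear e ℓ c p.2 p.1) *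
      ((ℓ p.1 + c) * φ p.1)) (volume.prod (volume.restrict (Ioc 0 1))) :=
    hg.mul_bdd (c := C'') (hθφ.comp continuous_fst).aestronglyMeasurable
      (Eventually.of_forall fun p => hC'' _)
  have e4 : ∫ w, zeroExt K u w * (φ (shear e ℓ c (-1) w) - φ w) =
      ∫ w, (∫ r in Ioc (0 : ℝ) 1, zeroExt K g (shear e ℓ c r w) * ((ℓ w + c) * φ w)) := by
    simp_rw [e2, intervalIntegral.integral_neg, intervalIntegral.integral_of_le zero_le_one,
      mul_neg, ← integral_const_mul, integral_neg]
    rw [integral_integral_swap (f := fun w r => zeroExt K u w *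
      ((ℓ (shear e ℓ c (-r) w) + c) * fderiv ℝ φ (shear e ℓ c (-r) w) e)) i1,
      integral_integral_swap (f := fun w r => zeroExt K g (shear e ℓ c r w) *
      ((ℓ w + c) * φ w)) i2, ← integral_neg]
    refine setIntegral_congr_fun measurableSet_Ioc fun r hr => ?_
    rw [e3 r ⟨hr.1.le, hr.2⟩, neg_neg]
  have i3 : Integrable fun w => φ w * zeroExt K u (shear e ℓ c 1 w) :=
    hus.bdd_mul (c := C) h1.continuous.aestronglyMeasurable (Eventually.of_forall hC)
  have i4 : Integrable fun w => φ w * zeroExt K u w :=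
    hu.bdd_mul (c := C) h1.continuous.aestronglyMeasurable (Eventually.of_forall hC)
  have i5 : Integrable fun w => (∫ r in Ioc (0 : ℝ) 1, zeroExt K g (shear e ℓ c r w) *
      ((ℓ w + c) * φ w)) := i2.integral_prod_left
  have i6 : Integrable fun w => zeroExt K u w * φ (shear e ℓ c (-1) w) :=
    hu.mul_bdd (c := C) ((h1.continuous.comp (continuous_shear ℓ c _)).aestronglyMeasurable)
      (Eventually.of_forall fun w => hC _)
  have i7 : Integrable fun w => zeroExt K u w * φ w :=
    hu.mul_bdd (c := C) h1.continuous.aestronglyMeasurable (Eventually.of_forall hC)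
  calc ∫ w, φ w • (zeroExt K u (shear e ℓ c 1 w) - zeroExt K u w -
        (ℓ w + c) * ∫ r in (0 : ℝ)..1, zeroExt K g (shear e ℓ c r w))
      = ∫ w, (φ w * zeroExt K u (shear e ℓ c 1 w) - φ w * zeroExt K u w -
        (∫ r in Ioc (0 : ℝ) 1, zeroExt K g (shear e ℓ c r w) * ((ℓ w + c) * φ w))) := by
        congr 1; funext w
        rw [integral_mul_const, intervalIntegral.integral_of_le zero_le_one, smul_eq_mul]
        ring
    _ = 0 := by
        have i34 : Integrable fun w => φ w * zeroExt K u (shear e ℓ c 1 w) - φ w * zeroExt K u w :=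
          i3.sub i4
        rw [integral_sub i34 i5, integral_sub i3 i4, e1, ← e4]
        simp_rw [mul_sub]
        rw [integral_sub i6 i7]
        simp_rw [mul_comm (φ _)]
        ring

end Shear

/-! ### Surface measure on hyperplanes -/

section Hyperplane

variable {d : ℕ}

/-- The affine hyperplane `⟨n, x⟩ = c`. -/
def hyperplane (n : Space d) (c : ℝ) : Set (Space d) := {x | inner ℝ n x = c}

theorem isClosed_hyperplane (n : Space d) (c : ℝ) : IsClosed (hyperplane n c) :=
  isClosed_eq (by fun_prop) continuous_const

theorem exists_isometry_hyperplane {n : Space d} (hn : n ≠ 0) (c : ℝ) :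
    ∃ x₀ : Space d, range (fun w : (ℝ ∙ n)ᗮ => x₀ + w) = hyperplane n c := by
  have hnn : inner ℝ n n ≠ 0 := inner_self_ne_zero.2 hn
  refine ⟨(c / inner ℝ n n) • n, ?_⟩
  ext x
  simp only [mem_range, Subtype.exists, hyperplane, mem_ofPred_eq]
  constructor
  · rintro ⟨w, hw, rfl⟩
    rw [Submodule.mem_orthogonal_singleton_iff_inner_right] at hw
    rw [inner_add_right, hw, inner_smul_right]
    field_simp
    simp
  · intro hx
    refine ⟨x - (c / inner ℝ n n) • n, ?_, by simp⟩
    rw [Submodule.mem_orthogonal_singleton_iff_inner_right, inner_sub_right, inner_smul_right, hx]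
    field_simp
    simp

theorem isometry_const_add_coe {n : Space d} (x₀ : Space d) :
    Isometry (fun w : (ℝ ∙ n)ᗮ => x₀ + w) :=
  (isometry_add_left x₀).comp isometry_subtype_coe

theorem isAddHaarMeasure_orthogonal {n : Space d} (hn : n ≠ 0) :
    (Measure.euclideanHausdorffMeasure (d - 1) : Measure (ℝ ∙ n)ᗮ).IsAddHaarMeasure := by
  obtain ⟨k, rfl⟩ : ∃ k, d = k + 1 := by
    rcases d with _ | k
    · exact absurd (Subsingleton.elim n 0) hn
    · exact ⟨k, rfl⟩
  have : Fact (Module.finrank ℝ (Space (k + 1)) = k + 1) := ⟨by simp⟩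
  have h := Submodule.finrank_orthogonal_span_singleton (𝕜 := ℝ) (n := k) hn
  have hi : (Measure.euclideanHausdorffMeasure (Module.finrank ℝ (ℝ ∙ n)ᗮ) :
      Measure (ℝ ∙ n)ᗮ).IsAddHaarMeasure := inferInstance
  rwa [h] at hi

/-- Surface measure on a hyperplane is σ-finite. -/
theorem sFinite_hyperplane {n : Space d} (hn : n ≠ 0) (c : ℝ) :
    SFinite ((Measure.euclideanHausdorffMeasure (d - 1)).restrict (hyperplane n c)) := by
  obtain ⟨x₀, hx₀⟩ := exists_isometry_hyperplane hn c
  have := isAddHaarMeasure_orthogonal hn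
  rw [← hx₀, ← (isometry_const_add_coe x₀).map_euclideanHausdorffMeasure]
  infer_instance

/-- Surface measure on a hyperplane times length in a transversal direction `e` is a multiple of
volume, because it comes from a Haar measure of `n^⊥ × ℝ`. -/
theorem exists_map_hyperplane {n : Space d} (hn : n ≠ 0) (c : ℝ) {e : Space d}
    (he : inner ℝ n e ≠ 0) :
    ∃ C : NNReal, C ≠ 0 ∧ Measure.map (fun p : Space d × ℝ => p.1 + p.2 • e)
      (((Measure.euclideanHausdorffMeasure (d - 1)).restrict (hyperplane n c)).prod volume) =
      C • volume := by
  obtain ⟨x₀, hx₀⟩ := exists_isometry_hyperplane hn c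
  have hH := isAddHaarMeasure_orthogonal hn
  set μ : Measure (ℝ ∙ n)ᗮ := Measure.euclideanHausdorffMeasure (d - 1) with hμ
  have hiso := isometry_const_add_coe (n := n) x₀
  let L₀ : (ℝ ∙ n)ᗮ × ℝ →ₗ[ℝ] Space d :=
    (Submodule.subtype (ℝ ∙ n)ᗮ).coprod (LinearMap.toSpanSingleton ℝ _ e)
  have hL₀ : Function.Bijective L₀ := by
    constructor
    · rw [injective_iff_map_eq_zero]
      rintro ⟨w, s⟩ hws
      have hw := (Submodule.mem_orthogonal_singleton_iff_inner_right).1 w.2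
      have h0 : (w : Space d) + s • e = 0 := by simpa [L₀] using hws
      have : s = 0 := by
        have := congrArg (inner ℝ n) h0
        rw [inner_add_right, hw, inner_smul_right, inner_zero_right, zero_add] at this
        exact (mul_eq_zero.1 this).resolve_right he
      subst this
      simpa using h0
    · intro x
      refine ⟨(⟨x - (inner ℝ n x / inner ℝ n e) • e, ?_⟩, inner ℝ n x / inner ℝ n e), by simp [L₀]⟩
      rw [Submodule.mem_orthogonal_singleton_iff_inner_right, inner_sub_right, inner_smul_right]
      field_simp
      simp
  let L : ((ℝ ∙ n)ᗮ × ℝ) ≃L[ℝ] Space d := (LinearEquiv.ofBijective L₀ hL₀).toContinuousLinearEquiv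
  have hL : ∀ p, L p = (p.1 : Space d) + p.2 • e := fun p => by simp [L, L₀]
  have hHm : (Measure.map L (μ.prod volume)).IsAddHaarMeasure := L.isAddHaarMeasure_map _
  refine ⟨Measure.addHaarScalarFactor (Measure.map L (μ.prod volume)) volume,
    (Measure.addHaarScalarFactor_pos_of_isAddHaarMeasure _ _).ne', ?_⟩
  rw [← Measure.isAddLeftInvariant_eq_smul, ← hx₀, ← hiso.map_euclideanHausdorffMeasure, ← hμ]
  have h1 : (Measure.map (fun w : (ℝ ∙ n)ᗮ => x₀ + (w : Space d)) μ).prod (volume : Measure ℝ) =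
      Measure.map (Prod.map (fun w : (ℝ ∙ n)ᗮ => x₀ + (w : Space d)) id) (μ.prod volume) := by
    rw [← Measure.map_prod_map _ _ hiso.continuous.measurable measurable_id, Measure.map_id]
  rw [h1, Measure.map_map (by fun_prop) (hiso.continuous.measurable.prodMap measurable_id)]
  have h2 : (fun p : Space d × ℝ => p.1 + p.2 • e) ∘
      Prod.map (fun w : (ℝ ∙ n)ᗮ => x₀ + (w : Space d)) id = (fun x => x₀ + x) ∘ L := by
    funext p
    simp [hL, add_assoc]
  rw [h2, ← Measure.map_map (by fun_prop) L.continuous.measurable, map_add_left_eq_self]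

theorem volume_hyperplane {m : Space d} (hm : m ≠ 0) (c : ℝ) :
    (volume : Measure (Space d)) (hyperplane m c) = 0 := by
  obtain ⟨x₀, hx₀⟩ := exists_isometry_hyperplane hm c
  have h1 : hyperplane m c = (fun x => x₀ + x) '' ((ℝ ∙ m)ᗮ : Submodule ℝ (Space d)) := by
    rw [← hx₀, ← Subtype.range_coe (s := ((ℝ ∙ m)ᗮ : Set (Space d))), ← range_comp]; rfl
  rw [h1, image_add_left, measure_preimage_add]
  apply Measure.addHaar_submodule
  intro htop
  have : m ∈ (ℝ ∙ m)ᗮ := by rw [htop]; trivial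
  rw [Submodule.mem_orthogonal_singleton_iff_inner_right] at this
  exact hm (inner_self_eq_zero.1 this)

/-- Two hyperplanes which are not parallel meet in a null set for surface measure: the cylinder over
the intersection in a direction along the second one is contained in the second one. -/
theorem hyperplane_inter_null {n m : Space d} {c c' : ℝ} {e : Space d}
    (hm : m ≠ 0) (hne : inner ℝ n e ≠ 0) (hme : inner ℝ m e = 0) :
    Measure.euclideanHausdorffMeasure (d - 1) (hyperplane n c ∩ hyperplane m c') = 0 := by
  have hn : n ≠ 0 := by rintro rfl; simp at hne
  obtain ⟨C, hC, hmap⟩ := exists_map_hyperplane hn c hne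
  have := sFinite_hyperplane hn c
  have h0 := congrArg (fun μ => μ (hyperplane m c')) hmap
  simp only [Measure.smul_apply, volume_hyperplane hm c', smul_zero] at h0
  rw [Measure.map_apply (by fun_prop) (isClosed_hyperplane m c').measurableSet] at h0
  have h2 : (hyperplane m c') ×ˢ univ ⊆
      (fun p : Space d × ℝ => p.1 + p.2 • e) ⁻¹' (hyperplane m c') := by
    rintro ⟨x, s⟩ ⟨hx, -⟩
    simp only [hyperplane, mem_ofPred_eq, mem_preimage] at hx ⊢
    rw [inner_add_right, inner_smul_right, hx, hme]; simp
  have h3 := measure_mono_null h2 h0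
  rw [Measure.prod_prod, Measure.restrict_apply (isClosed_hyperplane m c').measurableSet] at h3
  simpa [inter_comm] using h3

end Hyperplane

/-! ### Boundary structure of polytopes -/

section Polytope

variable {d : ℕ} {P : Set (Space d)}

/-- The boundary points of `P` on the hyperplane `⟨n, x⟩ = c` around which `P` coincides, in the
ball of radius `r`, with the half-space below the hyperplane. -/
def flatPart (P : Set (Space d)) (n : Space d) (c r : ℝ) : Set (Space d) :=
  {x | inner ℝ n x = c ∧ ∀ y ∈ Metric.ball x r, (y ∈ P ↔ inner ℝ n (y - x) < 0)}

theorem isClosed_flatPart (P : Set (Space d)) (n : Space d) (c r : ℝ) :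
    IsClosed (flatPart P n c r) := by
  have : flatPart P n c r = hyperplane n c ∩
      (Metric.thickening r {y | ¬ (y ∈ P ↔ inner ℝ n y < c)})ᶜ := by
    ext x
    simp only [flatPart, hyperplane, mem_inter_iff, mem_ofPred_eq, mem_compl_iff,
      Metric.mem_thickening_iff, not_exists, not_and, Metric.mem_ball]
    refine and_congr_right fun hx => ?_
    constructor
    · intro h y hy hxy
      have := h y (by rwa [dist_comm])
      rw [inner_sub_right, hx, sub_neg] at this
      exact hy this
    · intro h y hy
      rw [inner_sub_right, hx, sub_neg]
      by_contra hc
      exact h y hc (by rwa [dist_comm])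
  rw [this]
  exact (isClosed_hyperplane n c).inter Metric.isOpen_thickening.isClosed_compl

theorem inter_frontier_nonempty_of_isPreconnected {s : Set (Space d)} (hs : IsPreconnected s)
    (hP : IsOpen P) (h1 : (s ∩ P).Nonempty) (h2 : ∃ y ∈ s, y ∉ P) : (s ∩ frontier P).Nonempty := by
  by_contra hc
  rw [not_nonempty_iff_eq_empty, ← disjoint_iff_inter_eq_empty] at hc
  have hsub : s ⊆ P ∪ (closure P)ᶜ := by
    intro y hy
    by_cases hyP : y ∈ P
    · exact Or.inl hyP
    · refine Or.inr fun hcl => disjoint_left.1 hc hy ?_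
      rw [hP.frontier_eq]
      exact ⟨hcl, hyP⟩
  obtain ⟨y, hy, hyP⟩ := h2
  obtain ⟨z, hz, hzP⟩ := h1
  rcases hs.subset_or_subset hP isClosed_closure.isOpen_compl
    (disjoint_compl_right.mono_left subset_closure) hsub with h | h
  · exact hyP (h hy)
  · exact h hz (subset_closure hzP)

theorem isOutwardNormal_of_mem_flatPart {n x : Space d} {c r : ℝ} (hn : ‖n‖ = 1) (hr : 0 < r)
    (hx : x ∈ flatPart P n c r) : IsOutwardNormal P x n :=
  ⟨hn, r, hr, hx.2⟩

theorem IsOutwardNormal.exists_mem_flatPart {n x : Space d} (h : IsOutwardNormal P x n) :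
    ∃ k : ℕ, x ∈ flatPart P n (inner ℝ n x) (1 / (k + 1 : ℝ)) := by
  obtain ⟨-, r, hr, hx⟩ := h
  obtain ⟨k, hk⟩ := exists_nat_one_div_lt hr
  exact ⟨k, rfl, fun y hy => hx y (Metric.ball_subset_ball hk.le hy)⟩

theorem IsOutwardNormal.eq {n m x : Space d} (hn : IsOutwardNormal P x n)
    (hm : IsOutwardNormal P x m) : n = m := by
  obtain ⟨hn1, r, hr, hn⟩ := hn
  obtain ⟨hm1, r', hr', hm⟩ := hm
  have key : ∀ v : Space d, inner ℝ n v < 0 ↔ inner ℝ m v < 0 := by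
    intro v
    obtain ⟨s, hs, hsv⟩ : ∃ s > (0 : ℝ), s * ‖v‖ < min r r' := by
      refine ⟨min r r' / (2 * (‖v‖ + 1)), by positivity, ?_⟩
      rw [div_mul_eq_mul_div, div_lt_iff₀ (by positivity)]
      have : 0 < min r r' := lt_min hr hr'
      nlinarith [norm_nonneg v]
    have hd : ‖s • v‖ < min r r' := by rwa [norm_smul, Real.norm_of_nonneg hs.le]
    have h1 := hn (x + s • v) (by simpa using hd.trans_le (min_le_left _ _))
    have h2 := hm (x + s • v) (by simpa using hd.trans_le (min_le_right _ _))
    rw [add_sub_cancel_left, inner_smul_right] at h1 h2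
    have h3 : ∀ a : ℝ, s * a < 0 ↔ a < 0 := fun a => by
      constructor
      · intro h; by_contra hc; nlinarith [mul_nonneg hs.le (not_lt.1 hc)]
      · intro h; exact mul_neg_of_pos_of_neg hs h
    rw [h3] at h1 h2
    exact h1.symm.trans h2
  -- if the unit vectors differ, `m - n` separates the two half-spaces
  by_contra hne
  have hlt : inner ℝ n m < 1 := by
    refine lt_of_le_of_ne ((real_inner_le_norm n m).trans (by simp [hn1, hm1])) ?_
    intro h
    exact hne ((inner_eq_one_iff_of_norm_eq_one hn1 hm1).1 h)
  have h1 := (key (m - n)).1 (by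
    rw [inner_sub_right, real_inner_self_eq_norm_sq, hn1]; linarith)
  rw [inner_sub_right, real_inner_self_eq_norm_sq, hm1, real_inner_comm] at h1
  linarith

theorem isOutwardNormal_outwardNormal {x n : Space d} (h : IsOutwardNormal P x n) :
    IsOutwardNormal P x (outwardNormal P x) := by
  have : ∃ n, IsOutwardNormal P x n := ⟨n, h⟩
  rw [outwardNormal, dif_pos this]
  exact this.choose_spec

theorem IsOutwardNormal.outwardNormal_eq {x n : Space d} (h : IsOutwardNormal P x n) :
    outwardNormal P x = n :=
  (isOutwardNormal_outwardNormal h).eq h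

/-- A boundary point all of whose hyperplanes are parallel is flat. Near it, the frontier
lies in one hyperplane, so each of the two half-balls is inside or outside of `P`; both cannot be
inside because `P` is the interior of its closure. -/
theorem isOutwardNormal_or_neg (hPo : IsOpen P) (hPc : interior (closure P) = P)
    {H : Finset (Space d × ℝ)}
    (hH : frontier P ⊆ ⋃ h ∈ H, {x : Space d | inner ℝ h.1 x = h.2}) {x n : Space d}
    (hx : x ∈ frontier P) (hn : ‖n‖ = 1)
    (hpar : ∀ h ∈ H, inner ℝ h.1 x = h.2 → ∃ a : ℝ, a ≠ 0 ∧ h.1 = a • n) :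
    IsOutwardNormal P x n ∨ IsOutwardNormal P x (-n) := by
  have hev : ∀ᶠ y in 𝓝 x, ∀ h ∈ H, inner ℝ h.1 x ≠ h.2 → inner ℝ h.1 y ≠ h.2 := by
    rw [Finset.eventually_all]
    intro h _
    by_cases hx' : inner ℝ h.1 x = h.2
    · exact Eventually.of_forall fun y hy => absurd hx' hy
    · have : ContinuousAt (fun y => inner ℝ h.1 y) x := by fun_prop
      filter_upwards [this.eventually_ne hx'] with y hy _ using hy
  obtain ⟨r, hr, hball⟩ := Metric.eventually_nhds_iff_ball.1 hev
  have hfr : ∀ y ∈ Metric.ball x r, y ∈ frontier P → inner ℝ n (y - x) = 0 := by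
    intro y hy hyf
    obtain ⟨h, hh, hyh⟩ := mem_iUnion₂.1 (hH hyf)
    have hxh : inner ℝ h.1 x = h.2 := by
      by_contra hc
      exact hball y hy h hh hc hyh
    obtain ⟨a, ha, han⟩ := hpar h hh hxh
    have : inner ℝ h.1 (y - x) = 0 := by
      rw [inner_sub_right, hxh]; exact sub_eq_zero.2 hyh
    rw [han, inner_smul_left] at this
    exact (mul_eq_zero.1 this).resolve_left (by simpa using ha)
  have half : ∀ m : Space d, (m = n ∨ m = -n) →
      (Metric.ball x r ∩ {y | 0 < inner ℝ m (y - x)} ⊆ P ∨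
       Disjoint (Metric.ball x r ∩ {y | 0 < inner ℝ m (y - x)}) P) := by
    intro m hm
    by_contra hc
    rw [not_or, not_subset, not_disjoint_iff] at hc
    obtain ⟨⟨y, hy, hyP⟩, ⟨z, hz, hzP⟩⟩ := hc
    have hconv : Convex ℝ (Metric.ball x r ∩ {y | 0 < inner ℝ m (y - x)}) := by
      refine (convex_ball x r).inter ?_
      have : {y | 0 < inner ℝ m (y - x)} = {y | inner ℝ m x < innerSL ℝ m y} := by
        ext y; simp [inner_sub_right]
      rw [this]
      exact convex_halfSpace_gt (innerSL ℝ m).isLinear _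
    obtain ⟨w, ⟨hw1, hw2⟩, hw3⟩ := inter_frontier_nonempty_of_isPreconnected
      hconv.isPreconnected hPo ⟨z, hz, hzP⟩ ⟨y, hy, hyP⟩
    have := hfr w hw1 hw3
    rcases hm with rfl | rfl
    · exact absurd this (ne_of_gt hw2)
    · have h2 : 0 < inner ℝ (-n) (w - x) := hw2
      rw [inner_neg_left, this] at h2
      simp at h2
  -- points of the ball on the hyperplane are limits of points of both half-balls
  have push : ∀ m : Space d, ‖m‖ = 1 → ∀ y ∈ Metric.ball x r, inner ℝ m (y - x) = 0 →
      ∀ U ∈ 𝓝 y, ∃ z ∈ U, z ∈ Metric.ball x r ∩ {y | 0 < inner ℝ m (y - x)} := by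
    intro m hm y hy hy0 U hU
    have ht : Tendsto (fun s : ℝ => y + s • m) (𝓝[>] 0) (𝓝 y) := by
      have : Continuous fun s : ℝ => y + s • m := by fun_prop
      simpa using (this.tendsto 0).mono_left nhdsWithin_le_nhds
    have h1 := ht.eventually (inter_mem hU (Metric.isOpen_ball.mem_nhds hy))
    obtain ⟨s, hs, hs0⟩ := (h1.and self_mem_nhdsWithin).exists
    refine ⟨y + s • m, hs.1, hs.2, ?_⟩
    have : y + s • m - x = (y - x) + s • m := by abel
    simp only [mem_ofPred_eq]
    rw [this, inner_add_right, hy0, inner_smul_right, real_inner_self_eq_norm_sq, hm]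
    simpa using hs0
  have main : ∀ m : Space d, ‖m‖ = 1 →
      Disjoint (Metric.ball x r ∩ {y | 0 < inner ℝ m (y - x)}) P →
      Metric.ball x r ∩ {y | 0 < inner ℝ (-m) (y - x)} ⊆ P → IsOutwardNormal P x m := by
    intro m hm h1 h2
    refine ⟨hm, r, hr, fun y hy => ⟨fun hyP => ?_, fun hlt => ?_⟩⟩
    · rcases lt_trichotomy (inner ℝ m (y - x)) 0 with h | h | h
      · exact h
      · obtain ⟨z, hzP, hz⟩ := push m hm y hy h P (hPo.mem_nhds hyP)
        exact absurd hzP (disjoint_left.1 h1 hz)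
      · exact absurd hyP (disjoint_left.1 h1 ⟨hy, h⟩)
    · refine h2 ⟨hy, ?_⟩
      simp only [mem_ofPred_eq]
      rw [inner_neg_left]; linarith
  have hxP : x ∉ P := by
    rw [hPo.frontier_eq] at hx; exact hx.2
  rcases half n (Or.inl rfl) with h1 | h1 <;> rcases half (-n) (Or.inr rfl) with h2 | h2
  · exfalso
    apply hxP
    rw [← hPc, mem_interior]
    refine ⟨Metric.ball x r, fun y hy => ?_, Metric.isOpen_ball, Metric.mem_ball_self hr⟩
    rcases lt_trichotomy (inner ℝ n (y - x)) 0 with h | h | h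
    · refine subset_closure (h2 ⟨hy, ?_⟩)
      simp only [mem_ofPred_eq]
      rw [inner_neg_left]; linarith
    · rw [mem_closure_iff_nhds]
      intro U hU
      obtain ⟨z, hzU, hz⟩ := push n hn y hy h U hU
      exact ⟨z, hzU, h1 hz⟩
    · exact subset_closure (h1 ⟨hy, h⟩)
  · right
    exact main (-n) (by simpa using hn) h2 (by simpa using h1)
  · left
    exact main n hn h1 h2
  · exfalso
    obtain ⟨y, hy, hyP⟩ := mem_closure_iff_nhds.1 (frontier_subset_closure hx) _
      (Metric.ball_mem_nhds x hr)
    rcases lt_trichotomy (inner ℝ n (y - x)) 0 with h | h | h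
    · refine disjoint_left.1 h2 ⟨hy, ?_⟩ hyP
      simp only [mem_ofPred_eq]
      rw [inner_neg_left]; linarith
    · obtain ⟨z, hzP, hz⟩ := push n hn y hy h P (hPo.mem_nhds hyP)
      exact disjoint_left.1 h1 hz hzP
    · exact disjoint_left.1 h1 ⟨hy, h⟩ hyP

/-- Up to a null set for surface measure, the boundary of a polytope consists of flat parts in
finitely many hyperplanes. -/
theorem IsPolytope.exists_flat_cover (hP : IsPolytope P) :
    ∃ F : Finset (Space d × ℝ), (∀ p ∈ F, ‖p.1‖ = 1) ∧
      frontier P ⊆ (⋃ p ∈ F, hyperplane p.1 p.2) ∧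
      Measure.euclideanHausdorffMeasure (d - 1)
        (frontier P \ ⋃ p ∈ F, ⋃ k : ℕ, flatPart P p.1 p.2 (1 / (k + 1 : ℝ))) = 0 := by
  classical
  obtain ⟨-, hPo, -, hPc, H, hH0, hH⟩ := hP
  let f : Space d × ℝ → Space d × ℝ := fun h => (‖h.1‖⁻¹ • h.1, ‖h.1‖⁻¹ * h.2)
  refine ⟨H.image f ∪ H.image fun h => -f h, ?_, ?_, ?_⟩
  · intro p hp
    rw [Finset.mem_union, Finset.mem_image, Finset.mem_image] at hp
    rcases hp with ⟨h, hh, rfl⟩ | ⟨h, hh, rfl⟩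
    · exact norm_smul_inv_norm (𝕜 := ℝ) (hH0 h hh)
    · simp only [f, Prod.fst_neg, norm_neg]
      exact norm_smul_inv_norm (𝕜 := ℝ) (hH0 h hh)
  · intro x hx
    obtain ⟨h, hh, hxh⟩ := mem_iUnion₂.1 (hH hx)
    have hxh : inner ℝ h.1 x = h.2 := hxh
    refine mem_iUnion₂.2 ⟨f h, Finset.mem_union_left _ (Finset.mem_image_of_mem f hh), ?_⟩
    simp [hyperplane, f, inner_smul_left, hxh]
  -- the exceptional points lie on two hyperplanes which are not parallel
  let B : Set (Space d) := ⋃ h ∈ H, ⋃ h' ∈ H, ⋃ _ : ¬ ∃ a : ℝ, h.1 = a • h'.1,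
    hyperplane h.1 h.2 ∩ hyperplane h'.1 h'.2
  have hB : Measure.euclideanHausdorffMeasure (d - 1) B = 0 := by
    refine (measure_biUnion_null_iff H.countable_toSet).2 fun h hh => ?_
    refine (measure_biUnion_null_iff H.countable_toSet).2 fun h' hh' => ?_
    refine measure_iUnion_null fun hnp => ?_
    have h'0 : inner ℝ h'.1 h'.1 ≠ 0 := inner_self_ne_zero.2 (hH0 h' hh')
    set e : Space d := h.1 - (inner ℝ h'.1 h.1 / inner ℝ h'.1 h'.1) • h'.1 with he
    have h1 : inner ℝ h'.1 e = 0 := by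
      rw [he, inner_sub_right, inner_smul_right]; field_simp; simp
    have h2 : e ≠ 0 := fun h0 => hnp ⟨_, sub_eq_zero.1 h0⟩
    refine hyperplane_inter_null (e := e) (hH0 h' hh') ?_ h1
    have h3 : inner ℝ h.1 e = inner ℝ e e := by
      conv_rhs => rw [he, inner_sub_left, ← he, inner_smul_left, h1]
      simp
    rw [h3]
    exact inner_self_ne_zero.2 h2
  refine measure_mono_null ?_ hB
  rintro x ⟨hx, hxF⟩
  by_contra hxB
  obtain ⟨h, hh, hxh⟩ := mem_iUnion₂.1 (hH hx)
  have hxh : inner ℝ h.1 x = h.2 := hxh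
  have hpos : 0 < ‖h.1‖ := norm_pos_iff.2 (hH0 h hh)
  have hfx : inner ℝ (f h).1 x = (f h).2 := by
    simp [f, inner_smul_left, hxh]
  have hfn : ‖(f h).1‖ = 1 := norm_smul_inv_norm (𝕜 := ℝ) (hH0 h hh)
  have hcase := isOutwardNormal_or_neg hPo hPc hH hx hfn (by
    intro h' hh' hxh'
    by_cases hp : ∃ a : ℝ, h'.1 = a • h.1
    · obtain ⟨a, ha⟩ := hp
      refine ⟨a * ‖h.1‖, mul_ne_zero ?_ hpos.ne', ?_⟩
      · rintro rfl
        exact hH0 h' hh' (by simpa using ha)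
      · rw [ha]; simp only [f]; rw [smul_smul, mul_assoc, mul_inv_cancel₀ hpos.ne', mul_one]
    · exfalso
      apply hxB
      simp only [B, mem_iUnion]
      exact ⟨h', hh', h, hh, hp, hxh', hxh⟩)
  apply hxF
  rcases hcase with hc | hc
  · obtain ⟨k, hk⟩ := hc.exists_mem_flatPart
    rw [hfx] at hk
    simp only [mem_iUnion]
    exact ⟨f h, Finset.mem_union_left _ (Finset.mem_image_of_mem f hh), k, hk⟩
  · obtain ⟨k, hk⟩ := hc.exists_mem_flatPart
    rw [inner_neg_left, hfx] at hk
    simp only [mem_iUnion]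
    exact ⟨-f h, Finset.mem_union_right _ (Finset.mem_image_of_mem _ hh), k, hk⟩

theorem IsPolytope.sFinite_frontier (hP : IsPolytope P) :
    SFinite ((Measure.euclideanHausdorffMeasure (d - 1)).restrict (frontier P)) := by
  obtain ⟨-, -, -, -, H, hH0, hH⟩ := hP
  set μ : Measure (Space d) := Measure.euclideanHausdorffMeasure (d - 1)
  have h1 : ∀ S : Finset (Space d × ℝ), S ⊆ H →
      SFinite (μ.restrict (⋃ h ∈ S, hyperplane h.1 h.2)) := by
    classical
    intro S
    induction S using Finset.induction_on with
    | empty => intro _; simp only [Finset.notMem_empty, iUnion_of_empty, iUnion_empty,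
        Measure.restrict_empty]; infer_instance
    | insert a S ha ih =>
      intro hS
      have i1 := ih ((Finset.subset_insert a S).trans hS)
      have i2 := sFinite_hyperplane (hH0 a (hS (Finset.mem_insert_self a S))) a.2
      rw [Finset.set_biUnion_insert, union_comm, ← union_sdiff_self,
        Measure.restrict_union disjoint_sdiff_right]
      · have : (μ.restrict (hyperplane a.1 a.2 \ ⋃ x ∈ S, hyperplane x.1 x.2)) =
            (μ.restrict (hyperplane a.1 a.2)).restrict
              (hyperplane a.1 a.2 \ ⋃ x ∈ S, hyperplane x.1 x.2) :=
          (Measure.restrict_restrict_of_subset sdiff_subset).symm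
        rw [this]
        infer_instance
      · exact (isClosed_hyperplane _ _).measurableSet.diff
          (Finset.measurableSet_biUnion _ fun b _ => (isClosed_hyperplane _ _).measurableSet)
  have := h1 H subset_rfl
  rw [← Measure.restrict_restrict_of_subset hH]
  change SFinite ((μ.restrict (⋃ h ∈ H, hyperplane h.1 h.2)).restrict (frontier P))
  infer_instance

theorem IsPolytope.volume_frontier (hP : IsPolytope P) :
    (volume : Measure (Space d)) (frontier P) = 0 := by
  obtain ⟨-, -, -, -, H, hH0, hH⟩ := hP
  refine measure_mono_null hH ((measure_biUnion_null_iff H.countable_toSet).2 fun h hh => ?_)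
  exact volume_hyperplane (hH0 h hh) h.2

/-- The cell of an arrangement `H` of hyperplanes that lies above the hyperplanes in `A` and below
the other ones. -/
def arrangementCell (H A : Set (Space d × ℝ)) : Set (Space d) :=
  {x | (∀ h ∈ A, h.2 < inner ℝ h.1 x) ∧ ∀ h ∈ H \ A, inner ℝ h.1 x < h.2}

theorem isOpen_arrangementCell {H A : Set (Space d × ℝ)} (hH : H.Finite) (hA : A.Finite) :
    IsOpen (arrangementCell H A) := by
  have h1 : arrangementCell H A = (⋂ h ∈ A, {x | h.2 < inner ℝ h.1 x}) ∩
      ⋂ h ∈ H \ A, {x | inner ℝ h.1 x < h.2} := by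
    ext x; simp [arrangementCell]
  rw [h1]
  exact (hA.isOpen_biInter fun h _ => isOpen_lt continuous_const (by fun_prop)).inter
    ((hH.sdiff).isOpen_biInter fun h _ => isOpen_lt (by fun_prop) continuous_const)

theorem convex_arrangementCell (H A : Set (Space d × ℝ)) : Convex ℝ (arrangementCell H A) := by
  have hlin : ∀ n : Space d, IsLinearMap ℝ fun x => inner ℝ n x := fun n =>
    ⟨inner_add_right n, fun a x => inner_smul_right n x a⟩
  have h1 : arrangementCell H A = (⋂ h ∈ A, {x | h.2 < inner ℝ h.1 x}) ∩
      ⋂ h ∈ H \ A, {x | inner ℝ h.1 x < h.2} := by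
    ext x; simp [arrangementCell]
  rw [h1]
  refine Convex.inter ?_ ?_
  · exact convex_iInter₂ fun h _ => convex_halfSpace_gt (hlin h.1) h.2
  · exact convex_iInter₂ fun h _ => convex_halfSpace_lt (hlin h.1) h.2

/-- The hyperplanes that carry the boundary of a polytope cut it into convex cells. -/
theorem IsPolytope.exists_convex_cover (hP : IsPolytope P) :
    ∃ S : Set (Set (Space d)), S.Finite ∧
      (∀ C ∈ S, IsOpen C ∧ Convex ℝ C ∧ C.Nonempty ∧ C ⊆ P) ∧ closure P ⊆ ⋃ C ∈ S, closure C := by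
  classical
  obtain ⟨-, hPo, -, -, H, hH0, hH⟩ := hP
  have hfin : {C | ∃ A ⊆ (H : Set (Space d × ℝ)), C = arrangementCell H A ∧
      (C ∩ P).Nonempty}.Finite := by
    refine ((H.finite_toSet.finite_subsets).image
      (arrangementCell (H : Set (Space d × ℝ)))).subset ?_
    rintro C ⟨A, hA, rfl, -⟩
    exact mem_image_of_mem _ hA
  refine ⟨_, hfin, ?_, ?_⟩
  · rintro C ⟨A, hA, rfl, hne⟩
    refine ⟨isOpen_arrangementCell H.finite_toSet (H.finite_toSet.subset hA),
      convex_arrangementCell _ _, hne.mono inter_subset_left, ?_⟩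
    by_contra hc
    obtain ⟨w, ⟨hw1, hw2⟩, hwf⟩ := inter_frontier_nonempty_of_isPreconnected
      (convex_arrangementCell _ _).isPreconnected hPo hne (not_subset.1 hc)
    obtain ⟨h, hh, hwh⟩ := mem_iUnion₂.1 (hH hwf)
    have hwh : inner ℝ h.1 w = h.2 := hwh
    by_cases hA : h ∈ A
    · exact (hw1 h hA).ne' hwh
    · exact (hw2 h ⟨hh, hA⟩).ne hwh
  · rw [← hfin.closure_biUnion]
    refine closure_minimal ?_ isClosed_closure
    intro x hx
    rw [mem_closure_iff]
    intro U hU hxU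
    -- the hyperplanes are null, so the open set `U ∩ P` is not contained in them
    have hnull : (volume : Measure (Space d)) (⋃ h ∈ H, hyperplane h.1 h.2) = 0 :=
      (measure_biUnion_null_iff H.countable_toSet).2 fun h hh => volume_hyperplane (hH0 h hh) h.2
    have hpos : 0 < (volume : Measure (Space d)) (U ∩ P) :=
      (hU.inter hPo).measure_pos volume ⟨x, hxU, hx⟩
    obtain ⟨y, ⟨hyU, hyP⟩, hyH⟩ : ((U ∩ P) \ ⋃ h ∈ H, hyperplane h.1 h.2).Nonempty := by
      rw [sdiff_nonempty]
      intro hsub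
      exact hpos.ne' (measure_mono_null hsub hnull)
    have hycell : y ∈ arrangementCell H {h ∈ (H : Set (Space d × ℝ)) | h.2 < inner ℝ h.1 y} := by
      refine ⟨fun h hh => hh.2, fun h hh => ?_⟩
      have : ¬ h.2 < inner ℝ h.1 y := fun hc => hh.2 ⟨hh.1, hc⟩
      exact lt_of_le_of_ne (not_lt.1 this) fun hc => hyH (mem_iUnion₂.2 ⟨h, hh.1, hc⟩)
    exact ⟨y, hyU, mem_iUnion₂.2 ⟨_, ⟨_, fun h hh => hh.1, rfl, ⟨y, hycell, hyP⟩⟩, hycell⟩⟩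

/-- From the points of the closure of a convex open set `C` near `z` one can enter `C` in the
direction from `z` to an interior point. -/
theorem exists_slanted_cover_of_convex {C : Set (Space d)} (hCo : IsOpen C) (hCc : Convex ℝ C)
    (hCn : C.Nonempty) (hCb : Bornology.IsBounded C) :
    ∃ S : Set (Set (Space d) × Space d), S.Finite ∧
      (∀ p ∈ S, MeasurableSet p.1 ∧ ∀ x ∈ p.1, ∀ s ∈ Ioc (0 : ℝ) 1, x + s • p.2 ∈ C) ∧
      closure C ⊆ ⋃ p ∈ S, p.1 := by
  obtain ⟨x₀, hx₀⟩ := hCn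
  obtain ⟨r, hr, hball⟩ := Metric.isOpen_iff.1 hCo x₀ hx₀
  obtain ⟨t, htA, htf, hcov⟩ := hCb.isCompact_closure.finite_cover_balls hr
  refine ⟨(fun z => (closure C ∩ Metric.ball z r, x₀ - z)) '' t, htf.image _, ?_, ?_⟩
  · rintro _ ⟨z, hz, rfl⟩
    refine ⟨isClosed_closure.measurableSet.inter measurableSet_ball, ?_⟩
    rintro x ⟨hx1, hx2⟩ s hs
    have h1 : x₀ + (x - z) ∈ interior C := by
      rw [hCo.interior_eq]
      apply hball
      simpa [dist_eq_norm] using hx2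
    have h2 := hCc.combo_closure_interior_mem_interior hx1 h1
      (a := 1 - s) (b := s) (by linarith [hs.2]) hs.1 (by ring)
    have h3 : x + s • (x₀ - z) = (1 - s) • x + s • (x₀ + (x - z)) := by module
    simp only
    rw [h3]
    exact interior_subset h2
  · intro x hx
    obtain ⟨z, hz, hxz⟩ := mem_iUnion₂.1 (hcov hx)
    exact mem_iUnion₂.2 ⟨_, mem_image_of_mem _ hz, hx, hxz⟩

/-- The closure of a polytope is covered by finitely many sets from each of which one can enter the
polytope in a fixed direction. -/
theorem IsPolytope.exists_slanted_cover (hP : IsPolytope P) :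
    ∃ S : Set (Set (Space d) × Space d), S.Finite ∧
      (∀ p ∈ S, MeasurableSet p.1 ∧ ∀ x ∈ p.1, ∀ s ∈ Ioc (0 : ℝ) 1, x + s • p.2 ∈ P) ∧
      closure P ⊆ ⋃ p ∈ S, p.1 := by
  obtain ⟨𝒞, h𝒞f, h𝒞, hcover⟩ := hP.exists_convex_cover
  choose! S hS1 hS2 hS3 using fun C hC => exists_slanted_cover_of_convex (h𝒞 C hC).1 (h𝒞 C hC).2.1
    (h𝒞 C hC).2.2.1 (hP.2.2.1.subset (h𝒞 C hC).2.2.2)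
  refine ⟨⋃ C ∈ 𝒞, S C, h𝒞f.biUnion hS1, ?_, ?_⟩
  · intro p hp
    obtain ⟨C, hC, hpC⟩ := mem_iUnion₂.1 hp
    exact ⟨(hS2 C hC p hpC).1, fun x hx s hs => (h𝒞 C hC).2.2.2 ((hS2 C hC p hpC).2 x hx s hs)⟩
  · intro x hx
    obtain ⟨C, hC, hxC⟩ := mem_iUnion₂.1 (hcover hx)
    obtain ⟨p, hp, hxp⟩ := mem_iUnion₂.1 (hS3 C hC hxC)
    exact mem_iUnion₂.2 ⟨p, mem_iUnion₂.2 ⟨C, hC, hp⟩, hxp⟩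

end Polytope

/-! ### Sobolev functions on collars -/

section Collar

variable {d : ℕ} {K : Set (SpaceTime d)} {e : SpaceTime d}

theorem HasWeakDeriv.ae_shift (hK : IsOpen K) (hfin : volume K ≠ ⊤) {u g : L2 K}
    (h : HasWeakDeriv K e u g) :
    ∀ᵐ w : SpaceTime d, ∀ᵐ s : ℝ, (∀ r ∈ Icc (0 : ℝ) 1, w + (r * s) • e ∈ K) →
      zeroExt K u (w + s • e) - zeroExt K u w = ∫ r in (0 : ℝ)..s, zeroExt K g (w + r • e) := by
  have hKm := hK.measurableSet
  have hum := (stronglyMeasurable_zeroExt hKm u).measurable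
  have hgm := stronglyMeasurable_zeroExt hKm g
  have hgi : Measurable fun p : ℝ × SpaceTime d =>
      ∫ r in (0 : ℝ)..1, zeroExt K g (p.2 + (r * p.1) • e) := by
    simp_rw [intervalIntegral.integral_of_le zero_le_one]
    refine StronglyMeasurable.measurable (StronglyMeasurable.integral_prod_right
      (f := fun (p : ℝ × SpaceTime d) r => zeroExt K g (p.2 + (r * p.1) • e)) ?_)
    exact hgm.comp_measurable (g := fun q : (ℝ × SpaceTime d) × ℝ => q.1.2 + (q.2 * q.1.1) • e)
      (by fun_prop)
  set S : Set (ℝ × SpaceTime d) := {p | (∀ r ∈ Icc (0 : ℝ) 1, p.2 + (r * p.1) • e ∈ K) ∧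
    ¬ (zeroExt K u (p.2 + p.1 • e) - zeroExt K u p.2 =
      p.1 * ∫ r in (0 : ℝ)..1, zeroExt K g (p.2 + (r * p.1) • e))} with hS
  have hSm : MeasurableSet S := by
    refine MeasurableSet.inter ?_ (measurableSet_eq_fun ?_ ?_).compl
    · exact (isOpen_forall_mem_Icc (F := fun q : (ℝ × SpaceTime d) × ℝ =>
        q.1.2 + (q.2 * q.1.1) • e) (by fun_prop) hK).measurableSet
    · exact (hum.comp (by fun_prop)).sub (hum.comp (by fun_prop))
    · exact measurable_fst.mul hgi
  have hS0 : ((volume : Measure ℝ).prod (volume : Measure (SpaceTime d))) S = 0 := by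
    rw [Measure.measure_prod_null hSm]
    refine Eventually.of_forall fun s => ?_
    have := h.ae_shear (0 : SpaceTime d →L[ℝ] ℝ) s hK hfin (by simp)
    refine (measure_mono_null ?_ (ae_iff.1 this))
    rintro w ⟨h1, h2⟩ h3
    simp only [shear, zero_apply, zero_add, one_mul] at h3
    exact h2 (h3 h1)
  have h1 : ∀ᵐ p ∂((volume : Measure ℝ).prod (volume : Measure (SpaceTime d))), p ∉ S := by
    rw [ae_iff]; simpa using hS0
  have h2 : ∀ᵐ p ∂((volume : Measure (SpaceTime d)).prod (volume : Measure ℝ)), p.swap ∉ S :=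
    (Measure.measurePreserving_swap (μ := (volume : Measure (SpaceTime d)))
      (ν := (volume : Measure ℝ))).quasiMeasurePreserving.ae h1
  filter_upwards [Measure.ae_ae_of_ae_prod h2] with w hw
  filter_upwards [hw] with s hs hseg
  have : zeroExt K u (w + s • e) - zeroExt K u w =
      s * ∫ r in (0 : ℝ)..1, zeroExt K g (w + (r * s) • e) := by
    by_contra hc
    exact hs ⟨hseg, hc⟩
  rw [this, intervalIntegral.mul_integral_comp_mul_right (f := fun r => zeroExt K g (w + r • e))]
  simp

variable {Y : Type*} [MeasurableSpace Y] {μ : Measure Y} {b : Y → SpaceTime d} {δ : ℝ}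

/-- The segments `{b y + s e | 0 < s < δ}` form a collar inside `K` over the measure space `Y`: up
to a constant, the measure of `Y` times length is dominated by volume. -/
structure IsCollar (μ : Measure Y) (b : Y → SpaceTime d) (e : SpaceTime d) (δ : ℝ)
    (K : Set (SpaceTime d)) : Prop where
  measurable : Measurable b
  pos : 0 < δ
  mem : ∀ᵐ y ∂μ, ∀ s ∈ Ioo 0 δ, b y + s • e ∈ K
  map_le : ∃ C : NNReal, Measure.map (fun p : Y × ℝ => b p.1 + p.2 • e)
    (μ.prod (volume.restrict (Ioo 0 δ))) ≤ C • volume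

namespace IsCollar

theorem measurable_uncurry (h : IsCollar μ b e δ K) :
    Measurable fun p : Y × ℝ => b p.1 + p.2 • e :=
  (h.measurable.comp measurable_fst).add (measurable_snd.smul_const e)

theorem ae_prod (h : IsCollar μ b e δ K) {p : SpaceTime d → Prop} (hp : ∀ᵐ w, p w) :
    ∀ᵐ q ∂μ.prod (volume.restrict (Ioo 0 δ)), p (b q.1 + q.2 • e) := by
  obtain ⟨C, hC⟩ := h.map_le
  have : ∀ᵐ w ∂Measure.map (fun p : Y × ℝ => b p.1 + p.2 • e)
    (μ.prod (volume.restrict (Ioo 0 δ))), p w :=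
    (Measure.absolutelyContinuous_of_le_smul (c := (C : ENNReal)) hC).ae_le hp
  exact ae_of_ae_map h.measurable_uncurry.aemeasurable this

theorem memLp_comp (h : IsCollar μ b e δ K) {f : SpaceTime d → ℝ} {p : ENNReal}
    (hf : MemLp f p volume) :
    MemLp (fun q : Y × ℝ => f (b q.1 + q.2 • e)) p (μ.prod (volume.restrict (Ioo 0 δ))) := by
  obtain ⟨C, hC⟩ := h.map_le
  exact (hf.of_measure_le_smul (c := (C : ENNReal)) ENNReal.coe_ne_top hC).comp_of_map
    h.measurable_uncurry.aemeasurable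

theorem ae_integrableOn [SFinite μ] (h : IsCollar μ b e δ K) (hK : MeasurableSet K) (u : L2 K) :
    ∀ᵐ y ∂μ, Integrable (fun s => zeroExt K u (b y + s • e) ^ 2) (volume.restrict (Ioo 0 δ)) ∧
      Integrable (fun s => zeroExt K u (b y + s • e)) (volume.restrict (Ioo 0 δ)) := by
  have hm := (stronglyMeasurable_zeroExt hK u).comp_measurable h.measurable_uncurry
  have h2 := ((memLp_two_iff_integrable_sq hm.aestronglyMeasurable).1
    (h.memLp_comp (memLp_zeroExt hK u))).prod_right_ae
  filter_upwards [h2] with y hy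
  refine ⟨hy, ?_⟩
  refine MemLp.integrable (q := 2) (by norm_num) ((memLp_two_iff_integrable_sq ?_).2 hy)
  exact (hm.comp_measurable measurable_prodMk_left).aestronglyMeasurable

end IsCollar

theorem sq_integral_abs_le {δ : ℝ} (hδ : 0 < δ) {f : ℝ → ℝ}
    (h2 : Integrable (fun s => f s ^ 2) (volume.restrict (Ioo 0 δ)))
    (h1 : Integrable f (volume.restrict (Ioo 0 δ))) :
    (∫ s in Ioo 0 δ, |f s|) ^ 2 ≤ δ * ∫ s in Ioo 0 δ, f s ^ 2 := by
  set c := ∫ s in Ioo 0 δ, |f s| with hc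
  have h0 : 0 ≤ ∫ s in Ioo 0 δ, (|f s| - c / δ) ^ 2 := integral_nonneg fun s => sq_nonneg _
  have : ∫ s in Ioo 0 δ, (|f s| - c / δ) ^ 2 = (∫ s in Ioo 0 δ, f s ^ 2) - c ^ 2 / δ := by
    have e1 : ∀ s, (|f s| - c / δ) ^ 2 = f s ^ 2 - 2 * (c / δ) * |f s| + (c / δ) ^ 2 := by
      intro s; rw [sub_sq, sq_abs]; ring
    simp_rw [e1]
    have i1 : Integrable (fun s => f s ^ 2 - 2 * (c / δ) * |f s|) (volume.restrict (Ioo 0 δ)) :=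
      h2.sub (h1.abs.const_mul _)
    rw [integral_add i1 (integrable_const _), integral_sub h2 (h1.abs.const_mul _),
      integral_const_mul, ← hc]
    simp [hδ.le]
    field_simp
    ring
  rw [this, sub_nonneg, div_le_iff₀ hδ] at h0
  linarith

theorem abs_intervalIntegral_le {δ s : ℝ} {f : ℝ → ℝ} (hs : s ∈ Ioo 0 δ)
    (h1 : Integrable f (volume.restrict (Ioo 0 δ))) :
    |∫ r in (0 : ℝ)..s, f r| ≤ ∫ r in Ioo 0 δ, |f r| := by
  rw [intervalIntegral.integral_of_le hs.1.le]
  refine (abs_integral_le_integral_abs).trans ?_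
  refine setIntegral_mono_set h1.abs (Eventually.of_forall fun _ => abs_nonneg _) ?_
  have hsub : Ioc 0 s ⊆ Ioo 0 δ := fun r hr => ⟨hr.1, hr.2.trans_lt hs.2⟩
  exact hsub.eventuallyLE

/-- Along almost every segment of a collar, a Sobolev function is absolutely continuous up to the
end point, where its value is square integrable. -/
theorem IsCollar.exists_trace [SFinite μ] (h : IsCollar μ b e δ K) (hK : IsOpen K)
    (hfin : volume K ≠ ⊤) {u g : L2 K} (hug : HasWeakDeriv K e u g) :
    ∃ τ : Y → ℝ, MemLp τ 2 μ ∧ ∀ᵐ y ∂μ, ∀ᵐ s ∂volume.restrict (Ioo 0 δ),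
      zeroExt K u (b y + s • e) = τ y + ∫ r in (0 : ℝ)..s, zeroExt K g (b y + r • e) := by
  have hKm := hK.measurableSet
  set ν : Measure ℝ := volume.restrict (Ioo 0 δ) with hν
  have hδ := h.pos
  have hνu : ν.real univ = δ := by simp [hν, hδ.le]
  have hν0 : NeBot (ae ν) := by
    rw [ae_neBot, hν, Ne, Measure.restrict_eq_zero]
    simp [hδ]
  have hum := stronglyMeasurable_zeroExt hKm u
  have hgm := stronglyMeasurable_zeroExt hKm g
  have hGm : StronglyMeasurable fun q : Y × ℝ =>
      ∫ r in (0 : ℝ)..q.2, zeroExt K g (b q.1 + r • e) := by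
    have h1 : StronglyMeasurable fun q : Y × ℝ =>
        ∫ r in Ioc (0 : ℝ) 1, zeroExt K g (b q.1 + (r * q.2) • e) := by
      refine StronglyMeasurable.integral_prod_right
        (f := fun (q : Y × ℝ) r => zeroExt K g (b q.1 + (r * q.2) • e)) ?_
      have hbm := h.measurable
      exact hgm.comp_measurable (g := fun q : (Y × ℝ) × ℝ => b q.1.1 + (q.2 * q.1.2) • e)
        (by fun_prop)
    have h2 : (fun q : Y × ℝ => ∫ r in (0 : ℝ)..q.2, zeroExt K g (b q.1 + r • e)) =
        fun q => q.2 * ∫ r in Ioc (0 : ℝ) 1, zeroExt K g (b q.1 + (r * q.2) • e) := by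
      funext q
      rw [← intervalIntegral.integral_of_le zero_le_one,
        intervalIntegral.mul_integral_comp_mul_right (f := fun r => zeroExt K g (b q.1 + r • e))]
      simp
    rw [h2]
    exact measurable_snd.stronglyMeasurable.mul h1
  have hFm : StronglyMeasurable fun q : Y × ℝ => zeroExt K u (b q.1 + q.2 • e) -
      ∫ r in (0 : ℝ)..q.2, zeroExt K g (b q.1 + r • e) :=
    (hum.comp_measurable h.measurable_uncurry).sub hGm
  -- the primitive of the weak derivative is square integrable on the collar
  have hG2 : MemLp (fun q : Y × ℝ => ∫ r in (0 : ℝ)..q.2, zeroExt K g (b q.1 + r • e)) 2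
      (μ.prod ν) := by
    rw [memLp_two_iff_integrable_sq hGm.aestronglyMeasurable]
    have hJ : Integrable (fun q : Y × ℝ => δ * ∫ s, zeroExt K g (b q.1 + s • e) ^ 2 ∂ν)
        (μ.prod ν) := by
      refine Integrable.const_mul ?_ δ
      refine Integrable.comp_fst (f := fun y => ∫ s, zeroExt K g (b y + s • e) ^ 2 ∂ν) ?_ ν
      exact ((memLp_two_iff_integrable_sq
        (hgm.comp_measurable h.measurable_uncurry).aestronglyMeasurable).1
        (h.memLp_comp (memLp_zeroExt hKm g))).integral_prod_left
    refine hJ.mono' (hGm.pow 2).aestronglyMeasurable ?_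
    have hae : ∀ᵐ q ∂μ.prod ν, (Integrable (fun s => zeroExt K g (b q.1 + s • e) ^ 2) ν ∧
        Integrable (fun s => zeroExt K g (b q.1 + s • e)) ν) ∧ q.2 ∈ Ioo 0 δ := by
      have h1 := (Measure.quasiMeasurePreserving_fst (μ := μ) (ν := ν)).ae
        (h.ae_integrableOn hKm g)
      have h2 := (Measure.quasiMeasurePreserving_snd (μ := μ) (ν := ν)).ae
        (ae_restrict_mem measurableSet_Ioo)
      exact h1.and h2
    filter_upwards [hae] with q hq
    rw [Real.norm_eq_abs, abs_pow, ← sq_abs, abs_abs]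
    refine le_trans ?_ (sq_integral_abs_le hδ hq.1.1 hq.1.2)
    exact pow_le_pow_left₀ (abs_nonneg _) (abs_intervalIntegral_le hq.2 hq.1.2) 2
  have hF2 := (h.memLp_comp (memLp_zeroExt hKm u)).sub hG2
  set τ : Y → ℝ := fun y => δ⁻¹ * ∫ s, (zeroExt K u (b y + s • e) -
      ∫ r in (0 : ℝ)..s, zeroExt K g (b y + r • e)) ∂ν with hτ
  have hτm : StronglyMeasurable τ := hFm.integral_prod_right'.const_mul δ⁻¹
  have key : ∀ᵐ y ∂μ, ∀ᵐ s ∂ν,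
      zeroExt K u (b y + s • e) - ∫ r in (0 : ℝ)..s, zeroExt K g (b y + r • e) = τ y := by
    have h1 := Measure.ae_ae_of_ae_prod (h.ae_prod (hug.ae_shift hK hfin))
    filter_upwards [h1, h.mem, h.ae_integrableOn hKm g] with y hy hmem hint
    obtain ⟨s₀, hs₀, hs₀'⟩ := (hy.and (ae_restrict_mem measurableSet_Ioo)).exists
    have hgi : IntegrableOn (fun s => zeroExt K g (b y + s • e)) (Ioo 0 δ) := hint.2
    have h2 : ∀ᵐ s ∂ν,
        zeroExt K u (b y + s • e) - ∫ r in (0 : ℝ)..s, zeroExt K g (b y + r • e) =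
        zeroExt K u (b y + s₀ • e) - ∫ r in (0 : ℝ)..s₀, zeroExt K g (b y + r • e) := by
      have h3 := ae_restrict_of_ae (s := Ioo 0 δ)
        ((measurePreserving_sub_right volume s₀).quasiMeasurePreserving.ae hs₀)
      filter_upwards [h3, ae_restrict_mem measurableSet_Ioo] with s hs hs'
      have hseg : ∀ r ∈ Icc (0 : ℝ) 1, b y + s₀ • e + (r * (s - s₀)) • e ∈ K := by
        intro r hr
        rw [add_assoc, ← add_smul]
        have : s₀ + r * (s - s₀) ∈ Ioo 0 δ :=
          (convex_Ioo 0 δ).add_smul_sub_mem hs₀' hs' hr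
        exact hmem _ this
      have h4 := hs hseg
      rw [add_assoc, ← add_smul, add_sub_cancel] at h4
      simp_rw [add_assoc, ← add_smul] at h4
      rw [intervalIntegral.integral_comp_add_left (fun r => zeroExt K g (b y + r • e)), add_zero,
        add_sub_cancel] at h4
      have hii : ∀ t ∈ Ioo 0 δ, IntervalIntegrable (fun r => zeroExt K g (b y + r • e))
          volume 0 t := by
        intro t ht
        rw [intervalIntegrable_iff_integrableOn_Ioc_of_le ht.1.le]
        exact hgi.mono_set fun r hr => ⟨hr.1, hr.2.trans_lt ht.2⟩
      have h5 := intervalIntegral.integral_interval_sub_left (hii s hs') (hii s₀ hs₀')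
      linarith
    have h6 : τ y =
        zeroExt K u (b y + s₀ • e) - ∫ r in (0 : ℝ)..s₀, zeroExt K g (b y + r • e) := by
      simp only [hτ]
      rw [integral_congr_ae h2, integral_const, hνu, smul_eq_mul, ← mul_assoc,
        inv_mul_cancel₀ hδ.ne', one_mul]
    rw [h6]
    exact h2
  refine ⟨τ, ?_, ?_⟩
  · rw [memLp_two_iff_integrable_sq hτm.aestronglyMeasurable]
    have h1 : ∀ᵐ q ∂μ.prod ν, zeroExt K u (b q.1 + q.2 • e) -
        (∫ r in (0 : ℝ)..q.2, zeroExt K g (b q.1 + r • e)) = τ q.1 := by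
      have hm : MeasurableSet {q : Y × ℝ | zeroExt K u (b q.1 + q.2 • e) -
        (∫ r in (0 : ℝ)..q.2, zeroExt K g (b q.1 + r • e)) = τ q.1} :=
        measurableSet_eq_fun hFm.measurable (hτm.measurable.comp measurable_fst)
      exact (Measure.ae_prod_iff_ae_ae hm).2 key
    have h2 : MemLp (fun q : Y × ℝ => τ q.1) 2 (μ.prod ν) := hF2.ae_eq h1
    have h3 := ((memLp_two_iff_integrable_sq h2.1).1 h2).integral_prod_left
    simp only [integral_const, hνu, smul_eq_mul] at h3
    have := h3.const_mul δ⁻¹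
    simpa [← mul_assoc, hδ.ne'] using this
  · filter_upwards [key] with y hy
    filter_upwards [hy] with s hs
    linarith

end Collar

/-! ### Limits of one-sided means -/

section RightMean

/-- The means of `f` over `[0, ε]` converge to `τ` as `ε → 0⁺`. -/
def HasRightMean (f : ℝ → ℝ) (τ : ℝ) : Prop :=
  Tendsto (fun ε : ℝ => ε⁻¹ * ∫ s in (0 : ℝ)..ε, f s) (𝓝[>] 0) (𝓝 τ)

namespace HasRightMean

variable {f g : ℝ → ℝ} {τ σ δ : ℝ}

theorem unique (hf : HasRightMean f τ) (hf' : HasRightMean f σ) : τ = σ :=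
  tendsto_nhds_unique hf hf'

theorem trace_eq {d : ℕ} {u : SpaceTime d → ℝ} {z ν : SpaceTime d}
    (h : HasRightMean (fun s => u (z - s • ν)) τ) : trace u z ν = τ :=
  Tendsto.limUnder_eq h

theorem congr_ae (hf : HasRightMean f τ) (hδ : 0 < δ)
    (h : ∀ᵐ s ∂volume.restrict (Ioo 0 δ), f s = g s) : HasRightMean g τ := by
  refine Tendsto.congr' ?_ hf
  filter_upwards [Ioo_mem_nhdsGT hδ] with ε hε
  congr 1
  refine intervalIntegral.integral_congr_ae ?_
  rw [uIoc_of_le hε.1.le]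
  filter_upwards [(ae_restrict_iff' measurableSet_Ioo).1 h] with s hs hs'
  exact hs ⟨hs'.1, hs'.2.trans_lt hε.2⟩

theorem congr (hf : HasRightMean f τ) (hδ : 0 < δ) (h : ∀ s ∈ Ioo 0 δ, f s = g s) :
    HasRightMean g τ :=
  hf.congr_ae hδ ((ae_restrict_iff' measurableSet_Ioo).2 (Eventually.of_forall h))

theorem of_continuous (hf : Continuous f) : HasRightMean f (f 0) := by
  have h := (hf.integral_hasStrictDerivAt 0 0).hasDerivAt
  rw [hasDerivAt_iff_tendsto_slope_zero] at h
  refine (h.mono_left (nhdsWithin_mono _ fun x hx => ne_of_gt hx)).congr fun ε => ?_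
  simp

theorem of_eq_add_primitive (hδ : 0 < δ) (hg : Integrable g (volume.restrict (Ioo 0 δ)))
    (h : ∀ᵐ s ∂volume.restrict (Ioo 0 δ), f s = τ + ∫ r in (0 : ℝ)..s, g r) :
    HasRightMean f τ := by
  have hi : Integrable ((Ioo 0 δ).indicator g) := (integrable_indicator_iff measurableSet_Ioo).2 hg
  have hc : Continuous fun s => τ + ∫ r in (0 : ℝ)..s, (Ioo 0 δ).indicator g r :=
    continuous_const.add (intervalIntegral.continuous_primitive
      (fun a b => hi.intervalIntegrable) 0)
  have h0 := of_continuous hc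
  simp only [intervalIntegral.integral_same, add_zero] at h0
  refine h0.congr_ae hδ ?_
  filter_upwards [h, ae_restrict_mem measurableSet_Ioo] with s hs hs'
  rw [hs]
  congr 1
  refine intervalIntegral.integral_congr_ae (Eventually.of_forall fun r hr => ?_)
  rw [uIoc_of_le hs'.1.le] at hr
  have hm : r ∈ Ioo 0 δ := ⟨hr.1, hr.2.trans_lt hs'.2⟩
  exact indicator_of_mem hm g

theorem of_ae_eq_const (hδ : 0 < δ) (h : ∀ᵐ s ∂volume.restrict (Ioo 0 δ), f s = τ) :
    HasRightMean f τ :=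
  of_eq_add_primitive (g := 0) hδ (integrable_zero _ _ _) (by simpa using h)

theorem comp_mul (hf : HasRightMean f τ) {c : ℝ} (hc : 0 < c) :
    HasRightMean (fun s => f (c * s)) τ := by
  have h1 : Tendsto (fun ε : ℝ => c * ε) (𝓝[>] 0) (𝓝[>] 0) := by
    refine tendsto_nhdsWithin_of_tendsto_nhds_of_eventually_within _ ?_ ?_
    · have : Continuous fun ε : ℝ => c * ε := by fun_prop
      simpa using (this.tendsto 0).mono_left nhdsWithin_le_nhds
    · filter_upwards [self_mem_nhdsWithin] with ε hε using mul_pos hc hε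
  refine (hf.comp h1).congr fun ε => ?_
  simp only [Function.comp_apply]
  rw [intervalIntegral.integral_comp_mul_left f hc.ne', mul_zero, smul_eq_mul, mul_inv]
  ring

theorem const_mul (hf : HasRightMean f τ) (k : ℝ) :
    HasRightMean (fun s => k * f s) (k * τ) := by
  refine (Tendsto.const_mul k hf).congr fun ε => ?_
  rw [intervalIntegral.integral_const_mul]
  ring

theorem add (hf : HasRightMean f τ) (hg : HasRightMean g σ) (hδ : 0 < δ)
    (hfi : Integrable f (volume.restrict (Ioo 0 δ)))
    (hgi : Integrable g (volume.restrict (Ioo 0 δ))) :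
    HasRightMean (fun s => f s + g s) (τ + σ) := by
  refine (Tendsto.add hf hg).congr' ?_
  filter_upwards [Ioo_mem_nhdsGT hδ] with ε hε
  have hii : ∀ {f : ℝ → ℝ}, Integrable f (volume.restrict (Ioo 0 δ)) →
      IntervalIntegrable f volume 0 ε := by
    intro f hf
    rw [intervalIntegrable_iff_integrableOn_Ioc_of_le hε.1.le]
    exact IntegrableOn.mono_set hf fun r hr => ⟨hr.1, hr.2.trans_lt hε.2⟩
  rw [intervalIntegral.integral_add (hii hfi) (hii hgi)]
  ring

/-- Functions whose difference is bounded by `s h(s)`, with `h` integrable, have the same limits of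
means. -/
theorem of_abs_sub_le (hf : HasRightMean f τ) (hδ : 0 < δ) {h : ℝ → ℝ}
    (hfi : Integrable f (volume.restrict (Ioo 0 δ)))
    (hgi : Integrable g (volume.restrict (Ioo 0 δ)))
    (hhi : Integrable h (volume.restrict (Ioo 0 δ)))
    (hle : ∀ᵐ s ∂volume.restrict (Ioo 0 δ), |g s - f s| ≤ s * h s) : HasRightMean g τ := by
  have hii : ∀ {f : ℝ → ℝ} {ε : ℝ}, ε ∈ Ioo 0 δ → Integrable f (volume.restrict (Ioo 0 δ)) →
      IntervalIntegrable f volume 0 ε := by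
    intro f ε hε hf
    rw [intervalIntegrable_iff_integrableOn_Ioc_of_le hε.1.le]
    exact IntegrableOn.mono_set hf fun r hr => ⟨hr.1, hr.2.trans_lt hε.2⟩
  have hprim : Tendsto (fun ε => ∫ s in (0 : ℝ)..ε, (Ioo 0 δ).indicator (fun s => |h s|) s)
      (𝓝[>] 0) (𝓝 0) := by
    have hi : Integrable ((Ioo 0 δ).indicator fun s => |h s|) :=
      (integrable_indicator_iff measurableSet_Ioo).2 hhi.abs
    have := (intervalIntegral.continuous_primitive (fun a b => hi.intervalIntegrable) 0).tendsto 0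
    rw [intervalIntegral.integral_same] at this
    exact this.mono_left nhdsWithin_le_nhds
  have hdiff : Tendsto (fun ε : ℝ => (ε⁻¹ * ∫ s in (0 : ℝ)..ε, g s) -
      ε⁻¹ * ∫ s in (0 : ℝ)..ε, f s) (𝓝[>] 0) (𝓝 0) := by
    refine squeeze_zero_norm' ?_ hprim
    filter_upwards [Ioo_mem_nhdsGT hδ] with ε hε
    rw [← mul_sub, ← intervalIntegral.integral_sub (hii hε hgi) (hii hε hfi), norm_mul,
      norm_inv, Real.norm_of_nonneg hε.1.le, inv_mul_le_iff₀ hε.1,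
      ← intervalIntegral.integral_const_mul]
    refine intervalIntegral.norm_integral_le_of_norm_le hε.1.le ?_ ?_
    · filter_upwards [(ae_restrict_iff' measurableSet_Ioo).1 hle] with s hs hs'
      have hmem : s ∈ Ioo 0 δ := ⟨hs'.1, hs'.2.trans_lt hε.2⟩
      rw [indicator_of_mem hmem]
      refine (hs hmem).trans ((mul_le_mul_of_nonneg_left (le_abs_self _) hs'.1.le).trans ?_)
      exact mul_le_mul_of_nonneg_right hs'.2 (abs_nonneg _)
    · exact (((integrable_indicator_iff measurableSet_Ioo).2
        hhi.abs).const_mul ε).intervalIntegrable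
  have := hdiff.add hf
  simpa [HasRightMean] using this

end HasRightMean

end RightMean

theorem IsCollar.exists_trace_hasRightMean {d : ℕ} {K : Set (SpaceTime d)} {e : SpaceTime d}
    {Y : Type*} [MeasurableSpace Y] {μ : Measure Y} {b : Y → SpaceTime d} {δ : ℝ} [SFinite μ]
    (h : IsCollar μ b e δ K) (hK : IsOpen K)
    (hfin : volume K ≠ ⊤) {u g : L2 K} (hug : HasWeakDeriv K e u g) :
    ∃ τ : Y → ℝ, MemLp τ 2 μ ∧
      ∀ᵐ y ∂μ, HasRightMean (fun s => zeroExt K u (b y + s • e)) (τ y) := by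
  obtain ⟨τ, h1, h2⟩ := h.exists_trace hK hfin hug
  refine ⟨τ, h1, ?_⟩
  filter_upwards [h2, h.ae_integrableOn hK.measurableSet g] with y hy hg
  exact HasRightMean.of_eq_add_primitive h.pos hg.2 hy

/-! ### Traces on the lateral boundary of a prism -/

section Lateral

variable {d : ℕ} {P : Set (Space d)} {I : Set ℝ} {n : Space d} {c r : ℝ}

theorem sFinite_restrict_of_subset_hyperplane {A : Set (Space d)} (hn : n ≠ 0)
    (hA : A ⊆ hyperplane n c) :
    SFinite ((Measure.euclideanHausdorffMeasure (d - 1)).restrict A) := by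
  have := sFinite_hyperplane hn c
  rw [← Measure.restrict_restrict_of_subset hA]
  infer_instance

theorem lateralMeasure_mono {A B : Set (Space d)} {J : Set ℝ} (hAB : A ⊆ B) (hIJ : I ⊆ J) :
    lateralMeasure A I ≤ lateralMeasure B J :=
  Measure.prod_mono (Measure.restrict_mono hAB le_rfl) (Measure.restrict_mono hIJ le_rfl)

theorem exists_map_lateralMeasure (hn : n ≠ 0) (c : ℝ) {e : Space d} (he : inner ℝ n e ≠ 0) :
    ∃ C : NNReal, C ≠ 0 ∧
      Measure.map (fun p : SpaceTime d × ℝ => p.1 + p.2 • ((e, 0) : SpaceTime d))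
      ((lateralMeasure (hyperplane n c) univ).prod volume) = C • volume := by
  obtain ⟨C, hC, hmap⟩ := exists_map_hyperplane hn c he
  have := sFinite_hyperplane hn c
  refine ⟨C, hC, ?_⟩
  set H : Measure (Space d) := (Measure.euclideanHausdorffMeasure (d - 1)).restrict (hyperplane n c)
  let ψ : Space d × ℝ → Space d := fun p => p.1 + p.2 • e
  have hψ : Measurable ψ := by fun_prop
  -- rearrange `((x, t), s)` as `((x, s), t)`
  let R : (Space d × ℝ) × ℝ → (Space d × ℝ) × ℝ :=
    (MeasurableEquiv.prodAssoc (α := Space d) (β := ℝ) (γ := ℝ)).symm ∘ Prod.map id Prod.swap ∘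
      MeasurableEquiv.prodAssoc
  have hR : MeasurePreserving R ((H.prod volume).prod volume) ((H.prod volume).prod volume) := by
    have h1 := measurePreserving_prodAssoc H (volume : Measure ℝ) (volume : Measure ℝ)
    exact (h1.symm _).comp (((MeasurePreserving.id H).prod Measure.measurePreserving_swap).comp h1)
  have h2 : (fun p : SpaceTime d × ℝ => p.1 + p.2 • ((e, 0) : SpaceTime d)) =
      Prod.map ψ id ∘ R := by
    funext ⟨⟨x, t⟩, s⟩
    simp [R, ψ, MeasurableEquiv.prodAssoc]
  rw [lateralMeasure, Measure.restrict_univ, h2,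
    ← Measure.map_map (hψ.prodMap measurable_id) hR.measurable, hR.map_eq,
    ← Measure.map_prod_map _ _ hψ measurable_id, Measure.map_id, hmap]
  rw [Measure.volume_eq_prod]
  exact Measure.prod_smul_left (c := (C : ENNReal))

theorem isCollar_lateral {A : Set (Space d)} (hAm : MeasurableSet A) (hn : n ≠ 0)
    (hA : A ⊆ hyperplane n c) (hI : MeasurableSet I) {e : Space d} (he : inner ℝ n e ≠ 0) {δ : ℝ}
    (hδ : 0 < δ) (hmem : ∀ x ∈ A, ∀ s ∈ Ioo 0 δ, x + s • e ∈ P) :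
    IsCollar (lateralMeasure A I) id ((e, 0) : SpaceTime d) δ (P ×ˢ I) := by
  have := sFinite_restrict_of_subset_hyperplane hn hA
  refine ⟨measurable_id, hδ, ?_, ?_⟩
  · have h1 : ∀ᵐ z ∂lateralMeasure A I, z.1 ∈ A :=
      Measure.quasiMeasurePreserving_fst.ae (ae_restrict_mem hAm)
    have h2 : ∀ᵐ z ∂lateralMeasure A I, z.2 ∈ I :=
      Measure.quasiMeasurePreserving_snd.ae (ae_restrict_mem hI)
    filter_upwards [h1, h2] with z h1 h2 s hs
    exact ⟨hmem _ h1 s hs, by simpa using h2⟩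
  · obtain ⟨C, -, hC⟩ := exists_map_lateralMeasure hn c he
    refine ⟨C, ?_⟩
    rw [← hC]
    refine Measure.map_mono ?_ (by fun_prop)
    exact Measure.prod_mono (lateralMeasure_mono hA (subset_univ _)) Measure.restrict_le_self

end Lateral

section Lateral

variable {d : ℕ} {P : Set (Space d)} {n : Space d} {a b : ℝ}

theorem IsPolytope.isOpen_prism (hP : IsPolytope P) (a b : ℝ) : IsOpen (P ×ˢ Ioo a b) :=
  hP.2.1.prod isOpen_Ioo

theorem IsPolytope.volume_prism (hP : IsPolytope P) (a b : ℝ) :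
    volume (P ×ˢ Ioo a b : Set (SpaceTime d)) ≠ ⊤ :=
  (hP.2.2.1.prod (Metric.isBounded_Ioo a b)).measure_lt_top.ne

theorem flatPart_subset_hyperplane (P : Set (Space d)) (n : Space d) (c r : ℝ) :
    flatPart P n c r ⊆ hyperplane n c := fun _ hx => hx.1

/-- The means of a Sobolev function along the normal and along the oblique direction `e = v - n`,
`v ⟂ n`, have the same limits on a flat part of the boundary: the values at `z - s n` and at
`z + s e` differ by an integral of the derivative in the direction `v` over a segment of length
proportional to `s`. This is the formula for shears, as `s` is the distance to the hyperplane. -/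
theorem hasRightMean_oblique_iff_of_inner_eq {c r : ℝ} (hP : IsPolytope P) (hn : ‖n‖ = 1)
    (hr : 0 < r) {e : Space d} (he : inner ℝ n e = -1) {u : L2 (P ×ˢ Ioo a b)}
    (hu : u ∈ H1 (P ×ˢ Ioo a b)) :
    ∀ᵐ z ∂lateralMeasure (flatPart P n c r) (Ioo a b), ∀ τ,
      HasRightMean (fun s => zeroExt _ u (z + s • ((e, 0) : SpaceTime d))) τ ↔
      HasRightMean (fun s => zeroExt _ u (z + s • ((-n, 0) : SpaceTime d))) τ := by
  have hK := hP.isOpen_prism a b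
  have hfin := hP.volume_prism a b
  have hKm := hK.measurableSet
  have hn0 : n ≠ 0 := by rintro rfl; simp at hn
  set A := flatPart P n c r with hA
  have hAm : MeasurableSet A := (isClosed_flatPart P n c r).measurableSet
  have hAh := flatPart_subset_hyperplane P n c r
  have := sFinite_restrict_of_subset_hyperplane hn0 hAh
  have : SFinite (lateralMeasure A (Ioo a b)) := by unfold lateralMeasure; infer_instance
  have hnn : inner ℝ n n = (1 : ℝ) := by rw [real_inner_self_eq_norm_sq, hn]; norm_num
  set v : Space d := e + n with hv
  have hnv : inner ℝ n v = 0 := by rw [hv, inner_add_right, he, hnn]; norm_num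
  set δ : ℝ := r / (1 + ‖v‖) with hδ
  have hvp : 0 < 1 + ‖v‖ := by positivity
  have hδ0 : 0 < δ := div_pos hr hvp
  have hmem : ∀ x ∈ A, ∀ s ∈ Ioo 0 δ, ∀ t ∈ Icc (0 : ℝ) 1, x + s • (-n + t • v) ∈ P := by
    intro x hx s hs t ht
    refine (hx.2 _ ?_).2 ?_
    · rw [Metric.mem_ball, dist_eq_norm, add_sub_cancel_left, norm_smul,
        Real.norm_of_nonneg hs.1.le]
      have h1 : ‖-n + t • v‖ ≤ 1 + ‖v‖ := by
        refine (norm_add_le _ _).trans ?_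
        rw [norm_neg, hn, norm_smul, Real.norm_of_nonneg ht.1]
        have := mul_le_of_le_one_left (norm_nonneg v) ht.2
        linarith
      calc s * ‖-n + t • v‖ ≤ s * (1 + ‖v‖) := mul_le_mul_of_nonneg_left h1 hs.1.le
        _ < r := (lt_div_iff₀ hvp).1 hs.2
    · rw [add_sub_cancel_left, inner_smul_right, inner_add_right, inner_neg_right, hnn,
        inner_smul_right, hnv]
      have := hs.1
      linarith
  have hcn : IsCollar (lateralMeasure A (Ioo a b)) id ((-n, 0) : SpaceTime d) δ (P ×ˢ Ioo a b) :=
    isCollar_lateral hAm hn0 hAh measurableSet_Ioo (by rw [inner_neg_right, hnn]; norm_num) hδ0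
      fun x hx s hs => by simpa using hmem x hx s hs 0 (by simp)
  have hce : IsCollar (lateralMeasure A (Ioo a b)) id ((e, 0) : SpaceTime d) δ (P ×ˢ Ioo a b) :=
    isCollar_lateral hAm hn0 hAh measurableSet_Ioo (by rw [he]; norm_num) hδ0
      fun x hx s hs => by simpa [hv] using hmem x hx s hs 1 (by simp)
  obtain ⟨g, hg⟩ := hu ((v, 0) : SpaceTime d)
  let ℓ : SpaceTime d →L[ℝ] ℝ := -((innerSL ℝ n).comp (ContinuousLinearMap.fst ℝ (Space d) ℝ))
  have hℓ : ∀ w, ℓ w = -inner ℝ n w.1 := fun w => by simp [ℓ]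
  have hℓv : ℓ ((v, 0) : SpaceTime d) = 0 := by rw [hℓ, hnv, neg_zero]
  have hshear := hcn.ae_prod (hg.ae_shear ℓ c hK hfin hℓv)
  have hGi : Integrable (fun w : SpaceTime d => ∫ t in Ioc (0 : ℝ) 1,
      |zeroExt (P ×ˢ Ioo a b) g (shear ((v, 0) : SpaceTime d) ℓ c t w)|) :=
    (integrable_zeroExt_shear ℓ c hKm hfin hℓv g).abs.integral_prod_left
  have hGc := memLp_one_iff_integrable.1 (hcn.memLp_comp (memLp_one_iff_integrable.2 hGi))
  have hzA : ∀ᵐ z ∂lateralMeasure A (Ioo a b), z.1 ∈ A :=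
    Measure.quasiMeasurePreserving_fst.ae (ae_restrict_mem hAm)
  have hzI : ∀ᵐ z ∂lateralMeasure A (Ioo a b), z.2 ∈ Ioo a b :=
    Measure.quasiMeasurePreserving_snd.ae (ae_restrict_mem measurableSet_Ioo)
  filter_upwards [hcn.ae_integrableOn hKm u, hce.ae_integrableOn hKm u, hGc.prod_right_ae,
    Measure.ae_ae_of_ae_prod hshear, hzA, hzI] with z i1 i2 i3 hz hzA hzI
  have hle : ∀ᵐ s ∂volume.restrict (Ioo 0 δ),
      |zeroExt (P ×ˢ Ioo a b) u (z + s • ((e, 0) : SpaceTime d)) -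
        zeroExt (P ×ˢ Ioo a b) u (z + s • ((-n, 0) : SpaceTime d))| ≤
      s * ∫ t in Ioc (0 : ℝ) 1, |zeroExt (P ×ˢ Ioo a b) g
        (shear ((v, 0) : SpaceTime d) ℓ c t (z + s • ((-n, 0) : SpaceTime d)))| := by
    filter_upwards [hz, ae_restrict_mem measurableSet_Ioo] with s hs hs'
    have hθ : ℓ (z + s • ((-n, 0) : SpaceTime d)) + c = s := by
      rw [hℓ]
      simp only [Prod.fst_add, Prod.smul_fst]
      rw [inner_add_right, hzA.1, inner_smul_right, inner_neg_right, hnn]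
      ring
    have hS : ∀ t, shear ((v, 0) : SpaceTime d) ℓ c t (z + s • ((-n, 0) : SpaceTime d)) =
        (z.1 + s • (-n + t • v), z.2) := by
      intro t
      simp only [shear, hθ]
      ext1
      · simp only [Prod.fst_add, Prod.smul_fst]; module
      · simp
    have h1 := hs (fun t ht => by rw [id, hS]; exact ⟨hmem _ hzA s hs' t ht, hzI⟩)
    simp only [id] at h1
    have h2 : shear ((v, 0) : SpaceTime d) ℓ c 1 (z + s • ((-n, 0) : SpaceTime d)) =
        z + s • ((e, 0) : SpaceTime d) := by
      rw [hS, hv]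
      ext1
      · simp
      · simp
    rw [h2, hθ] at h1
    rw [h1, abs_mul, abs_of_pos hs'.1, intervalIntegral.integral_of_le zero_le_one]
    exact mul_le_mul_of_nonneg_left abs_integral_le_integral_abs hs'.1.le
  intro τ
  constructor
  · intro h
    refine h.of_abs_sub_le hδ0 i2.2 i1.2 i3 ?_
    filter_upwards [hle] with s hs
    rw [abs_sub_comm]
    exact hs
  · intro h
    exact h.of_abs_sub_le hδ0 i1.2 i2.2 i3 hle

/-- On a flat part of the boundary, the means of a Sobolev function along the normal and along any
inward direction have the same limits; rescaling reduces this to directions of unit normal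
component. -/
theorem hasRightMean_oblique_iff {c r : ℝ} (hP : IsPolytope P) (hn : ‖n‖ = 1)
    (hr : 0 < r) {e : Space d} (he : inner ℝ n e < 0) {u : L2 (P ×ˢ Ioo a b)}
    (hu : u ∈ H1 (P ×ˢ Ioo a b)) :
    ∀ᵐ z ∂lateralMeasure (flatPart P n c r) (Ioo a b), ∀ τ,
      HasRightMean (fun s => zeroExt _ u (z + s • ((e, 0) : SpaceTime d))) τ ↔
      HasRightMean (fun s => zeroExt _ u (z + s • ((-n, 0) : SpaceTime d))) τ := by
  set k : ℝ := (-inner ℝ n e)⁻¹ with hk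
  have hk0 : 0 < k := inv_pos.2 (by linarith)
  have h1 : inner ℝ n (k • e) = -1 := by
    rw [inner_smul_right, hk, inv_mul_eq_div, div_eq_iff (by linarith)]
    ring
  filter_upwards [hasRightMean_oblique_iff_of_inner_eq (c := c) (r := r) hP hn hr h1 hu] with z hz τ
  rw [← hz τ]
  constructor
  · intro h
    have := h.comp_mul hk0
    refine this.congr zero_lt_one fun s _ => ?_
    congr 2
    ext1
    · simp only [Prod.smul_fst]; module
    · simp
  · intro h
    have := h.comp_mul (inv_pos.2 hk0)
    refine this.congr zero_lt_one fun s _ => ?_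
    congr 2
    ext1
    · simp only [Prod.smul_fst, smul_smul]
      congr 1
      field_simp
    · simp

theorem restrict_lateralMeasure_frontier_le (hP : IsPolytope P) {A : Set (Space d)}
    (hA : MeasurableSet A) (I : Set ℝ) :
    (lateralMeasure (frontier P) I).restrict (A ×ˢ univ) ≤ lateralMeasure A I := by
  have := hP.sFinite_frontier
  rw [lateralMeasure, ← Measure.prod_restrict, Measure.restrict_univ]
  refine Measure.prod_mono ?_ le_rfl
  rw [Measure.restrict_restrict hA]
  exact Measure.restrict_mono inter_subset_left le_rfl

/-- A property of boundary points of a prism holds almost everywhere if it does so on flat parts. -/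
theorem ae_lateral_of_flatPart (hP : IsPolytope P) {p : SpaceTime d → Prop}
    (h : ∀ (n : Space d) (c r : ℝ), ‖n‖ = 1 → 0 < r →
      ∀ᵐ z ∂lateralMeasure (flatPart P n c r) (Ioo a b), p z) :
    ∀ᵐ z ∂lateralMeasure (frontier P) (Ioo a b), p z := by
  obtain ⟨F, hF1, -, hF⟩ := hP.exists_flat_cover
  have := hP.sFinite_frontier
  set N : Set (Space d) :=
    frontier P \ ⋃ p ∈ F, ⋃ k : ℕ, flatPart P p.1 p.2 (1 / (k + 1 : ℝ))
  have hN : ∀ᵐ z ∂lateralMeasure (frontier P) (Ioo a b), z.1 ∉ N := by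
    refine Measure.quasiMeasurePreserving_fst.ae (p := fun x => x ∉ N) ?_
    rw [ae_iff]
    simp only [not_not, ofPred_mem_eq]
    exact nonpos_iff_eq_zero.1 ((Measure.restrict_le_self _).trans hF.le)
  have hfr : ∀ᵐ z ∂lateralMeasure (frontier P) (Ioo a b), z.1 ∈ frontier P :=
    Measure.quasiMeasurePreserving_fst.ae (ae_restrict_mem isClosed_frontier.measurableSet)
  have hpiece : ∀ q ∈ F, ∀ k : ℕ, ∀ᵐ z ∂lateralMeasure (frontier P) (Ioo a b),
      z.1 ∈ flatPart P q.1 q.2 (1 / (k + 1 : ℝ)) → p z := by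
    intro q hq k
    have hm : MeasurableSet (flatPart P q.1 q.2 (1 / (k + 1 : ℝ))) :=
      (isClosed_flatPart _ _ _ _).measurableSet
    have h1 := h q.1 q.2 (1 / (k + 1 : ℝ)) (hF1 q hq) (by positivity)
    have h2 : ∀ᵐ z ∂(lateralMeasure (frontier P) (Ioo a b)).restrict
        (flatPart P q.1 q.2 (1 / (k + 1 : ℝ)) ×ˢ univ), p z := by
      exact ae_mono (restrict_lateralMeasure_frontier_le hP hm _) h1
    rw [ae_restrict_iff' (hm.prod MeasurableSet.univ)] at h2
    filter_upwards [h2] with z hz hzm using hz ⟨hzm, trivial⟩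
  have hall : ∀ᵐ z ∂lateralMeasure (frontier P) (Ioo a b), ∀ q ∈ F, ∀ k : ℕ,
      z.1 ∈ flatPart P q.1 q.2 (1 / (k + 1 : ℝ)) → p z :=
    (Finset.eventually_all F).2 fun q hq => ae_all_iff.2 fun k => hpiece q hq k
  filter_upwards [hN, hfr, hall] with z h1 h2 h3
  by_contra hc
  apply h1
  refine ⟨h2, fun hz => ?_⟩
  simp only [mem_iUnion] at hz
  obtain ⟨q, hq, k, hk⟩ := hz
  exact hc (h3 q hq k hk)

theorem ae_mem_flatPart (P : Set (Space d)) (n : Space d) (c r : ℝ) (hn : ‖n‖ = 1) :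
    ∀ᵐ z ∂lateralMeasure (flatPart P n c r) (Ioo a b), z.1 ∈ flatPart P n c r ∧ z.2 ∈ Ioo a b := by
  have hn0 : n ≠ 0 := by rintro rfl; simp at hn
  have := sFinite_restrict_of_subset_hyperplane hn0 (flatPart_subset_hyperplane P n c r)
  have h1 : ∀ᵐ z ∂lateralMeasure (flatPart P n c r) (Ioo a b), z.1 ∈ flatPart P n c r :=
    Measure.quasiMeasurePreserving_fst.ae
      (ae_restrict_mem (isClosed_flatPart P n c r).measurableSet)
  have h2 : ∀ᵐ z ∂lateralMeasure (flatPart P n c r) (Ioo a b), z.2 ∈ Ioo a b :=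
    Measure.quasiMeasurePreserving_snd.ae (ae_restrict_mem measurableSet_Ioo)
  exact h1.and h2

theorem ae_isOutwardNormal (hP : IsPolytope P) :
    ∀ᵐ z ∂lateralMeasure (frontier P) (Ioo a b), IsOutwardNormal P z.1 (outwardNormal P z.1) := by
  refine ae_lateral_of_flatPart hP fun n c r hn hr => ?_
  filter_upwards [ae_mem_flatPart P n c r hn] with z hz
  exact isOutwardNormal_outwardNormal (isOutwardNormal_of_mem_flatPart hn hr hz.1)

theorem isCollar_normal (hn : ‖n‖ = 1) {c r : ℝ} (hr : 0 < r) :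
    IsCollar (lateralMeasure (flatPart P n c r) (Ioo a b)) id ((-n, 0) : SpaceTime d) r
      (P ×ˢ Ioo a b) := by
  have hnn : inner ℝ n n = (1 : ℝ) := by rw [real_inner_self_eq_norm_sq, hn]; norm_num
  refine isCollar_lateral (isClosed_flatPart P n c r).measurableSet (by rintro rfl; simp at hn)
    (flatPart_subset_hyperplane P n c r) measurableSet_Ioo (by rw [inner_neg_right, hnn]; norm_num)
    hr fun x hx s hs => (hx.2 _ ?_).2 ?_
  · rw [Metric.mem_ball, dist_eq_norm, add_sub_cancel_left, norm_smul, norm_neg, hn, mul_one,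
      Real.norm_of_nonneg hs.1.le]
    exact hs.2
  · rw [add_sub_cancel_left, inner_smul_right, inner_neg_right, hnn]
    linarith [hs.1]

theorem sFinite_lateralMeasure_flatPart (P : Set (Space d)) (hn : ‖n‖ = 1) (c r : ℝ) (I : Set ℝ) :
    SFinite (lateralMeasure (flatPart P n c r) I) := by
  have := sFinite_restrict_of_subset_hyperplane (n := n) (c := c) (by rintro rfl; simp at hn)
    (flatPart_subset_hyperplane P n c r)
  unfold lateralMeasure
  infer_instance

theorem ae_hasRightMean_flatPart (hP : IsPolytope P) (hn : ‖n‖ = 1) (c : ℝ) {r : ℝ} (hr : 0 < r)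
    {u : L2 (P ×ˢ Ioo a b)} (hu : u ∈ H1 (P ×ˢ Ioo a b)) :
    ∀ᵐ z ∂lateralMeasure (flatPart P n c r) (Ioo a b),
      HasRightMean (fun s => zeroExt _ u (z + s • ((-n, 0) : SpaceTime d)))
        (trace u z (outwardNormal P z.1, 0)) := by
  have := sFinite_lateralMeasure_flatPart P hn c r (Ioo a b)
  have hcn := isCollar_normal (P := P) (a := a) (b := b) hn (c := c) hr
  obtain ⟨g, hg⟩ := hu ((-n, 0) : SpaceTime d)
  obtain ⟨τ, -, hτ⟩ := hcn.exists_trace_hasRightMean (hP.isOpen_prism a b) (hP.volume_prism a b) hg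
  filter_upwards [hτ, hcn.mem, ae_mem_flatPart P n c r hn] with z hz hmem hzA
  have hN : outwardNormal P z.1 = n :=
    (isOutwardNormal_of_mem_flatPart hn hr hzA.1).outwardNormal_eq
  have htr : trace u z ((n, 0) : SpaceTime d) = τ z := by
    refine HasRightMean.trace_eq (hz.congr hr fun s hs => ?_)
    have h1 : z + s • ((-n, 0) : SpaceTime d) = z - s • ((n, 0) : SpaceTime d) := by
      ext1
      · simp [sub_eq_add_neg]
      · simp
    rw [id, ← h1, zeroExt_of_mem]
    exact hmem s hs
  rw [hN, htr]
  exact hz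

/-- The lateral trace of a Sobolev function on a prism is also the limit of the means along any
direction `e` which points into the prism. -/
theorem ae_hasRightMean_lateral (hP : IsPolytope P) (e : Space d) {u : L2 (P ×ˢ Ioo a b)}
    (hu : u ∈ H1 (P ×ˢ Ioo a b)) :
    ∀ᵐ z ∂lateralMeasure (frontier P) (Ioo a b), inner ℝ (outwardNormal P z.1) e < 0 →
      HasRightMean (fun s => zeroExt _ u (z + s • ((e, 0) : SpaceTime d)))
        (trace u z (outwardNormal P z.1, 0)) := by
  refine ae_lateral_of_flatPart hP fun n c r hn hr => ?_
  have hobl : ∀ᵐ z ∂lateralMeasure (flatPart P n c r) (Ioo a b), inner ℝ n e < 0 → ∀ τ,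
      HasRightMean (fun s => zeroExt _ u (z + s • ((e, 0) : SpaceTime d))) τ ↔
      HasRightMean (fun s => zeroExt _ u (z + s • ((-n, 0) : SpaceTime d))) τ := by
    by_cases he : inner ℝ n e < 0
    · filter_upwards [hasRightMean_oblique_iff (c := c) hP hn hr he hu] with z hz _ using hz
    · exact Eventually.of_forall fun z h => absurd h he
  filter_upwards [ae_hasRightMean_flatPart hP hn c hr hu, hobl, ae_mem_flatPart P n c r hn]
    with z hz hobl hzA he
  have hN : outwardNormal P z.1 = n :=
    (isOutwardNormal_of_mem_flatPart hn hr hzA.1).outwardNormal_eq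
  rw [hobl (hN ▸ he)]
  exact hz

theorem ae_trace_smul_add (hP : IsPolytope P) {u v : L2 (P ×ˢ Ioo a b)}
    (hu : u ∈ H1 (P ×ˢ Ioo a b)) (hv : v ∈ H1 (P ×ˢ Ioo a b)) (k : ℝ)
    (hw : k • u + v ∈ H1 (P ×ˢ Ioo a b)) :
    ∀ᵐ z ∂lateralMeasure (frontier P) (Ioo a b),
      trace (k • u + v : L2 (P ×ˢ Ioo a b)) z (outwardNormal P z.1, 0) =
        k * trace u z (outwardNormal P z.1, 0) + trace v z (outwardNormal P z.1, 0) := by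
  refine ae_lateral_of_flatPart hP fun n c r hn hr => ?_
  have := sFinite_lateralMeasure_flatPart P hn c r (Ioo a b)
  have hKm := (hP.isOpen_prism a b).measurableSet
  have hcn := isCollar_normal (P := P) (a := a) (b := b) hn (c := c) hr
  have hsum := Measure.ae_ae_of_ae_prod (hcn.ae_prod (zeroExt_smul_add hKm k u v))
  filter_upwards [ae_hasRightMean_flatPart hP hn c hr hu, ae_hasRightMean_flatPart hP hn c hr hv,
    ae_hasRightMean_flatPart hP hn c hr hw, hcn.ae_integrableOn hKm u, hcn.ae_integrableOn hKm v,
    hsum] with z h1 h2 h3 i1 i2 hs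
  refine h3.unique ((h1.const_mul k).add h2 hr (i1.2.const_mul k) i2.2 |>.congr_ae hr ?_)
  filter_upwards [hs] with s hs using hs.symm

/-- The lateral trace is square integrable. On the part of the boundary from which a fixed oblique
direction leads into the prism along a fixed length, this is a one-dimensional trace inequality. -/
theorem memLp_trace_lateral (hP : IsPolytope P) {u : L2 (P ×ˢ Ioo a b)}
    (hu : u ∈ H1 (P ×ˢ Ioo a b)) :
    MemLp (fun z => trace u z (outwardNormal P z.1, 0)) 2
      (lateralMeasure (frontier P) (Ioo a b)) := by
  obtain ⟨F, hF1, -, hF⟩ := hP.exists_flat_cover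
  obtain ⟨S, hSf, hS, hcov⟩ := hP.exists_slanted_cover
  have := hP.sFinite_frontier
  set Λ := lateralMeasure (frontier P) (Ioo a b) with hΛ
  let B : (Space d × ℝ) → (Set (Space d) × Space d) → Set (Space d) := fun q p =>
    (⋃ k : ℕ, flatPart P q.1 q.2 (1 / (k + 1 : ℝ))) ∩ p.1
  have hBm : ∀ q ∈ F, ∀ p ∈ S, MeasurableSet (B q p) := fun q _ p hp =>
    (MeasurableSet.iUnion fun k => (isClosed_flatPart _ _ _ _).measurableSet).inter (hS p hp).1
  have hpiece : ∀ q ∈ F, ∀ p ∈ S, MemLp (fun z => trace u z (outwardNormal P z.1, 0)) 2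
      (Λ.restrict (B q p ×ˢ univ)) := by
    intro q hq p hp
    rcases (B q p).eq_empty_or_nonempty with h0 | ⟨x, hx, hxp⟩
    · rw [h0]; simp
    have hq0 : q.1 ≠ 0 := by
      intro h; have := hF1 q hq; simp [h] at this
    have hBh : B q p ⊆ hyperplane q.1 q.2 := by
      rintro y ⟨hy, -⟩
      obtain ⟨k, hk⟩ := mem_iUnion.1 hy
      exact hk.1
    obtain ⟨k, hk⟩ := mem_iUnion.1 hx
    -- the direction of the piece leads inside, hence below the hyperplane
    have hneg : inner ℝ q.1 p.2 < 0 := by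
      obtain ⟨s, hs0, hs1, hs⟩ : ∃ s : ℝ, 0 < s ∧ s ≤ 1 ∧ s * ‖p.2‖ < 1 / (k + 1 : ℝ) := by
        have hk1 : (0 : ℝ) < k + 1 := by positivity
        refine ⟨1 / (k + 1 : ℝ) / (1 + ‖p.2‖), by positivity, ?_, ?_⟩
        · rw [div_le_one (by positivity), div_le_iff₀ hk1]
          nlinarith [norm_nonneg p.2, Nat.cast_nonneg (α := ℝ) k]
        · rw [div_mul_eq_mul_div, div_lt_iff₀ (by positivity)]
          have : 0 < 1 / (k + 1 : ℝ) := by positivity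
          nlinarith
      have h1 := (hS p hp).2 x hxp s ⟨hs0, hs1⟩
      have h2 := (hk.2 (x + s • p.2) (by
        rwa [Metric.mem_ball, dist_eq_norm, add_sub_cancel_left, norm_smul,
          Real.norm_of_nonneg hs0.le])).1 h1
      rw [add_sub_cancel_left, inner_smul_right] at h2
      by_contra hc
      nlinarith [mul_nonneg hs0.le (not_lt.1 hc)]
    have := sFinite_restrict_of_subset_hyperplane hq0 hBh
    have hsf : SFinite (lateralMeasure (B q p) (Ioo a b)) := by
      unfold lateralMeasure; infer_instance
    have hcol : IsCollar (lateralMeasure (B q p) (Ioo a b)) id ((p.2, 0) : SpaceTime d) 1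
        (P ×ˢ Ioo a b) :=
      isCollar_lateral (hBm q hq p hp) hq0 hBh measurableSet_Ioo hneg.ne one_pos
        fun y hy s hs => (hS p hp).2 y hy.2 s ⟨hs.1, hs.2.le⟩
    obtain ⟨g, hg⟩ := hu ((p.2, 0) : SpaceTime d)
    obtain ⟨τ, hτ2, hτ⟩ :=
      hcol.exists_trace_hasRightMean (hP.isOpen_prism a b) (hP.volume_prism a b) hg
    have hle := restrict_lateralMeasure_frontier_le hP (hBm q hq p hp) (Ioo a b)
    refine (hτ2.mono_measure hle).ae_eq ?_
    have hmem : ∀ᵐ z ∂Λ.restrict (B q p ×ˢ univ), z ∈ B q p ×ˢ (univ : Set ℝ) :=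
      ae_restrict_mem ((hBm q hq p hp).prod MeasurableSet.univ)
    filter_upwards [ae_mono hle hτ, ae_restrict_of_ae (ae_hasRightMean_lateral hP p.2 hu), hmem]
      with z h1 h2 hz
    obtain ⟨j, hj⟩ := mem_iUnion.1 hz.1.1
    have hN : outwardNormal P z.1 = q.1 :=
      (isOutwardNormal_of_mem_flatPart (hF1 q hq) (by positivity) hj).outwardNormal_eq
    exact h1.unique (h2 (by rw [hN]; exact hneg))
  have hcover : Λ.restrict (⋃ q ∈ F, ⋃ p ∈ S, B q p ×ˢ univ) = Λ := by
    refine Measure.restrict_eq_self_of_ae_mem ?_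
    have h1 : ∀ᵐ x ∂(Measure.euclideanHausdorffMeasure (d - 1)).restrict (frontier P),
        x ∉ frontier P \ ⋃ p ∈ F, ⋃ k : ℕ, flatPart P p.1 p.2 (1 / (k + 1 : ℝ)) := by
      rw [ae_iff]
      simp only [not_not, ofPred_mem_eq]
      exact nonpos_iff_eq_zero.1 ((Measure.restrict_le_self _).trans hF.le)
    have h2 := Measure.quasiMeasurePreserving_fst (ν := volume.restrict (Ioo a b)) |>.ae
      (h1.and (ae_restrict_mem isClosed_frontier.measurableSet))
    filter_upwards [h2] with z hz
    have hzF : z.1 ∈ ⋃ p ∈ F, ⋃ k : ℕ, flatPart P p.1 p.2 (1 / (k + 1 : ℝ)) := by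
      by_contra hc
      exact hz.1 ⟨hz.2, hc⟩
    obtain ⟨q, hq, hzq⟩ := mem_iUnion₂.1 hzF
    obtain ⟨p, hp, hzp⟩ := mem_iUnion₂.1 (hcov (frontier_subset_closure hz.2))
    exact mem_iUnion₂.2 ⟨q, hq, mem_iUnion₂.2 ⟨p, hp, ⟨hzq, hzp⟩, trivial⟩⟩
  rw [← hcover]
  have hunion : ∀ {ι : Type _} {s : Set ι} {t : ι → Set (SpaceTime d)}
      {f : SpaceTime d → ℝ}, s.Finite →
      (∀ i ∈ s, MemLp f 2 (Λ.restrict (t i))) → MemLp f 2 (Λ.restrict (⋃ i ∈ s, t i)) := by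
    intro ι s t f hs hf
    have hm : AEStronglyMeasurable f (Λ.restrict (⋃ i ∈ s, t i)) := by
      have := hs.countable.to_subtype
      rw [biUnion_eq_iUnion, aestronglyMeasurable_iUnion_iff]
      exact fun i => (hf i i.2).1
    rw [memLp_two_iff_integrable_sq hm]
    refine (integrableOn_finite_biUnion hs).2 fun i hi => ?_
    exact (memLp_two_iff_integrable_sq (hf i hi).1).1 (hf i hi)
  exact hunion F.finite_toSet fun q hq => hunion hSf fun p hp => hpiece q hq p hp

theorem aestronglyMeasurable_outwardNormal (hP : IsPolytope P) :
    AEStronglyMeasurable (fun z : SpaceTime d => outwardNormal P z.1)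
      (lateralMeasure (frontier P) (Ioo a b)) := by
  obtain ⟨F, hF1, -, hF⟩ := hP.exists_flat_cover
  have := hP.sFinite_frontier
  suffices h : AEStronglyMeasurable (outwardNormal P)
      ((Measure.euclideanHausdorffMeasure (d - 1)).restrict (frontier P)) from h.comp_fst
  set μ := (Measure.euclideanHausdorffMeasure (d - 1) : Measure (Space d)).restrict (frontier P)
  have hcover : μ.restrict (⋃ q ∈ (F : Set (Space d × ℝ)),
      ⋃ k : ℕ, flatPart P q.1 q.2 (1 / (k + 1 : ℝ))) = μ := by
    refine Measure.restrict_eq_self_of_ae_mem ?_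
    have h1 : ∀ᵐ x ∂μ,
        x ∉ frontier P \ ⋃ p ∈ F, ⋃ k : ℕ, flatPart P p.1 p.2 (1 / (k + 1 : ℝ)) := by
      rw [ae_iff]
      simp only [not_not, ofPred_mem_eq]
      exact nonpos_iff_eq_zero.1 ((Measure.restrict_le_self _).trans hF.le)
    filter_upwards [h1, ae_restrict_mem isClosed_frontier.measurableSet] with x h1 h2
    by_contra hc
    exact h1 ⟨h2, hc⟩
  rw [← hcover]
  have := F.finite_toSet.countable.to_subtype
  rw [biUnion_eq_iUnion, aestronglyMeasurable_iUnion_iff]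
  intro q
  rw [aestronglyMeasurable_iUnion_iff]
  intro k
  refine (aestronglyMeasurable_const (b := q.1.1)).congr ?_
  filter_upwards [ae_restrict_mem (isClosed_flatPart P q.1.1 q.1.2 _).measurableSet] with x hx
  exact (isOutwardNormal_of_mem_flatPart (hF1 q q.2) (by positivity) hx).outwardNormal_eq.symm

end Lateral

/-! ### Weak derivatives -/

section WeakDeriv

variable {d : ℕ} {K : Set (SpaceTime d)} {e : SpaceTime d}

theorem hasWeakDeriv_weakDeriv {u : L2 K} (hu : u ∈ H1 K) (e : SpaceTime d) :
    HasWeakDeriv K e u (weakDeriv K e u) := by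
  rw [weakDeriv, dif_pos (hu e)]
  exact (hu e).choose_spec

theorem HasWeakDeriv.unique (hK : IsOpen K) {u g g' : L2 K} (h : HasWeakDeriv K e u g)
    (h' : HasWeakDeriv K e u g') : g = g' := by
  have hKm := hK.measurableSet
  have hloc : ∀ g : L2 K, LocallyIntegrable (zeroExt K g) := fun g =>
    (memLp_zeroExt hKm g).locallyIntegrable (by norm_num)
  have key := hK.ae_eq_zero_of_integral_contDiff_smul_eq_zero
    (((hloc g).sub (hloc g')).locallyIntegrableOn K) (fun φ h1 h2 h3 => ?_)
  · refine Lp.ext ((ae_restrict_iff' hKm).2 ?_)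
    filter_upwards [key] with w hw hwK
    have := hw hwK
    simp only [Pi.sub_apply, zeroExt_of_mem _ hwK] at this
    exact sub_eq_zero.1 this
  · have i : ∀ g : L2 K, Integrable fun z => zeroExt K g z * φ z := fun g => by
      simpa [mul_comm] using
        (hloc g).integrable_smul_left_of_hasCompactSupport h1.continuous h2
    have e1 := h.integral_zeroExt hKm h1 h2 h3
    have e2 := h'.integral_zeroExt hKm h1 h2 h3
    simp only [Pi.sub_apply, smul_eq_mul, mul_sub]
    simp_rw [mul_comm (φ _)]
    rw [integral_sub (i g) (i g')]
    linarith

theorem HasWeakDeriv.smul_add (hK : IsOpen K) {u v g g' : L2 K} (k : ℝ)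
    (h : HasWeakDeriv K e u g) (h' : HasWeakDeriv K e v g') :
    HasWeakDeriv K e (k • u + v) (k • g + g') := by
  intro φ h1 h2 h3
  have hKm := hK.measurableSet
  have hφ' : Continuous fun z => fderiv ℝ φ z e :=
    (h1.continuous_fderiv (by simp)).clm_apply continuous_const
  have i1 : ∀ g : L2 K, Integrable (fun z => g z * φ z) (volume.restrict K) := fun g =>
    (Lp.memLp g).integrable_mul
      ((h1.continuous.memLp_of_hasCompactSupport (p := 2) h2).restrict K)
  have i2 : ∀ g : L2 K, Integrable (fun z => g z * fderiv ℝ φ z e) (volume.restrict K) := fun g =>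
    (Lp.memLp g).integrable_mul
      ((hφ'.memLp_of_hasCompactSupport (p := 2) (h2.fderiv_apply ℝ e)).restrict K)
  have hsum : ∀ (u v : L2 K) (f : SpaceTime d → ℝ),
      Integrable (fun z => u z * f z) (volume.restrict K) →
      Integrable (fun z => v z * f z) (volume.restrict K) →
      ∫ z in K, (k • u + v : L2 K) z * f z = k * (∫ z in K, u z * f z) + ∫ z in K, v z * f z := by
    intro u v f hu hv
    rw [← integral_const_mul, ← integral_add (hu.const_mul k) hv]
    refine integral_congr_ae ?_
    filter_upwards [Lp.coeFn_add (k • u) v, Lp.coeFn_smul k u] with z h1 h2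
    rw [h1, Pi.add_apply, h2, Pi.smul_apply, smul_eq_mul]
    ring
  rw [hsum u v _ (i2 u) (i2 v), hsum g g' _ (i1 g) (i1 g'), h φ h1 h2 h3, h' φ h1 h2 h3]
  ring

theorem weakDeriv_smul_add (hK : IsOpen K) {u v : L2 K} (hu : u ∈ H1 K) (hv : v ∈ H1 K) (k : ℝ)
    (e : SpaceTime d) :
    weakDeriv K e (k • u + v) = k • weakDeriv K e u + weakDeriv K e v := by
  have h := (hasWeakDeriv_weakDeriv hu e).smul_add hK k (hasWeakDeriv_weakDeriv hv e)
  have h' : HasWeakDeriv K e (k • u + v) (weakDeriv K e (k • u + v)) := by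
    rw [weakDeriv, dif_pos ⟨_, h⟩]
    exact Exists.choose_spec (⟨_, h⟩ : ∃ g, HasWeakDeriv K e (k • u + v) g)
  exact h'.unique hK h

end WeakDeriv

/-! ### Traces at the initial and the final time of a prism -/

section TimeTrace

variable {d : ℕ} {P : Set (Space d)} {a b : ℝ}

theorem integral_primitive_mul {g : ℝ → ℝ} {δ : ℝ} (hg : IntervalIntegrable g volume 0 δ) :
    ∫ s in (0 : ℝ)..δ, (∫ r in (0 : ℝ)..s, g r) * g s = 1 / 2 * (∫ s in (0 : ℝ)..δ, g s) ^ 2 := by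
  have hac := hg.absolutelyContinuousOnInterval_intervalIntegral (c := 0) (by simp)
  have h1 := hac.integral_deriv_mul_eq_sub hac
  have h2 : ∫ x in (0 : ℝ)..δ,
      deriv (fun s => ∫ r in (0 : ℝ)..s, g r) x * (∫ r in (0 : ℝ)..x, g r) +
      (∫ r in (0 : ℝ)..x, g r) * deriv (fun s => ∫ r in (0 : ℝ)..s, g r) x =
      ∫ s in (0 : ℝ)..δ, 2 * ((∫ r in (0 : ℝ)..s, g r) * g s) := by
    refine intervalIntegral.integral_congr_ae ?_
    filter_upwards [hg.ae_hasDerivAt_integral] with x hx hx'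
    rw [(hx (uIoc_subset_uIcc hx') 0 (by simp)).deriv]
    ring
  rw [h2, intervalIntegral.integral_const_mul, intervalIntegral.integral_same] at h1
  linarith

theorem isCollar_time (hP : IsPolytope P) {t σ : ℝ} (hσ : σ = 1 ∨ σ = -1) (hab : a < b)
    (hmem : ∀ s ∈ Ioo 0 (b - a), t + s * σ ∈ Ioo a b) :
    IsCollar (volume.restrict P) (fun x => (x, t)) ((0, σ) : SpaceTime d) (b - a)
      (P ×ˢ Ioo a b) := by
  refine ⟨by fun_prop, by linarith, ?_, 1, ?_⟩
  · filter_upwards [ae_restrict_mem hP.2.1.measurableSet] with x hx s hs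
    exact ⟨by simpa using hx, by simpa using hmem s hs⟩
  · have h1 : MeasurePreserving (fun s : ℝ => t + s * σ) volume volume := by
      rcases hσ with rfl | rfl
      · simpa using measurePreserving_add_left (volume : Measure ℝ) t
      · simpa [sub_eq_add_neg] using Measure.measurePreserving_sub_left (volume : Measure ℝ) t
    have h2 := (MeasurePreserving.id (volume : Measure (Space d))).prod h1
    have h3 : (fun p : Space d × ℝ => ((p.1, t) : SpaceTime d) + p.2 • ((0, σ) : SpaceTime d)) =
        Prod.map id fun s : ℝ => t + s * σ := by
      funext p
      simp [Prod.map]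
    rw [h3, one_smul]
    calc _ ≤ Measure.map (Prod.map id fun s : ℝ => t + s * σ)
          ((volume : Measure (Space d)).prod (volume : Measure ℝ)) := by
          refine Measure.map_mono ?_ h2.measurable
          exact Measure.prod_mono Measure.restrict_le_self Measure.restrict_le_self
      _ = volume := h2.map_eq

theorem isCollar_bottom (hP : IsPolytope P) (hab : a < b) :
    IsCollar (volume.restrict P) (fun x => (x, a)) ((0, 1) : SpaceTime d) (b - a)
      (P ×ˢ Ioo a b) :=
  isCollar_time hP (Or.inl rfl) hab fun s hs => ⟨by linarith [hs.1], by linarith [hs.2]⟩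

theorem isCollar_top (hP : IsPolytope P) (hab : a < b) :
    IsCollar (volume.restrict P) (fun x => (x, b)) ((0, -1) : SpaceTime d) (b - a)
      (P ×ˢ Ioo a b) :=
  isCollar_time hP (Or.inr rfl) hab fun s hs => ⟨by linarith [hs.2], by linarith [hs.1]⟩

/-- On an end of the prism, described by a collar, the trace is the limit of means. -/
theorem ae_hasRightMean_time (hP : IsPolytope P) {t σ δ : ℝ}
    (hc : IsCollar (volume.restrict P) (fun x => (x, t)) ((0, σ) : SpaceTime d) δ (P ×ˢ Ioo a b))
    {u : L2 (P ×ˢ Ioo a b)} (hu : u ∈ H1 (P ×ˢ Ioo a b)) :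
    MemLp (fun x : Space d => trace u (x, t) (0, -σ)) 2 (volume.restrict P) ∧
    ∀ᵐ x ∂volume.restrict P, HasRightMean
      (fun s => zeroExt _ u (((x, t) : SpaceTime d) + s • ((0, σ) : SpaceTime d)))
      (trace u (x, t) (0, -σ)) := by
  obtain ⟨g, hg⟩ := hu ((0, σ) : SpaceTime d)
  obtain ⟨τ, hτ2, hτ⟩ :=
    hc.exists_trace_hasRightMean (hP.isOpen_prism a b) (hP.volume_prism a b) hg
  have htr : ∀ᵐ x ∂volume.restrict P, τ x = trace u (x, t) (0, -σ) := by
    filter_upwards [hτ, hc.mem] with x hx hmem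
    refine (HasRightMean.trace_eq (hx.congr hc.pos fun s hs => ?_)).symm
    have h1 : ((x, t) : SpaceTime d) + s • ((0, σ) : SpaceTime d) =
        (x, t) - s • ((0, -σ) : SpaceTime d) := by
      ext1 <;> simp
    rw [← h1, zeroExt_of_mem]
    exact hmem s hs
  refine ⟨hτ2.ae_eq htr, ?_⟩
  filter_upwards [hτ, htr] with x h1 h2
  rw [← h2]
  exact h1

theorem ae_time_trace_smul_add (hP : IsPolytope P) {t σ δ : ℝ}
    (hc : IsCollar (volume.restrict P) (fun x => (x, t)) ((0, σ) : SpaceTime d) δ (P ×ˢ Ioo a b))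
    {u v : L2 (P ×ˢ Ioo a b)} (hu : u ∈ H1 (P ×ˢ Ioo a b)) (hv : v ∈ H1 (P ×ˢ Ioo a b)) (k : ℝ)
    (hw : k • u + v ∈ H1 (P ×ˢ Ioo a b)) :
    ∀ᵐ x ∂volume.restrict P,
      trace (k • u + v : L2 (P ×ˢ Ioo a b)) ((x, t) : SpaceTime d) (0, -σ) =
        k * trace u (x, t) (0, -σ) + trace v (x, t) (0, -σ) := by
  have hKm := (hP.isOpen_prism a b).measurableSet
  have hsum := Measure.ae_ae_of_ae_prod (hc.ae_prod (zeroExt_smul_add hKm k u v))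
  filter_upwards [(ae_hasRightMean_time hP hc hu).2, (ae_hasRightMean_time hP hc hv).2,
    (ae_hasRightMean_time hP hc hw).2, hc.ae_integrableOn hKm u, hc.ae_integrableOn hKm v,
    hsum] with x h1 h2 h3 i1 i2 hs
  refine h3.unique ((h1.const_mul k).add h2 hc.pos (i1.2.const_mul k) i2.2 |>.congr_ae hc.pos ?_)
  filter_upwards [hs] with s hs using hs.symm

/-- `∫ u ∂ₜu` over a prism is half the difference of the squared traces at its ends. -/
theorem integral_weakDeriv_time_mul_self (hP : IsPolytope P) (hab : a < b)
    {u : L2 (P ×ˢ Ioo a b)} (hu : u ∈ H1 (P ×ˢ Ioo a b)) :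
    ∫ z in P ×ˢ Ioo a b, weakDeriv (P ×ˢ Ioo a b) (timeDir d) u z * u z =
      1 / 2 * ((∫ x in P, trace u ((x, b) : SpaceTime d) (0, 1) ^ 2) -
        ∫ x in P, trace u ((x, a) : SpaceTime d) (0, -1) ^ 2) := by
  have hK := hP.isOpen_prism a b
  have hKm := hK.measurableSet
  have hcb := isCollar_bottom hP hab
  have hct := isCollar_top hP hab
  have hbot := ae_hasRightMean_time hP hcb hu
  have htop := ae_hasRightMean_time hP hct hu
  rw [neg_neg] at htop
  set g := weakDeriv (P ×ˢ Ioo a b) (timeDir d) u with hg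
  have hug : HasWeakDeriv (P ×ˢ Ioo a b) ((0, 1) : SpaceTime d) u g := hasWeakDeriv_weakDeriv hu _
  obtain ⟨τ, -, hτ⟩ := hcb.exists_trace hK (hP.volume_prism a b) hug
  have hint : Integrable (fun z => g z * u z) (volume.restrict (P ×ˢ Ioo a b)) :=
    (Lp.memLp g).integrable_mul (Lp.memLp u)
  have hfub : ∫ z in P ×ˢ Ioo a b, g z * u z = ∫ x in P, ∫ t in Ioo a b, g (x, t) * u (x, t) :=
    setIntegral_prod (fun z : SpaceTime d => g z * u z) hint
  rw [hfub, ← integral_sub htop.1.integrable_sq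
    hbot.1.integrable_sq, ← integral_const_mul]
  refine integral_congr_ae ?_
  filter_upwards [hbot.2, htop.2, hτ, hcb.ae_integrableOn hKm g,
    ae_restrict_mem hP.2.1.measurableSet] with x hb ht hx hgi hxP
  have hδ : 0 < b - a := by linarith
  have hpt : ∀ s : ℝ, ((x, a) : SpaceTime d) + s • ((0, 1) : SpaceTime d) = (x, a + s) := by
    intro s; ext1 <;> simp
  have hpt' : ∀ s : ℝ, ((x, b) : SpaceTime d) + s • ((0, -1) : SpaceTime d) = (x, b - s) := by
    intro s; ext1 <;> simp [sub_eq_add_neg]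
  simp only [hpt, hpt'] at hb ht hx hgi
  set G : ℝ → ℝ := fun s => zeroExt (P ×ˢ Ioo a b) g (x, a + s) with hG
  set U : ℝ → ℝ := fun s => zeroExt (P ×ˢ Ioo a b) u (x, a + s) with hU
  have hGi : IntervalIntegrable G volume 0 (b - a) := by
    rw [intervalIntegrable_iff_integrableOn_Ioo_of_le hδ.le]
    exact hgi.2
  have hb' : trace u ((x, a) : SpaceTime d) (0, -1) = τ x :=
    hb.unique (HasRightMean.of_eq_add_primitive hδ hgi.2 hx)
  have ht' : trace u ((x, b) : SpaceTime d) (0, 1) = τ x + ∫ r in (0 : ℝ)..(b - a), G r := by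
    refine ht.unique (HasRightMean.of_eq_add_primitive (g := fun r => -G (b - a - r)) hδ ?_ ?_)
    · have := hGi.comp_sub_left (b - a)
      rw [sub_zero, sub_self] at this
      exact ((intervalIntegrable_iff_integrableOn_Ioo_of_le hδ.le).1 this.symm).neg
    · have h1 : ∀ᵐ s, s ∈ Ioo 0 (b - a) → U s = τ x + ∫ r in (0 : ℝ)..s, G r :=
        (ae_restrict_iff' measurableSet_Ioo).1 hx
      have h2 := (Measure.measurePreserving_sub_left (volume : Measure ℝ)
        (b - a)).quasiMeasurePreserving.ae h1
      refine (ae_restrict_iff' measurableSet_Ioo).2 ?_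
      filter_upwards [h2] with s hs hs'
      have h3 := hs ⟨by linarith [hs'.2], by linarith [hs'.1]⟩
      have h4 : U (b - a - s) = zeroExt (P ×ˢ Ioo a b) u (x, b - s) := by
        simp only [hU]; congr 2; ring
      rw [← h4, h3, intervalIntegral.integral_neg, intervalIntegral.integral_comp_sub_left,
        sub_zero, add_assoc, ← sub_eq_add_neg]
      congr 1
      rw [eq_sub_iff_add_eq]
      refine intervalIntegral.integral_add_adjacent_intervals (hGi.mono_set ?_) (hGi.mono_set ?_)
      · rw [uIcc_of_le (by linarith [hs'.2]), uIcc_of_le hδ.le]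
        exact Icc_subset_Icc le_rfl (by linarith [hs'.1])
      · rw [uIcc_of_le (by linarith [hs'.1]), uIcc_of_le hδ.le]
        exact Icc_subset_Icc (by linarith [hs'.2]) le_rfl
  have hlhs : ∫ t in Ioo a b, g (x, t) * u (x, t) = ∫ s in (0 : ℝ)..(b - a), U s * G s := by
    have h1 : ∫ t in Ioo a b, g (x, t) * u (x, t) = ∫ t in Ioo a b,
        zeroExt (P ×ˢ Ioo a b) u (x, t) * zeroExt (P ×ˢ Ioo a b) g (x, t) := by
      refine setIntegral_congr_fun measurableSet_Ioo fun t ht => ?_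
      have hm : ((x, t) : SpaceTime d) ∈ P ×ˢ Ioo a b := ⟨hxP, ht⟩
      simp only [zeroExt_of_mem _ hm, mul_comm]
    rw [h1, ← integral_Ioc_eq_integral_Ioo, ← intervalIntegral.integral_of_le hab.le]
    have := intervalIntegral.integral_comp_add_left (a := 0) (b := b - a) (fun t =>
      zeroExt (P ×ˢ Ioo a b) u (x, t) * zeroExt (P ×ˢ Ioo a b) g (x, t)) a
    rw [add_zero, add_sub_cancel] at this
    exact this.symm
  have hUG : ∫ s in (0 : ℝ)..(b - a), U s * G s =
      ∫ s in (0 : ℝ)..(b - a), (τ x * G s + (∫ r in (0 : ℝ)..s, G r) * G s) := by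
    rw [intervalIntegral.integral_of_le hδ.le, intervalIntegral.integral_of_le hδ.le,
      integral_Ioc_eq_integral_Ioo, integral_Ioc_eq_integral_Ioo]
    refine integral_congr_ae ?_
    filter_upwards [hx] with s hs
    simp only [hU]
    rw [hs]
    ring
  have hcont : ContinuousOn (fun s => ∫ r in (0 : ℝ)..s, G r) (uIcc 0 (b - a)) :=
    intervalIntegral.continuousOn_primitive_interval' hGi (by simp)
  rw [hlhs, hUG, intervalIntegral.integral_add (hGi.const_mul _) (hGi.continuousOn_mul hcont),
    intervalIntegral.integral_const_mul, integral_primitive_mul hGi, hb', ht']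
  ring

end TimeTrace

/-! ### Generic lines -/

section Lines

variable {d : ℕ}

/-- Finitely many hyperplanes through the origin do not cover the space. -/
theorem exists_transversal (F : Finset (Space d × ℝ)) (hF : ∀ q ∈ F, ‖q.1‖ = 1) :
    ∃ e : Space d, ∀ q ∈ F, inner ℝ q.1 e ≠ 0 := by
  have hnull : (volume : Measure (Space d)) (⋃ q ∈ F, hyperplane q.1 0) = 0 :=
    (measure_biUnion_null_iff F.countable_toSet).2 fun q hq =>
      volume_hyperplane (by intro h; have := hF q hq; simp [h] at this) 0
  by_contra hc
  push Not at hc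
  have huniv : (univ : Set (Space d)) ⊆ ⋃ q ∈ F, hyperplane q.1 0 := by
    intro e _
    obtain ⟨q, hq, h0⟩ := hc e
    exact mem_iUnion₂.2 ⟨q, hq, h0⟩
  have := measure_mono_null huniv hnull
  exact (isOpen_univ.measure_pos volume univ_nonempty).ne' this

theorem ae_forall_line_of_ae_hyperplane {n : Space d} (hn : n ≠ 0) (c : ℝ) {e : Space d}
    (he : inner ℝ n e ≠ 0) {p : SpaceTime d → Prop}
    (hp : ∀ᵐ z ∂lateralMeasure (hyperplane n c) univ, p z) :
    ∀ᵐ w : SpaceTime d, ∀ s : ℝ, w.1 + s • e ∈ hyperplane n c →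
      p (w + s • ((e, 0) : SpaceTime d)) := by
  obtain ⟨C, hC, hmap⟩ := exists_map_lateralMeasure hn c he
  have := sFinite_hyperplane hn c
  set Λ := lateralMeasure (hyperplane n c) univ with hΛ
  have : SFinite Λ := by rw [hΛ, lateralMeasure]; infer_instance
  set N := toMeasurable Λ {z | ¬ p z} with hN
  have hN0 : Λ N = 0 := by rw [hN, measure_toMeasurable]; exact ae_iff.1 hp
  have hNm : MeasurableSet N := measurableSet_toMeasurable _ _
  -- the projection onto the hyperplane along `e`
  let π : SpaceTime d → SpaceTime d := fun w =>
    w + ((c - inner ℝ n w.1) / inner ℝ n e) • ((e, 0) : SpaceTime d)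
  have hπ : Measurable π := by
    have : Continuous π := by fun_prop
    exact this.measurable
  have hπ0 : (volume : Measure (SpaceTime d)) (π ⁻¹' N) = 0 := by
    have h1 : (C • (volume : Measure (SpaceTime d))) (π ⁻¹' N) = 0 := by
      rw [← hmap, Measure.map_apply (by fun_prop) (hπ hNm)]
      have h2 : ∀ᵐ z ∂Λ, z.1 ∈ hyperplane n c :=
        Measure.quasiMeasurePreserving_fst.ae
          (ae_restrict_mem (isClosed_hyperplane n c).measurableSet)
      have h3 : ∀ᵐ z ∂Λ, z ∉ N := by rw [ae_iff]; simpa using hN0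
      have h4 := (Measure.quasiMeasurePreserving_fst (μ := Λ) (ν := (volume : Measure ℝ))).ae
        (h2.and h3)
      rw [ae_iff] at h4
      refine measure_mono_null ?_ h4
      rintro ⟨z, s⟩ hz ⟨hz1, hz2⟩
      apply hz2
      have hz1 : inner ℝ n z.1 = c := hz1
      have : π (z + s • ((e, 0) : SpaceTime d)) = z := by
        simp only [π, Prod.fst_add, Prod.smul_fst]
        rw [inner_add_right, inner_smul_right, hz1, add_assoc, ← add_smul]
        have : s + (c - (c + s * inner ℝ n e)) / inner ℝ n e = 0 := by
          field_simp
          ring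
        rw [this]; simp
      change z ∈ N
      rw [← this]
      exact hz
    rw [Measure.smul_apply] at h1
    exact (smul_eq_zero.1 h1).resolve_left hC
  have h5 : ∀ᵐ w : SpaceTime d, π w ∉ N := by rw [ae_iff]; simp only [not_not]; exact hπ0
  filter_upwards [h5] with w hw s hs
  have hs : inner ℝ n (w.1 + s • e) = c := hs
  have h6 : π w = w + s • ((e, 0) : SpaceTime d) := by
    simp only [π]
    congr 2
    rw [← hs, inner_add_right, inner_smul_right]
    field_simp
    ring
  rw [← h6]
  by_contra hc
  exact hw (subset_toMeasurable Λ _ hc)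

/-- Almost every line in a transversal direction only meets the lateral boundary of a prism in
points of a given set of full measure. -/
theorem ae_forall_line_of_ae_lateral {P : Set (Space d)} {a b : ℝ} {F : Finset (Space d × ℝ)}
    (hF1 : ∀ q ∈ F, ‖q.1‖ = 1) (hF : frontier P ⊆ ⋃ q ∈ F, hyperplane q.1 q.2) {e : Space d}
    (he : ∀ q ∈ F, inner ℝ q.1 e ≠ 0) {p : SpaceTime d → Prop}
    (hp : ∀ᵐ z ∂lateralMeasure (frontier P) (Ioo a b), p z) :
    ∀ᵐ w : SpaceTime d, w.2 ∈ Ioo a b → ∀ s : ℝ, w.1 + s • e ∈ frontier P →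
      p (w + s • ((e, 0) : SpaceTime d)) := by
  have hq : ∀ q ∈ F, ∀ᵐ w : SpaceTime d, ∀ s : ℝ, w.1 + s • e ∈ hyperplane q.1 q.2 →
      (w.1 + s • e ∈ frontier P → w.2 ∈ Ioo a b → p (w + s • ((e, 0) : SpaceTime d))) := by
    intro q hq
    have hq0 : q.1 ≠ 0 := by intro h; have := hF1 q hq; simp [h] at this
    have := sFinite_hyperplane hq0 q.2
    have hfm : MeasurableSet (frontier P) := isClosed_frontier.measurableSet
    have h1 : ∀ᵐ z ∂lateralMeasure (hyperplane q.1 q.2) univ,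
        z.1 ∈ frontier P → z.2 ∈ Ioo a b → p z := by
      have h2 : ∀ᵐ z ∂(lateralMeasure (hyperplane q.1 q.2) univ).restrict
          (frontier P ×ˢ Ioo a b), p z := by
        refine ae_mono ?_ hp
        rw [lateralMeasure, Measure.restrict_univ, ← Measure.prod_restrict]
        refine Measure.prod_mono ?_ le_rfl
        rw [Measure.restrict_restrict hfm]
        exact Measure.restrict_mono inter_subset_left le_rfl
      rw [ae_restrict_iff' (hfm.prod measurableSet_Ioo)] at h2
      filter_upwards [h2] with z hz h3 h4 using hz ⟨h3, h4⟩
    filter_upwards [ae_forall_line_of_ae_hyperplane hq0 q.2 (he q hq) h1] with w hw s hs h3 h4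
    exact hw s hs (by simpa using h3) (by simpa using h4)
  filter_upwards [(Finset.eventually_all F).2 hq] with w hw hwI s hs
  obtain ⟨q, hqF, hsq⟩ := mem_iUnion₂.1 (hF hs)
  exact hw q hqF s hsq hs hwI

theorem ae_ae_line {p : SpaceTime d → Prop} (hp : ∀ᵐ w, p w) (e : SpaceTime d) :
    ∀ᵐ w : SpaceTime d, ∀ᵐ s : ℝ, p (w + s • e) := by
  set N := toMeasurable (volume : Measure (SpaceTime d)) {z | ¬ p z} with hN
  have hN0 : volume N = 0 := by rw [hN, measure_toMeasurable]; exact ae_iff.1 hp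
  have hNm : MeasurableSet N := measurableSet_toMeasurable _ _
  have hm : Measurable fun q : ℝ × SpaceTime d => q.2 + q.1 • e := by fun_prop
  have h1 : ((volume : Measure ℝ).prod (volume : Measure (SpaceTime d)))
      ((fun q : ℝ × SpaceTime d => q.2 + q.1 • e) ⁻¹' N) = 0 := by
    rw [Measure.measure_prod_null (hm hNm)]
    refine Eventually.of_forall fun s => ?_
    change volume ((fun w : SpaceTime d => w + s • e) ⁻¹' N) = 0
    rw [measure_preimage_add_right, hN0]
  have h2 : ∀ᵐ q ∂((volume : Measure ℝ).prod (volume : Measure (SpaceTime d))),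
      q.2 + q.1 • e ∉ N := by rw [ae_iff]; simp only [not_not]; exact h1
  have h3 := (Measure.measurePreserving_swap (μ := (volume : Measure (SpaceTime d)))
      (ν := (volume : Measure ℝ))).quasiMeasurePreserving.ae h2
  filter_upwards [Measure.ae_ae_of_ae_prod h3] with w hw
  filter_upwards [hw] with s hs
  by_contra hc
  exact hs (subset_toMeasurable _ _ hc)

/-- Fubini's theorem for the lines of direction `e`, parametrised redundantly by all points. -/
theorem ae_of_ae_ae_line {p : SpaceTime d → Prop} (hpm : MeasurableSet {w | p w}) (e : SpaceTime d)
    (h : ∀ᵐ w : SpaceTime d, ∀ᵐ s : ℝ, p (w + s • e)) : ∀ᵐ w, p w := by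
  have hm : Measurable fun q : SpaceTime d × ℝ => q.1 + q.2 • e := by fun_prop
  have h1 : ∀ᵐ q ∂((volume : Measure (SpaceTime d)).prod (volume : Measure ℝ)),
      p (q.1 + q.2 • e) := (Measure.ae_prod_iff_ae_ae (hm hpm)).2 h
  have h2 := (Measure.measurePreserving_swap (μ := (volume : Measure ℝ))
      (ν := (volume : Measure (SpaceTime d)))).quasiMeasurePreserving.ae h1
  obtain ⟨s, hs⟩ := (Measure.ae_ae_of_ae_prod h2).exists
  have h3 := (measurePreserving_sub_right (volume : Measure (SpaceTime d))
    (s • e)).quasiMeasurePreserving.ae hs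
  filter_upwards [h3] with w hw
  simpa using hw

/-- A function without derivative in the direction `e` is constant on the segments of almost every
line in this direction. -/
theorem HasWeakDeriv.ae_const_on_lines {K : Set (SpaceTime d)} (hK : IsOpen K)
    (hfin : volume K ≠ ⊤) {e : SpaceTime d} {u : L2 K} (h : HasWeakDeriv K e u 0) :
    ∀ᵐ w : SpaceTime d, ∀ s₀ s₁ : ℝ, s₀ < s₁ → (∀ s ∈ Ioo s₀ s₁, w + s • e ∈ K) →
      ∃ c : ℝ, ∀ᵐ s, s ∈ Ioo s₀ s₁ → zeroExt K u (w + s • e) = c := by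
  have h0 : ∀ᵐ w, zeroExt K (0 : L2 K) w = 0 := by
    filter_upwards [(ae_restrict_iff' hK.measurableSet).1 (Lp.coeFn_zero ℝ 2 (volume.restrict K))]
      with w hw
    by_cases hwK : w ∈ K
    · rw [zeroExt_of_mem _ hwK, hw hwK, Pi.zero_apply]
    · simp [zeroExt, hwK]
  have h1 : ∀ᵐ w : SpaceTime d, ∀ᵐ s : ℝ, (∀ r ∈ Icc (0 : ℝ) 1, w + (r * s) • e ∈ K) →
      zeroExt K u (w + s • e) = zeroExt K u w := by
    filter_upwards [h.ae_shift hK hfin, ae_ae_line h0 e] with w hw hw0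
    filter_upwards [hw] with s hs hseg
    have h2 := hs hseg
    rw [intervalIntegral.integral_zero_ae (by filter_upwards [hw0] with r hr _ using hr)] at h2
    linarith
  filter_upwards [ae_ae_line h1 e] with w hw s₀ s₁ hlt hseg
  have hne : NeBot (ae ((volume : Measure ℝ).restrict (Ioo s₀ s₁))) := by
    rw [ae_neBot, Ne, Measure.restrict_eq_zero]
    simp [hlt]
  obtain ⟨t, ht, htm⟩ := ((ae_restrict_of_ae (s := Ioo s₀ s₁) hw).and
    (ae_restrict_mem measurableSet_Ioo)).exists
  refine ⟨zeroExt K u (w + t • e), ?_⟩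
  filter_upwards [(measurePreserving_sub_right (volume : Measure ℝ)
    t).quasiMeasurePreserving.ae ht] with s hs hsm
  have h3 := hs (fun r hr => by
    rw [add_assoc, ← add_smul]
    exact hseg _ ((convex_Ioo s₀ s₁).add_smul_sub_mem htm hsm hr))
  rw [add_assoc, ← add_smul, add_sub_cancel] at h3
  exact h3

/-- A function on the line that is almost everywhere constant near every point, and vanishes far
out, is zero almost everywhere. -/
theorem ae_eq_zero_of_locally_const {f : ℝ → ℝ}
    (hf : ∀ s₀ : ℝ, ∃ δ > 0, ∃ c : ℝ, ∀ᵐ s, s ∈ Ioo (-δ) δ → f (s₀ + s) = c)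
    (hR : ∃ R : ℝ, ∀ s, R < s → f s = 0) : ∀ᵐ s, f s = 0 := by
  choose δ hδ c hc using hf
  have hc' : ∀ s₀, ∀ᵐ s, s ∈ Ioo (s₀ - δ s₀) (s₀ + δ s₀) → f s = c s₀ := by
    intro s₀
    filter_upwards [(measurePreserving_sub_right (volume : Measure ℝ)
      s₀).quasiMeasurePreserving.ae (hc s₀)] with s hs hsm
    rw [add_sub_cancel] at hs
    exact hs ⟨by linarith [hsm.1], by linarith [hsm.2]⟩
  have hex : ∀ a b : ℝ, a < b → ∀ p : ℝ → Prop, (∀ᵐ s, p s) → ∃ s ∈ Ioo a b, p s := by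
    intro a b hab p hp
    have hne : NeBot (ae ((volume : Measure ℝ).restrict (Ioo a b))) := by
      rw [ae_neBot, Ne, Measure.restrict_eq_zero]
      simp [hab]
    obtain ⟨t, ht, htm⟩ := ((ae_restrict_of_ae (s := Ioo a b) hp).and
      (ae_restrict_mem measurableSet_Ioo)).exists
    exact ⟨t, htm, ht⟩
  have hloc : IsLocallyConstant c := by
    rw [IsLocallyConstant.iff_eventually_eq]
    intro s₀
    filter_upwards [Ioo_mem_nhds (sub_lt_self s₀ (hδ s₀)) (lt_add_of_pos_right s₀ (hδ s₀))]
      with s₁ hs₁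
    obtain ⟨t, ht, h1, h2⟩ := hex (max (s₀ - δ s₀) (s₁ - δ s₁)) (min (s₀ + δ s₀) (s₁ + δ s₁))
      (by
        rw [max_lt_iff, lt_min_iff, lt_min_iff]
        have := hδ s₀; have := hδ s₁
        obtain ⟨h3, h4⟩ := hs₁
        refine ⟨⟨by linarith, by linarith⟩, by linarith, by linarith⟩) _
      ((hc' s₀).and (hc' s₁))
    rw [mem_Ioo, max_lt_iff, lt_min_iff] at ht
    rw [← h1 ⟨ht.1.1, ht.2.1⟩, ← h2 ⟨ht.1.2, ht.2.2⟩]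
  have hzero : ∀ s, c s = 0 := by
    obtain ⟨R, hR⟩ := hR
    intro s
    rw [hloc.apply_eq_of_preconnectedSpace s R]
    obtain ⟨t, ht, h1⟩ := hex R (R + δ R) (by linarith [hδ R]) _ (hc' R)
    rw [← h1 ⟨by linarith [ht.1, hδ R], ht.2⟩, hR t ht.1]
  rw [ae_iff]
  refine measure_null_of_locally_null _ fun s₀ _ => ?_
  refine ⟨Ioo (s₀ - δ s₀) (s₀ + δ s₀) ∩ {s | ¬ f s = 0}, ?_, ?_⟩
  · rw [inter_comm]
    exact inter_mem_nhdsWithin _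
      (Ioo_mem_nhds (sub_lt_self s₀ (hδ s₀)) (lt_add_of_pos_right s₀ (hδ s₀)))
  · refine measure_mono_null ?_ (ae_iff.1 (hc' s₀))
    rintro s ⟨h1, h2⟩ h3
    exact h2 ((h3 h1).trans (hzero s₀))

/-- Two disjoint sets with flat boundary at a common point lie on opposite sides of it. -/
theorem IsOutwardNormal.eq_neg_of_disjoint {A B : Set (Space d)} {x n m : Space d}
    (hn : IsOutwardNormal A x n) (hm : IsOutwardNormal B x m) (hAB : Disjoint A B) : m = -n := by
  obtain ⟨hn1, r, hr, hn⟩ := hn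
  obtain ⟨hm1, r', hr', hm⟩ := hm
  by_contra hne
  have hgt : -1 < inner ℝ n m := by
    have h1 : -1 ≤ inner ℝ n m := by
      have := neg_le_of_abs_le (abs_real_inner_le_norm n m)
      simpa [hn1, hm1] using this
    refine lt_of_le_of_ne h1 fun h => hne ?_
    have h2 : inner ℝ m (-n) = 1 := by rw [inner_neg_right, real_inner_comm, ← h]; norm_num
    exact (inner_eq_one_iff_of_norm_eq_one hm1 (by simpa using hn1)).1 h2
  set v : Space d := -(n + m) with hv
  obtain ⟨s, hs, hsv⟩ : ∃ s > (0 : ℝ), s * ‖v‖ < min r r' := by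
    have : 0 < min r r' := lt_min hr hr'
    refine ⟨min r r' / (2 * (‖v‖ + 1)), by positivity, ?_⟩
    rw [div_mul_eq_mul_div, div_lt_iff₀ (by positivity)]
    nlinarith [norm_nonneg v]
  have hd : ‖s • v‖ < min r r' := by rwa [norm_smul, Real.norm_of_nonneg hs.le]
  have h1 : x + s • v ∈ A := (hn _ (by simpa using hd.trans_le (min_le_left _ _))).2 (by
    rw [add_sub_cancel_left, inner_smul_right, hv, inner_neg_right, inner_add_right,
      real_inner_self_eq_norm_sq, hn1]
    nlinarith)
  have h2 : x + s • v ∈ B := (hm _ (by simpa using hd.trans_le (min_le_right _ _))).2 (by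
    rw [add_sub_cancel_left, inner_smul_right, hv, inner_neg_right, inner_add_right,
      real_inner_self_eq_norm_sq, hm1, real_inner_comm]
    nlinarith)
  exact disjoint_left.1 hAB h1 h2

end Lines

/-! ### Piecewise constancy in space and definiteness -/

section Definite

variable {d : ℕ}

theorem integrable_mul_fderiv {K : Set (SpaceTime d)} (u : L2 K) {φ : SpaceTime d → ℝ}
    (h1 : ContDiff ℝ ∞ φ) (h2 : HasCompactSupport φ) (e : SpaceTime d) :
    Integrable (fun z => u z * fderiv ℝ φ z e) (volume.restrict K) := by
  have hφ' : Continuous fun z => fderiv ℝ φ z e :=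
    (h1.continuous_fderiv (by simp)).clm_apply continuous_const
  exact (Lp.memLp u).integrable_mul
    ((hφ'.memLp_of_hasCompactSupport (p := 2) (h2.fderiv_apply (𝕜 := ℝ) e)).restrict K)

theorem hasWeakDeriv_zero_of_spaceDir {K : Set (SpaceTime d)} {u : L2 K}
    (h : ∀ k, HasWeakDeriv K (spaceDir k) u 0) (e : Space d) :
    HasWeakDeriv K ((e, 0) : SpaceTime d) u 0 := by
  intro φ h1 h2 h3
  have he : ((e, 0) : SpaceTime d) = ∑ k, e k • spaceDir k := by
    refine Prod.ext ?_ ?_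
    · simp only [Prod.fst_sum, Prod.smul_fst, spaceDir]
      exact ((EuclideanSpace.basisFun (Fin d) ℝ).sum_repr e).symm.trans (by simp)
    · simp [Prod.snd_sum, spaceDir]
  have hz : ∫ z in K, (0 : L2 K) z * φ z = 0 := by
    refine integral_eq_zero_of_ae ?_
    filter_upwards [Lp.coeFn_zero ℝ 2 (volume.restrict K)] with z hz
    rw [hz, Pi.zero_apply, zero_mul]
  rw [hz, he]
  simp only [map_sum, map_smul, smul_eq_mul, Finset.mul_sum]
  rw [integral_finsetSum]
  · rw [neg_zero]
    refine Finset.sum_eq_zero fun k _ => ?_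
    simp_rw [mul_left_comm _ (e k)]
    rw [integral_const_mul, h k φ h1 h2 h3, hz, neg_zero, mul_zero]
  · intro k _
    simp_rw [mul_left_comm _ (e k)]
    exact (integrable_mul_fderiv u h1 h2 _).const_mul _

/-- A flat boundary piece cannot contain a segment in a direction transversal to the hyperplanes
which carry the boundary. -/
theorem IsOutwardNormal.inner_ne_zero {P : Set (Space d)} {x n e : Space d}
    (hn : IsOutwardNormal P x n) {F : Finset (Space d × ℝ)}
    (hF : frontier P ⊆ ⋃ q ∈ F, hyperplane q.1 q.2) (he : ∀ q ∈ F, inner ℝ q.1 e ≠ 0) :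
    inner ℝ n e ≠ 0 := by
  intro h0
  obtain ⟨hn1, r, hr, hn⟩ := hn
  have hcont : Continuous fun s : ℝ => x + s • e := by fun_prop
  have hopen : IsOpen {s : ℝ | x + s • e ∈ Metric.ball x r} := Metric.isOpen_ball.preimage hcont
  have hinf : {s : ℝ | x + s • e ∈ Metric.ball x r}.Infinite := by
    refine infinite_of_mem_nhds (0 : ℝ) (hopen.mem_nhds ?_)
    simpa using hr
  refine hinf (Finite.subset (s := ⋃ q ∈ F, {s : ℝ | x + s • e ∈ hyperplane q.1 q.2}) ?_ ?_)
  · refine F.finite_toSet.biUnion fun q hq => Set.Subsingleton.finite ?_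
    intro s hs s' hs'
    simp only [hyperplane, mem_ofPred_eq, inner_add_right, inner_smul_right] at hs hs'
    have := he q hq
    have h2 : (s - s') * inner ℝ q.1 e = 0 := by linarith
    linarith [(mul_eq_zero.1 h2).resolve_right this]
  · intro s hs
    have hfr : x + s • e ∈ frontier P := by
      have h1 : x + s • e ∉ P := by
        rw [hn _ hs, add_sub_cancel_left, inner_smul_right, h0]
        simp
      refine ⟨?_, fun h => h1 (interior_subset h)⟩
      rw [mem_closure_iff_nhds]
      intro U hU
      have hc2 : Continuous fun σ : ℝ => x + s • e - σ • n := by fun_prop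
      have hU' : ∀ᶠ σ in 𝓝 (0 : ℝ), x + s • e - σ • n ∈ U ∩ Metric.ball x r :=
        hc2.continuousAt.preimage_mem_nhds (by
          simp only [zero_smul, sub_zero]
          exact inter_mem hU (Metric.isOpen_ball.mem_nhds hs))
      obtain ⟨σ, hσ, hσ0⟩ := ((hU'.filter_mono nhdsWithin_le_nhds).and
        (self_mem_nhdsWithin : Ioi (0 : ℝ) ∈ 𝓝[>] 0)).exists
      refine ⟨_, hσ.1, (hn _ hσ.2).2 ?_⟩
      have hσ0 : 0 < σ := hσ0
      rw [show x + s • e - σ • n - x = s • e - σ • n by abel, inner_sub_right, inner_smul_right,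
        inner_smul_right, h0, real_inner_self_eq_norm_sq, hn1]
      simpa using hσ0
    exact mem_iUnion₂.2 (by simpa using hF hfr)

theorem lateralMeasure_inter {A B : Set (Space d)} {I J : Set ℝ} (hB : MeasurableSet B)
    (hJ : MeasurableSet J) (hA : SFinite ((Measure.euclideanHausdorffMeasure (d - 1)).restrict A)) :
    lateralMeasure (A ∩ B) (I ∩ J) = (lateralMeasure A I).restrict (B ×ˢ J) := by
  rw [lateralMeasure, lateralMeasure, ← Measure.prod_restrict, Measure.restrict_restrict hB,
    Measure.restrict_restrict hJ, inter_comm A, inter_comm I]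

theorem ae_lateralMeasure_of_inter {A B : Set (Space d)} {I J : Set ℝ} (hB : MeasurableSet B)
    (hJ : MeasurableSet J) (hA : SFinite ((Measure.euclideanHausdorffMeasure (d - 1)).restrict A))
    {p : SpaceTime d → Prop} (h : ∀ᵐ z ∂lateralMeasure (A ∩ B) (I ∩ J), p z) :
    ∀ᵐ z ∂lateralMeasure A I, z.1 ∈ B → z.2 ∈ J → p z := by
  rw [lateralMeasure_inter hB hJ hA, ae_restrict_iff' (hB.prod hJ)] at h
  filter_upwards [h] with z hz h1 h2 using hz ⟨h1, h2⟩

end Definite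

namespace PrismaticMesh

variable {d : ℕ} {Ω : Set (Space d)} {T : ℝ} {𝒯 : PrismaticMesh Ω T}

theorem isOpen_elem (i : Fin 𝒯.N) : IsOpen (𝒯.elem i) := (𝒯.base_polytope i).isOpen_prism _ _

theorem disjoint_base_of_mem {i j : Fin 𝒯.N} (hij : i ≠ j) {t : ℝ} (hi : t ∈ 𝒯.interval i)
    (hj : t ∈ 𝒯.interval j) : Disjoint (𝒯.base i) (𝒯.base j) := by
  rw [disjoint_left]
  intro x hx hx'
  exact disjoint_left.1 (𝒯.disjoint hij) (show (x, t) ∈ _ from ⟨hx, hi⟩) ⟨hx', hj⟩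

theorem notMem_closure_base {i j : Fin 𝒯.N} (hij : i ≠ j) {t : ℝ} (hi : t ∈ 𝒯.interval i)
    (hj : t ∈ 𝒯.interval j) {x : Space d} (hx : x ∈ 𝒯.base i) : x ∉ closure (𝒯.base j) :=
  disjoint_left.1 ((disjoint_base_of_mem hij hi hj).closure_right (𝒯.base_polytope i).2.1) hx

theorem exists_mem_closure_base {x : Space d} {t : ℝ} (hx : x ∈ closure Ω) (ht : t ∈ Icc 0 T)
    (hT : 0 < T) : ∃ j, x ∈ closure (𝒯.base j) ∧ t ∈ Icc (𝒯.tMin j) (𝒯.tMax j) := by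
  have : (x, t) ∈ closure (Ω ×ˢ Ioo 0 T) := by
    rw [closure_prod_eq, closure_Ioo hT.ne]
    exact ⟨hx, ht⟩
  rw [← 𝒯.cover] at this
  obtain ⟨j, hj⟩ := mem_iUnion.1 this
  rw [closure_prod_eq, closure_Ioo (𝒯.tMin_lt_tMax j).ne] at hj
  exact ⟨j, hj.1, hj.2⟩

/-- At a flat boundary point, two adjacent elements leave no room for a third one. -/
theorem notMem_closure_of_adjacent {i j k : Fin 𝒯.N} (hki : k ≠ i) (hkj : k ≠ j)
    {t : ℝ} (hi : t ∈ 𝒯.interval i) (hj : t ∈ 𝒯.interval j) (hk : t ∈ 𝒯.interval k)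
    {x n : Space d} (hni : IsOutwardNormal (𝒯.base i) x n)
    (hnj : IsOutwardNormal (𝒯.base j) x (-n)) : x ∉ closure (𝒯.base k) := by
  obtain ⟨hn1, r, hr, hn⟩ := hni
  obtain ⟨-, r', hr', hn'⟩ := hnj
  intro hx
  have hn0 : n ≠ 0 := by rintro rfl; simp at hn1
  set ρ := min r r'
  have hB : (Metric.ball x ρ ∩ 𝒯.base k).Nonempty :=
    mem_closure_iff.1 hx _ Metric.isOpen_ball (Metric.mem_ball_self (lt_min hr hr'))
  have hsub : Metric.ball x ρ ∩ 𝒯.base k ⊆ hyperplane n (inner ℝ n x) := by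
    rintro y ⟨hy, hyk⟩
    have h1 := mt (hn y (Metric.ball_subset_ball (min_le_left _ _) hy)).2
      (disjoint_left.1 (disjoint_base_of_mem hki hk hi) hyk)
    have h2 := mt (hn' y (Metric.ball_subset_ball (min_le_right _ _) hy)).2
      (disjoint_left.1 (disjoint_base_of_mem hkj hk hj) hyk)
    rw [inner_neg_left] at h2
    rw [inner_sub_right] at h1 h2
    change inner ℝ n y = _
    linarith
  have hpos : 0 < volume (Metric.ball x ρ ∩ 𝒯.base k) :=
    (Metric.isOpen_ball.inter (𝒯.base_polytope k).2.1).measure_pos _ hB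
  exact hpos.ne' (measure_mono_null hsub (volume_hyperplane hn0 _))

/-- A flat boundary point of a base which lies on no other active base is on the boundary of the
domain. -/
theorem mem_frontier_of_isolated (hΩ : IsPolytope Ω) {i : Fin 𝒯.N} {t : ℝ}
    (hi : t ∈ 𝒯.interval i) (ht : ∀ j, t ≠ 𝒯.tMin j ∧ t ≠ 𝒯.tMax j) {x n : Space d}
    (hx : x ∈ frontier (𝒯.base i)) (hn : IsOutwardNormal (𝒯.base i) x n)
    (h : ∀ j, j ≠ i → t ∈ 𝒯.interval j → x ∉ closure (𝒯.base j)) : x ∈ frontier Ω := by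
  refine ⟨closure_mono (𝒯.base_subset i) hx.1, fun hxΩ => ?_⟩
  have hxΩ : x ∈ Ω := interior_subset hxΩ
  obtain ⟨hn1, r, hr, hn⟩ := hn
  set G : Set (Space d) := {y | ∀ j, j ≠ i → t ∈ 𝒯.interval j → y ∉ closure (𝒯.base j)} with hG
  have hGo : IsOpen G := by
    have : G = ⋂ j, {y | j ≠ i → t ∈ 𝒯.interval j → y ∉ closure (𝒯.base j)} := by
      ext y; simp [hG]
    rw [this]
    refine isOpen_iInter_of_finite fun j => ?_
    by_cases hj : j ≠ i ∧ t ∈ 𝒯.interval j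
    · convert (isClosed_closure (s := 𝒯.base j)).isOpen_compl using 1
      ext y; simp [hj.1, hj.2]
    · convert isOpen_univ using 1
      ext y
      simp only [mem_ofPred_eq, mem_univ, iff_true]
      exact fun h1 h2 => absurd ⟨h1, h2⟩ hj
  have hc : Continuous fun σ : ℝ => x + σ • n := by fun_prop
  have hnear : ∀ᶠ σ in 𝓝 (0 : ℝ), x + σ • n ∈ Ω ∩ G ∩ Metric.ball x r :=
    hc.continuousAt.preimage_mem_nhds (by
      simp only [zero_smul, add_zero]
      exact inter_mem (inter_mem (hΩ.2.1.mem_nhds hxΩ) (hGo.mem_nhds h))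
        (Metric.ball_mem_nhds x hr))
  -- otherwise a point of `Ω` just outside of `base i` lies in the closure of no active base
  obtain ⟨σ, ⟨⟨hσΩ, hσG⟩, hσb⟩, hσ0⟩ := ((hnear.filter_mono nhdsWithin_le_nhds).and
    (self_mem_nhdsWithin : Ioi (0 : ℝ) ∈ 𝓝[>] 0)).exists
  have hσ0 : 0 < σ := hσ0
  have hT0 : 0 < T := (𝒯.tMin_nonneg i).trans_lt ((𝒯.tMin_lt_tMax i).trans_le (𝒯.tMax_le i))
  obtain ⟨j, hj, htj⟩ := exists_mem_closure_base (𝒯 := 𝒯) (subset_closure hσΩ)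
    (t := t) ⟨(𝒯.tMin_nonneg i).trans hi.1.le, hi.2.le.trans (𝒯.tMax_le i)⟩ hT0
  have htj : t ∈ 𝒯.interval j :=
    ⟨lt_of_le_of_ne htj.1 (ht j).1.symm, lt_of_le_of_ne htj.2 (ht j).2⟩
  rcases eq_or_ne j i with rfl | hji
  · have hopen : IsOpen (Metric.ball x r ∩ {y | 0 < inner ℝ n (y - x)}) :=
      Metric.isOpen_ball.inter (isOpen_lt continuous_const (by fun_prop))
    obtain ⟨y, ⟨hy1, hy2⟩, hy3⟩ := mem_closure_iff.1 hj _ hopen ⟨hσb, by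
      simp only [mem_ofPred_eq, add_sub_cancel_left, inner_smul_right, real_inner_self_eq_norm_sq,
        hn1]
      simpa using hσ0⟩
    exact lt_asymm hy2 ((hn y hy1).1 hy3)
  · exact hσG j hji htj hj

end PrismaticMesh

/-- `f` is almost everywhere equal to `a` immediately to the left of `0` and to `b` immediately to
the right of `0`. -/
def IsLocalStep (f : ℝ → ℝ) (a b : ℝ) : Prop :=
  ∃ δ > 0, (∀ᵐ s, s ∈ Ioo (-δ) 0 → f s = a) ∧ ∀ᵐ s, s ∈ Ioo 0 δ → f s = b

namespace IsLocalStep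

variable {f : ℝ → ℝ} {a b : ℝ}

theorem of_forall {δ : ℝ} (hδ : 0 < δ) {c : ℝ} (h : ∀ s ∈ Ioo (-δ) δ, f s = c) :
    IsLocalStep f c c :=
  ⟨δ, hδ, Eventually.of_forall fun s hs => h s ⟨hs.1, hs.2.trans hδ⟩,
    Eventually.of_forall fun s hs => h s ⟨(neg_lt_zero.2 hδ).trans hs.1, hs.2⟩⟩

theorem of_ae {δ : ℝ} (hδ : 0 < δ) {c : ℝ} (h : ∀ᵐ s, s ∈ Ioo (-δ) δ → f s = c) :
    IsLocalStep f c c := by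
  refine ⟨δ, hδ, ?_, ?_⟩
  · filter_upwards [h] with s h hs using h ⟨hs.1, hs.2.trans hδ⟩
  · filter_upwards [h] with s h hs using h ⟨(neg_lt_zero.2 hδ).trans hs.1, hs.2⟩

theorem mono {f : ℝ → ℝ} {a b : ℝ} (h : IsLocalStep f a b) : ∀ᶠ δ in 𝓝[>] (0 : ℝ),
    (∀ᵐ s, s ∈ Ioo (-δ) 0 → f s = a) ∧ ∀ᵐ s, s ∈ Ioo 0 δ → f s = b := by
  obtain ⟨δ, hδ, h1, h2⟩ := h
  filter_upwards [Ioo_mem_nhdsGT hδ] with ε hε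
  constructor
  · filter_upwards [h1] with s h hs using h ⟨(neg_lt_neg hε.2).trans hs.1, hs.2⟩
  · filter_upwards [h2] with s h hs using h ⟨hs.1, hs.2.trans hε.2⟩

theorem sum {ι : Type*} [Fintype ι] {f : ι → ℝ → ℝ} {a b : ι → ℝ}
    (h : ∀ i, IsLocalStep (f i) (a i) (b i)) :
    IsLocalStep (fun s => ∑ i, f i s) (∑ i, a i) (∑ i, b i) := by
  obtain ⟨δ, h, hδ⟩ := ((eventually_all.2 fun i => (h i).mono).and
    (self_mem_nhdsWithin : Ioi (0 : ℝ) ∈ 𝓝[>] 0)).exists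
  refine ⟨δ, hδ, ?_, ?_⟩
  · filter_upwards [ae_all_iff.2 fun i => (h i).1] with s h hs
    exact Finset.sum_congr rfl fun i _ => h i hs
  · filter_upwards [ae_all_iff.2 fun i => (h i).2] with s h hs
    exact Finset.sum_congr rfl fun i _ => h i hs

theorem comp_neg (h : IsLocalStep f a b) : IsLocalStep (fun s => f (-s)) b a := by
  obtain ⟨δ, hδ, h1, h2⟩ := h
  have hneg := (Measure.measurePreserving_neg (volume : Measure ℝ)).quasiMeasurePreserving
  refine ⟨δ, hδ, ?_, ?_⟩
  · filter_upwards [hneg.ae h2] with s h hs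
    exact h ⟨by linarith [hs.2], by linarith [hs.1]⟩
  · filter_upwards [hneg.ae h1] with s h hs
    exact h ⟨by linarith [hs.2], by linarith [hs.1]⟩

theorem exists_ae_eq (h : IsLocalStep f a a) :
    ∃ δ > 0, ∃ c : ℝ, ∀ᵐ s, s ∈ Ioo (-δ) δ → f s = c := by
  obtain ⟨δ, hδ, h1, h2⟩ := h
  refine ⟨δ, hδ, a, ?_⟩
  have h0 : ∀ᵐ s : ℝ, s ≠ 0 := by simp [ae_iff]
  filter_upwards [h1, h2, h0] with s h1 h2 h0 hs
  rcases lt_or_gt_of_ne h0 with h | h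
  · exact h1 ⟨hs.1, h⟩
  · exact h2 ⟨h, hs.2⟩

end IsLocalStep

section Crossing

variable {d : ℕ} {P : Set (Space d)} {a b : ℝ}

/-- A function constant along the lines of direction `e` jumps from `0` to its trace where such
a line enters the prism. -/
theorem isLocalStep_of_inner_neg (u : L2 (P ×ˢ Ioo a b)) {z : SpaceTime d} {n e : Space d}
    (hz : z.2 ∈ Ioo a b) (hn : IsOutwardNormal P z.1 n) (he : inner ℝ n e < 0) {τ : ℝ}
    (hτ : HasRightMean (fun s => zeroExt (P ×ˢ Ioo a b) u (z + s • ((e, 0) : SpaceTime d))) τ)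
    (hc : ∀ s₀ s₁ : ℝ, s₀ < s₁ →
      (∀ s ∈ Ioo s₀ s₁, z + s • ((e, 0) : SpaceTime d) ∈ P ×ˢ Ioo a b) →
      ∃ c : ℝ, ∀ᵐ s, s ∈ Ioo s₀ s₁ →
        zeroExt (P ×ˢ Ioo a b) u (z + s • ((e, 0) : SpaceTime d)) = c) :
    IsLocalStep (fun s => zeroExt (P ×ˢ Ioo a b) u (z + s • ((e, 0) : SpaceTime d))) 0 τ := by
  obtain ⟨hn1, r, hr, hn⟩ := hn
  have hcont : Continuous fun s : ℝ => z.1 + s • e := by fun_prop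
  have hnear : ∀ᶠ s in 𝓝 (0 : ℝ), z.1 + s • e ∈ Metric.ball z.1 r :=
    hcont.continuousAt.preimage_mem_nhds (by simpa using Metric.ball_mem_nhds z.1 hr)
  obtain ⟨δ, hδ, hball⟩ := Metric.eventually_nhds_iff_ball.1 hnear
  rw [Real.ball_eq_Ioo, zero_sub, zero_add] at hball
  have hmem : ∀ s ∈ Ioo (-δ) δ, (z.1 + s • e ∈ P ↔ 0 < s) := by
    intro s hs
    rw [hn _ (hball s hs), add_sub_cancel_left, inner_smul_right]
    exact ⟨fun h => by nlinarith, fun h => by nlinarith⟩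
  refine ⟨δ, hδ, Eventually.of_forall fun s hs => ?_, ?_⟩
  · refine indicator_of_notMem (fun h => ?_) _
    have := (hmem s ⟨hs.1, hs.2.trans hδ⟩).1 (by simpa using h.1)
    linarith [hs.2]
  · obtain ⟨c, hcc⟩ := hc 0 δ hδ fun s hs =>
      ⟨by simpa using (hmem s ⟨(neg_lt_zero.2 hδ).trans hs.1, hs.2⟩).2 hs.1, by simpa using hz⟩
    have := HasRightMean.of_ae_eq_const hδ ((ae_restrict_iff' measurableSet_Ioo).2 hcc)
    rwa [hτ.unique this]

theorem isLocalStep_of_inner_pos (u : L2 (P ×ˢ Ioo a b)) {z : SpaceTime d} {n e : Space d}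
    (hz : z.2 ∈ Ioo a b) (hn : IsOutwardNormal P z.1 n) (he : 0 < inner ℝ n e) {τ : ℝ}
    (hτ : HasRightMean (fun s => zeroExt (P ×ˢ Ioo a b) u (z + s • ((-e, 0) : SpaceTime d))) τ)
    (hc : ∀ s₀ s₁ : ℝ, s₀ < s₁ →
      (∀ s ∈ Ioo s₀ s₁, z + s • ((e, 0) : SpaceTime d) ∈ P ×ˢ Ioo a b) →
      ∃ c : ℝ, ∀ᵐ s, s ∈ Ioo s₀ s₁ →
        zeroExt (P ×ˢ Ioo a b) u (z + s • ((e, 0) : SpaceTime d)) = c) :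
    IsLocalStep (fun s => zeroExt (P ×ˢ Ioo a b) u (z + s • ((e, 0) : SpaceTime d))) τ 0 := by
  have hflip : ∀ s : ℝ, z + s • ((-e, 0) : SpaceTime d) = z + (-s) • ((e, 0) : SpaceTime d) := by
    intro s
    simp
  have := (isLocalStep_of_inner_neg u hz hn (e := -e) (by rwa [inner_neg_right, neg_lt_zero]) hτ
    fun s₀ s₁ hs hmem => ?_).comp_neg
  · simpa [hflip] using this
  · obtain ⟨c, hc⟩ := hc (-s₁) (-s₀) (by linarith) fun s hs => by
      have := hmem (-s) ⟨by linarith [hs.2], by linarith [hs.1]⟩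
      rwa [hflip, neg_neg] at this
    refine ⟨c, ?_⟩
    filter_upwards [(Measure.measurePreserving_neg
      (volume : Measure ℝ)).quasiMeasurePreserving.ae hc] with s h hs
    rw [hflip]
    exact h ⟨by linarith [hs.2], by linarith [hs.1]⟩

end Crossing

namespace PrismaticMesh

variable {d : ℕ} {Ω : Set (Space d)} {T : ℝ} {𝒯 : PrismaticMesh Ω T}

theorem timeFacet_comm (i j : Fin 𝒯.N) : 𝒯.timeFacet i j = 𝒯.timeFacet j i := by
  rw [timeFacet, timeFacet, inter_comm (frontier _), inter_comm (𝒯.interval i)]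

theorem ae_of_ae_timeFacet (i j : Fin 𝒯.N) {p : SpaceTime d → Prop}
    (h : ∀ᵐ z ∂𝒯.timeFacet i j, p z) :
    ∀ᵐ z ∂lateralMeasure (frontier (𝒯.base i)) (Ioo (𝒯.tMin i) (𝒯.tMax i)),
      z.1 ∈ frontier (𝒯.base j) → z.2 ∈ 𝒯.interval j → p z :=
  ae_lateralMeasure_of_inter isClosed_frontier.measurableSet measurableSet_Ioo
    (𝒯.base_polytope i).sFinite_frontier h

theorem timeFacet_le (i j : Fin 𝒯.N) :
    𝒯.timeFacet i j ≤ lateralMeasure (frontier (𝒯.base i)) (Ioo (𝒯.tMin i) (𝒯.tMax i)) :=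
  lateralMeasure_mono inter_subset_left inter_subset_left

theorem timeFacet_le_right (i j : Fin 𝒯.N) :
    𝒯.timeFacet i j ≤ lateralMeasure (frontier (𝒯.base j)) (Ioo (𝒯.tMin j) (𝒯.tMax j)) :=
  lateralMeasure_mono inter_subset_right inter_subset_right

theorem dirichletFacet_le (i : Fin 𝒯.N) :
    𝒯.dirichletFacet i ≤ lateralMeasure (frontier (𝒯.base i)) (Ioo (𝒯.tMin i) (𝒯.tMax i)) :=
  lateralMeasure_mono inter_subset_left le_rfl

theorem ae_timeFacet (i j : Fin 𝒯.N) : ∀ᵐ z ∂𝒯.timeFacet i j,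
    (z.1 ∈ frontier (𝒯.base i) ∧ z.1 ∈ frontier (𝒯.base j)) ∧
      z.2 ∈ 𝒯.interval i ∧ z.2 ∈ 𝒯.interval j := by
  have hA := (𝒯.base_polytope i).sFinite_frontier
  have hm : MeasurableSet (frontier (𝒯.base i) ∩ frontier (𝒯.base j)) :=
    isClosed_frontier.measurableSet.inter isClosed_frontier.measurableSet
  have : SFinite ((Measure.euclideanHausdorffMeasure (d - 1) : Measure (Space d)).restrict
      (frontier (𝒯.base i) ∩ frontier (𝒯.base j))) := by
    rw [← Measure.restrict_restrict_of_subset inter_subset_left]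
    infer_instance
  have h1 : ∀ᵐ z ∂𝒯.timeFacet i j, z.1 ∈ frontier (𝒯.base i) ∩ frontier (𝒯.base j) :=
    Measure.quasiMeasurePreserving_fst.ae (ae_restrict_mem hm)
  have h2 : ∀ᵐ z ∂𝒯.timeFacet i j, z.2 ∈ 𝒯.interval i ∩ 𝒯.interval j :=
    Measure.quasiMeasurePreserving_snd.ae
      (ae_restrict_mem (measurableSet_Ioo.inter measurableSet_Ioo))
  exact h1.and h2

/-- The outward normals of two adjacent elements are opposite. -/
theorem ae_timeFacet_normal {i j : Fin 𝒯.N} (hij : i ≠ j) : ∀ᵐ z ∂𝒯.timeFacet i j,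
    ‖𝒯.normal i z‖ = 1 ∧ 𝒯.normal j z = -𝒯.normal i z := by
  filter_upwards [ae_timeFacet i j,
    ae_mono (timeFacet_le i j) (ae_isOutwardNormal (𝒯.base_polytope i)),
    ae_mono (timeFacet_le_right i j) (ae_isOutwardNormal (𝒯.base_polytope j))] with z hz hi hj
  exact ⟨hi.1, hi.eq_neg_of_disjoint hj (disjoint_base_of_mem hij hz.2.1 hz.2.2)⟩

theorem ae_timeFacet_normalJump {i j : Fin 𝒯.N} (hij : i ≠ j) (u : 𝒯.Broken) :
    ∀ᵐ z ∂𝒯.timeFacet i j,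
      normalJump u i j z = (sideTrace u i z - sideTrace u j z) • 𝒯.normal i z := by
  filter_upwards [ae_timeFacet_normal hij] with z hz
  rw [normalJump, hz.2, smul_neg, sub_smul, sub_eq_add_neg]

end PrismaticMesh

namespace PrismaticMesh

variable {d : ℕ} {Ω : Set (Space d)} {T : ℝ} {𝒯 : PrismaticMesh Ω T}

theorem isLocalStep_zero_of_not_active (u : 𝒯.Broken) {k : Fin 𝒯.N} {z : SpaceTime d} (e : Space d)
    (h : z.2 ∈ 𝒯.interval k → z.1 ∉ closure (𝒯.base k)) :
    IsLocalStep (fun s => zeroExt (𝒯.elem k) (u k) (z + s • ((e, 0) : SpaceTime d))) 0 0 := by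
  by_cases ht : z.2 ∈ 𝒯.interval k
  · have hcont : Continuous fun s : ℝ => z.1 + s • e := by fun_prop
    have hnear : ∀ᶠ s in 𝓝 (0 : ℝ), z.1 + s • e ∈ (closure (𝒯.base k))ᶜ :=
      hcont.continuousAt.preimage_mem_nhds (by
        simpa using isClosed_closure.isOpen_compl.mem_nhds (h ht))
    obtain ⟨δ, hδ, hball⟩ := Metric.eventually_nhds_iff_ball.1 hnear
    rw [Real.ball_eq_Ioo, zero_sub, zero_add] at hball
    refine .of_forall hδ fun s hs => indicator_of_notMem (fun hz => hball s hs ?_) _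
    exact subset_closure (by simpa using hz.1)
  · refine .of_forall one_pos fun s _ => indicator_of_notMem (fun hz => ht ?_) _
    simpa using hz.2

/-- If the broken function `u` is constant along the segments of direction `e` inside each element,
has no jumps and vanishes on the Dirichlet boundary, its sum over the elements is constant across
each point `z` where the line through `z` crosses the mesh generically. -/
theorem exists_ae_eq_sum_zeroExt (hΩ : IsPolytope Ω) (u : 𝒯.Broken) {z : SpaceTime d} {e : Space d}
    (ht : ∀ j, z.2 ≠ 𝒯.tMin j ∧ z.2 ≠ 𝒯.tMax j)
    (hconst : ∀ i, ∀ s₀ s₁ : ℝ, s₀ < s₁ →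
      (∀ s ∈ Ioo s₀ s₁, z + s • ((e, 0) : SpaceTime d) ∈ 𝒯.elem i) →
      ∃ c : ℝ, ∀ᵐ s, s ∈ Ioo s₀ s₁ →
        zeroExt (𝒯.elem i) (u i) (z + s • ((e, 0) : SpaceTime d)) = c)
    (hnormal : ∀ i, z.2 ∈ 𝒯.interval i → z.1 ∈ frontier (𝒯.base i) →
      IsOutwardNormal (𝒯.base i) z.1 (𝒯.normal i z) ∧ inner ℝ (𝒯.normal i z) e ≠ 0)
    (hneg : ∀ i, z.2 ∈ 𝒯.interval i → z.1 ∈ frontier (𝒯.base i) → inner ℝ (𝒯.normal i z) e < 0 →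
      HasRightMean (fun s => zeroExt (𝒯.elem i) (u i) (z + s • ((e, 0) : SpaceTime d)))
        (sideTrace u i z))
    (hpos : ∀ i, z.2 ∈ 𝒯.interval i → z.1 ∈ frontier (𝒯.base i) → inner ℝ (𝒯.normal i z) (-e) < 0 →
      HasRightMean (fun s => zeroExt (𝒯.elem i) (u i) (z + s • ((-e, 0) : SpaceTime d)))
        (sideTrace u i z))
    (hdir : ∀ i, z.2 ∈ 𝒯.interval i → z.1 ∈ frontier (𝒯.base i) → z.1 ∈ frontier Ω →
      sideTrace u i z = 0)
    (hjump : ∀ i j, i ≠ j → z.2 ∈ 𝒯.interval i → z.1 ∈ frontier (𝒯.base i) →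
      z.2 ∈ 𝒯.interval j → z.1 ∈ frontier (𝒯.base j) → sideTrace u i z = sideTrace u j z) :
    ∃ δ > (0 : ℝ), ∃ c : ℝ, ∀ᵐ s, s ∈ Ioo (-δ) δ →
      ∑ i, zeroExt (𝒯.elem i) (u i) (z + s • ((e, 0) : SpaceTime d)) = c := by
  classical
  suffices h : ∃ a b : Fin 𝒯.N → ℝ, ∑ i, a i = ∑ i, b i ∧ ∀ i, IsLocalStep
      (fun s => zeroExt (𝒯.elem i) (u i) (z + s • ((e, 0) : SpaceTime d))) (a i) (b i) by
    obtain ⟨a, b, hab, h⟩ := h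
    have := IsLocalStep.sum h
    rw [hab] at this
    exact this.exists_ae_eq
  have stepneg : ∀ i, z.2 ∈ 𝒯.interval i → z.1 ∈ frontier (𝒯.base i) →
      inner ℝ (𝒯.normal i z) e < 0 → IsLocalStep
      (fun s => zeroExt (𝒯.elem i) (u i) (z + s • ((e, 0) : SpaceTime d))) 0 (sideTrace u i z) :=
    fun i h1 h2 h3 => isLocalStep_of_inner_neg (u i) h1 (hnormal i h1 h2).1 h3 (hneg i h1 h2 h3)
      (hconst i)
  have steppos : ∀ i, z.2 ∈ 𝒯.interval i → z.1 ∈ frontier (𝒯.base i) →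
      0 < inner ℝ (𝒯.normal i z) e → IsLocalStep
      (fun s => zeroExt (𝒯.elem i) (u i) (z + s • ((e, 0) : SpaceTime d))) (sideTrace u i z) 0 :=
    fun i h1 h2 h3 => isLocalStep_of_inner_pos (u i) h1 (hnormal i h1 h2).1 h3
      (hpos i h1 h2 (by rwa [inner_neg_right, neg_lt_zero])) (hconst i)
  -- the line leaves the element `j` and enters the adjacent element `i`
  have adjacent : ∀ i j, i ≠ j → z.2 ∈ 𝒯.interval i → z.1 ∈ frontier (𝒯.base i) →
      z.2 ∈ 𝒯.interval j → z.1 ∈ frontier (𝒯.base j) → inner ℝ (𝒯.normal i z) e < 0 →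
      ∃ a b : Fin 𝒯.N → ℝ, ∑ i, a i = ∑ i, b i ∧ ∀ i, IsLocalStep
        (fun s => zeroExt (𝒯.elem i) (u i) (z + s • ((e, 0) : SpaceTime d))) (a i) (b i) := by
    intro i j hij hi hi' hj hj' hlt
    have hnj := (hnormal i hi hi').1.eq_neg_of_disjoint (hnormal j hj hj').1
      (disjoint_base_of_mem hij hi hj)
    refine ⟨Pi.single j (sideTrace u j z), Pi.single i (sideTrace u i z), ?_, fun k => ?_⟩
    · simp [hjump i j hij hi hi' hj hj']
    · by_cases hki : k = i
      · subst hki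
        simpa [Pi.single_eq_of_ne hij] using stepneg k hi hi' hlt
      by_cases hkj : k = j
      · subst hkj
        simpa [Pi.single_eq_of_ne hki] using steppos k hj hj' (by
          rwa [hnj, inner_neg_left, neg_pos])
      rw [Pi.single_eq_of_ne hki, Pi.single_eq_of_ne hkj]
      exact isLocalStep_zero_of_not_active u e fun hk =>
        notMem_closure_of_adjacent hki hkj hi hj hk (hnormal i hi hi').1
          (hnj ▸ (hnormal j hj hj').1)
  by_cases hfr : ∃ i, z.2 ∈ 𝒯.interval i ∧ z.1 ∈ frontier (𝒯.base i)
  · obtain ⟨i, hi, hi'⟩ := hfr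
    by_cases hadj : ∃ j, i ≠ j ∧ z.2 ∈ 𝒯.interval j ∧ z.1 ∈ frontier (𝒯.base j)
    · obtain ⟨j, hij, hj, hj'⟩ := hadj
      rcases lt_or_gt_of_ne (hnormal i hi hi').2 with hlt | hgt
      · exact adjacent i j hij hi hi' hj hj' hlt
      · refine adjacent j i hij.symm hj hj' hi hi' ?_
        rwa [(hnormal i hi hi').1.eq_neg_of_disjoint (hnormal j hj hj').1
          (disjoint_base_of_mem hij hi hj), inner_neg_left, neg_lt_zero]
    · -- the line leaves or enters the domain
      push Not at hadj
      have hother : ∀ j, j ≠ i → z.2 ∈ 𝒯.interval j → z.1 ∉ closure (𝒯.base j) := by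
        intro j hji hj hcl
        refine hadj j hji.symm hj ⟨hcl, fun hint => ?_⟩
        exact notMem_closure_base hji hj hi (interior_subset hint) hi'.1
      have h0 := hdir i hi hi' (mem_frontier_of_isolated hΩ hi ht hi' (hnormal i hi hi').1 hother)
      refine ⟨0, 0, rfl, fun k => ?_⟩
      by_cases hki : k = i
      · subst hki
        rcases lt_or_gt_of_ne (hnormal k hi hi').2 with hlt | hgt
        · simpa [h0] using stepneg k hi hi' hlt
        · simpa [h0] using steppos k hi hi' hgt
      · exact isLocalStep_zero_of_not_active u e (hother k hki)
  · -- the point is inside an element, or away from all active elements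
    push Not at hfr
    suffices h : ∀ k, ∃ c : ℝ, IsLocalStep
        (fun s => zeroExt (𝒯.elem k) (u k) (z + s • ((e, 0) : SpaceTime d))) c c by
      choose c hc using h
      exact ⟨c, c, rfl, hc⟩
    intro k
    by_cases hk : z.2 ∈ 𝒯.interval k ∧ z.1 ∈ 𝒯.base k
    · have hcont : Continuous fun s : ℝ => z + s • ((e, 0) : SpaceTime d) := by fun_prop
      have hnear : ∀ᶠ s in 𝓝 (0 : ℝ), z + s • ((e, 0) : SpaceTime d) ∈ 𝒯.elem k :=
        hcont.continuousAt.preimage_mem_nhds (by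
          rw [zero_smul, add_zero]
          exact (isOpen_elem k).mem_nhds ⟨hk.2, hk.1⟩)
      obtain ⟨δ, hδ, hball⟩ := Metric.eventually_nhds_iff_ball.1 hnear
      rw [Real.ball_eq_Ioo, zero_sub, zero_add] at hball
      obtain ⟨c, hc⟩ := hconst k (-δ) δ (by linarith) hball
      exact ⟨c, .of_ae hδ hc⟩
    · refine ⟨0, isLocalStep_zero_of_not_active u e fun ht' hcl => hk ⟨ht', ?_⟩⟩
      by_contra hx
      exact hfr k ht' ⟨hcl, fun hint => hx (interior_subset hint)⟩

/-- A broken Sobolev function without spatial gradient, without jumps across the internal time-like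
facets and with zero Dirichlet trace vanishes: along almost all lines in a direction transversal
to all facets it is constant, and it is zero outside of the domain. -/
theorem eq_zero_of_spatial_gradient_eq_zero (hd : 1 ≤ d) (hΩ : IsPolytope Ω) (u : 𝒯.Broken)
    (hu : ∀ i, u i ∈ H1 (𝒯.elem i)) (hgrad : ∀ i k, weakDeriv (𝒯.elem i) (spaceDir k) (u i) = 0)
    (hjump : ∀ i j, i < j → ∀ᵐ z ∂𝒯.timeFacet i j, normalJump u i j z = 0)
    (hdir : ∀ i, ∀ᵐ z ∂𝒯.dirichletFacet i, sideTrace u i z = 0) : u = 0 := by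
  classical
  choose F hF1 hF _ using fun i => (𝒯.base_polytope i).exists_flat_cover
  -- transversality to the auxiliary unit vector `b` makes the direction `e` nonzero
  set b : Space d := EuclideanSpace.single ⟨0, hd⟩ 1
  obtain ⟨e, he⟩ := exists_transversal (insert (b, 0) (Finset.univ.biUnion F)) (by
    intro q hq
    rcases Finset.mem_insert.1 hq with rfl | hq
    · simp [b]
    · obtain ⟨i, -, hi⟩ := Finset.mem_biUnion.1 hq
      exact hF1 i q hi)
  have heF : ∀ i, ∀ q ∈ F i, inner ℝ q.1 e ≠ 0 := fun i q hq =>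
    he q (Finset.mem_insert_of_mem (Finset.mem_biUnion.2 ⟨i, Finset.mem_univ _, hq⟩))
  have he0 : e ≠ 0 := by
    rintro rfl
    exact he (b, 0) (Finset.mem_insert_self _ _) (by simp)
  have hweak : ∀ i, HasWeakDeriv (𝒯.elem i) ((e, 0) : SpaceTime d) (u i) 0 := fun i =>
    hasWeakDeriv_zero_of_spaceDir (fun k => hgrad i k ▸ hasWeakDeriv_weakDeriv (hu i) _) e
  have l1 : ∀ᵐ w : SpaceTime d, ∀ i, ∀ s₀ s₁ : ℝ, s₀ < s₁ →
      (∀ s ∈ Ioo s₀ s₁, w + s • ((e, 0) : SpaceTime d) ∈ 𝒯.elem i) →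
      ∃ c : ℝ, ∀ᵐ s, s ∈ Ioo s₀ s₁ →
        zeroExt (𝒯.elem i) (u i) (w + s • ((e, 0) : SpaceTime d)) = c :=
    ae_all_iff.2 fun i => (hweak i).ae_const_on_lines (isOpen_elem i)
      ((𝒯.base_polytope i).volume_prism _ _)
  have l2 : ∀ᵐ w : SpaceTime d, ∀ j, w.2 ≠ 𝒯.tMin j ∧ w.2 ≠ 𝒯.tMax j := by
    refine ae_all_iff.2 fun j => ?_
    have : ∀ c : ℝ, ∀ᵐ w : SpaceTime d, w.2 ≠ c := fun c =>
      Measure.quasiMeasurePreserving_snd.ae (p := fun t => t ≠ c) (by simp [ae_iff])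
    exact (this _).and (this _)
  let Q : Fin 𝒯.N → SpaceTime d → Prop := fun i z =>
    IsOutwardNormal (𝒯.base i) z.1 (𝒯.normal i z) ∧
    (inner ℝ (𝒯.normal i z) e < 0 →
      HasRightMean (fun s => zeroExt (𝒯.elem i) (u i) (z + s • ((e, 0) : SpaceTime d)))
        (sideTrace u i z)) ∧
    (inner ℝ (𝒯.normal i z) (-e) < 0 →
      HasRightMean (fun s => zeroExt (𝒯.elem i) (u i) (z + s • ((-e, 0) : SpaceTime d)))
        (sideTrace u i z)) ∧
    (z.1 ∈ frontier Ω → sideTrace u i z = 0) ∧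
    ∀ j, i ≠ j → z.1 ∈ frontier (𝒯.base j) → z.2 ∈ 𝒯.interval j →
      sideTrace u i z = sideTrace u j z
  have l3 : ∀ᵐ w : SpaceTime d, ∀ i, w.2 ∈ 𝒯.interval i → ∀ s : ℝ,
      w.1 + s • e ∈ frontier (𝒯.base i) → Q i (w + s • ((e, 0) : SpaceTime d)) := by
    refine ae_all_iff.2 fun i => ae_forall_line_of_ae_lateral (p := Q i) (a := 𝒯.tMin i)
      (b := 𝒯.tMax i) (hF1 i) (hF i) (heF i) ?_
    have hP := 𝒯.base_polytope i
    have hd' := ae_lateralMeasure_of_inter (A := frontier (𝒯.base i)) (I := 𝒯.interval i)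
      (J := univ) isClosed_frontier.measurableSet MeasurableSet.univ hP.sFinite_frontier
      (p := fun z => sideTrace u i z = 0) (by rw [inter_univ]; exact hdir i)
    have hj' : ∀ᵐ z ∂lateralMeasure (frontier (𝒯.base i)) (Ioo (𝒯.tMin i) (𝒯.tMax i)),
        ∀ j, i ≠ j → z.1 ∈ frontier (𝒯.base j) → z.2 ∈ 𝒯.interval j →
          sideTrace u i z = sideTrace u j z := by
      refine ae_all_iff.2 fun j => ?_
      by_cases hij : i = j
      · exact Eventually.of_forall fun z h => absurd hij h
      have : ∀ᵐ z ∂𝒯.timeFacet i j, sideTrace u i z = sideTrace u j z := by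
        have h0 : ∀ᵐ z ∂𝒯.timeFacet i j, normalJump u i j z = 0 := by
          rcases lt_or_gt_of_ne hij with h | h
          · exact hjump i j h
          · rw [timeFacet_comm]
            filter_upwards [hjump j i h] with z hz
            rw [← hz, normalJump, normalJump, add_comm]
        filter_upwards [h0, ae_timeFacet_normalJump hij u, ae_timeFacet_normal hij] with z h1 h2 h3
        rw [h1] at h2
        rcases smul_eq_zero.1 h2.symm with h | h
        · exact sub_eq_zero.1 h
        · rw [h, norm_zero] at h3
          exact absurd h3.1 zero_ne_one
      filter_upwards [ae_of_ae_timeFacet i j this] with z hz _ using hz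
    filter_upwards [ae_isOutwardNormal hP, ae_hasRightMean_lateral hP e (hu i),
      ae_hasRightMean_lateral hP (-e) (hu i), hd', hj'] with z h1 h2 h3 h4 h5
    exact ⟨h1, h2, h3, fun h => h4 h (mem_univ _), h5⟩
  have hline : ∀ᵐ w : SpaceTime d, ∀ᵐ s : ℝ,
      ∑ i, zeroExt (𝒯.elem i) (u i) (w + s • ((e, 0) : SpaceTime d)) = 0 := by
    filter_upwards [l1, l2, l3] with w h1 h2 h3
    refine ae_eq_zero_of_locally_const (fun s₀ => ?_) ?_
    · have hz2 : (w + s₀ • ((e, 0) : SpaceTime d)).2 = w.2 := by simp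
      have hz1 : (w + s₀ • ((e, 0) : SpaceTime d)).1 = w.1 + s₀ • e := by simp
      have hadd : ∀ s : ℝ, w + s₀ • ((e, 0) : SpaceTime d) + s • ((e, 0) : SpaceTime d) =
          w + (s₀ + s) • ((e, 0) : SpaceTime d) := fun s => by rw [add_smul, add_assoc]
      have h3' := fun i (hi : (w + s₀ • ((e, 0) : SpaceTime d)).2 ∈ 𝒯.interval i)
        (hi' : (w + s₀ • ((e, 0) : SpaceTime d)).1 ∈ frontier (𝒯.base i)) =>
        h3 i (hz2 ▸ hi) s₀ (hz1 ▸ hi')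
      have key := exists_ae_eq_sum_zeroExt hΩ u (z := w + s₀ • ((e, 0) : SpaceTime d)) (e := e)
        (by rwa [hz2]) (fun i a b hab hmem => ?_)
        (fun i hi hi' => ⟨(h3' i hi hi').1, (h3' i hi hi').1.inner_ne_zero (hF i) (heF i)⟩)
        (fun i hi hi' => (h3' i hi hi').2.1) (fun i hi hi' => (h3' i hi hi').2.2.1)
        (fun i hi hi' => (h3' i hi hi').2.2.2.1)
        (fun i j hij hi hi' hj hj' => (h3' i hi hi').2.2.2.2 j hij hj' hj)
      · simpa only [hadd] using key
      · obtain ⟨c, hc⟩ := h1 i (s₀ + a) (s₀ + b) (by linarith) fun s hs => by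
          have := hmem (s - s₀) ⟨by linarith [hs.1], by linarith [hs.2]⟩
          rwa [hadd, add_sub_cancel] at this
        refine ⟨c, ?_⟩
        filter_upwards [(measurePreserving_add_left (volume : Measure ℝ)
          s₀).quasiMeasurePreserving.ae hc] with s hs hs'
        rw [hadd]
        exact hs ⟨by linarith [hs'.1], by linarith [hs'.2]⟩
    · have hb : Bornology.IsBounded (⋃ i, 𝒯.base i) :=
        Bornology.isBounded_iUnion.2 fun i => (𝒯.base_polytope i).2.2.1
      obtain ⟨R, hR⟩ := hb.subset_closedBall 0
      have hne : 0 < ‖e‖ := norm_pos_iff.2 he0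
      refine ⟨max 0 ((R + ‖w.1‖) / ‖e‖), fun s hs => Finset.sum_eq_zero fun i _ =>
        indicator_of_notMem (fun hmem => ?_) _⟩
      have h4 : w.1 + s • e ∈ Metric.closedBall 0 R := hR (mem_iUnion.2 ⟨i, by simpa using hmem.1⟩)
      have h5 : R + ‖w.1‖ < s * ‖e‖ := (div_lt_iff₀ hne).1 ((le_max_right _ _).trans_lt hs)
      have h6 : ‖s • e‖ ≤ ‖w.1 + s • e‖ + ‖w.1‖ := by
        simpa using norm_sub_le (w.1 + s • e) w.1
      rw [norm_smul, Real.norm_of_nonneg ((le_max_left _ _).trans_lt hs).le] at h6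
      rw [mem_closedBall_zero_iff] at h4
      linarith
  have hzero : ∀ᵐ w : SpaceTime d, ∑ i, zeroExt (𝒯.elem i) (u i) w = 0 := by
    refine ae_of_ae_ae_line ?_ ((e, 0) : SpaceTime d) hline
    exact (Finset.measurable_sum _ fun i _ =>
      (stronglyMeasurable_zeroExt (isOpen_elem i).measurableSet (u i)).measurable)
      (measurableSet_singleton (0 : ℝ))
  funext i
  refine Lp.ext ((ae_restrict_iff' (isOpen_elem i).measurableSet).2 ?_)
  have hz := (ae_restrict_iff' (isOpen_elem i).measurableSet).1
    (Lp.coeFn_zero ℝ 2 (volume.restrict (𝒯.elem i)))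
  filter_upwards [hzero, hz] with w hw hz hwi
  rw [Finset.sum_eq_single i, zeroExt_of_mem _ hwi] at hw
  · rw [hw]
    exact (hz hwi).symm
  · intro j _ hji
    exact indicator_of_notMem (fun hwj => disjoint_left.1 (𝒯.disjoint hji) hwj hwi) _
  · intro h
    exact absurd (Finset.mem_univ i) h

end PrismaticMesh

/-! ### The form for the time derivative -/

namespace PrismaticMesh

variable {d : ℕ} {Ω : Set (Space d)} {T : ℝ} {𝒯 : PrismaticMesh Ω T}

theorem memLp_topTrace {u : 𝒯.Broken} {i : Fin 𝒯.N} (hu : u i ∈ H1 (𝒯.elem i)) :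
    MemLp (topTrace u i) 2 (volume.restrict (𝒯.base i)) := by
  have := (ae_hasRightMean_time (𝒯.base_polytope i)
    (isCollar_top (𝒯.base_polytope i) (𝒯.tMin_lt_tMax i)) hu).1
  rwa [neg_neg] at this

theorem memLp_bottomTrace {u : 𝒯.Broken} {i : Fin 𝒯.N} (hu : u i ∈ H1 (𝒯.elem i)) :
    MemLp (bottomTrace u i) 2 (volume.restrict (𝒯.base i)) :=
  (ae_hasRightMean_time (𝒯.base_polytope i)
    (isCollar_bottom (𝒯.base_polytope i) (𝒯.tMin_lt_tMax i)) hu).1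

/-- The bases of the elements which start when the element `i` ends cover the top of `i`. -/
theorem exists_mem_base_of_tMax_lt {i : Fin 𝒯.N} (hi : 𝒯.tMax i < T) {x : Space d}
    (hx : x ∈ 𝒯.base i) (hfr : ∀ j, x ∉ frontier (𝒯.base j)) :
    ∃ j, 𝒯.tMax i = 𝒯.tMin j ∧ x ∈ 𝒯.base j := by
  have hi0 : 0 < 𝒯.tMax i := (𝒯.tMin_nonneg i).trans_lt (𝒯.tMin_lt_tMax i)
  have hev : ∀ᶠ t in 𝓝[>] (𝒯.tMax i), ∀ j, 𝒯.tMax i < 𝒯.tMin j → t < 𝒯.tMin j := by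
    refine eventually_all.2 fun j => ?_
    by_cases hj : 𝒯.tMax i < 𝒯.tMin j
    · filter_upwards [Ioo_mem_nhdsGT hj] with t ht _ using ht.2
    · exact Eventually.of_forall fun t h => absurd h hj
  obtain ⟨t, htj, ht⟩ := (hev.and (Ioo_mem_nhdsGT hi)).exists
  obtain ⟨j, hj, htj'⟩ := exists_mem_closure_base (𝒯 := 𝒯) (subset_closure (𝒯.base_subset i hx))
    ⟨hi0.le.trans ht.1.le, ht.2.le⟩ (hi0.trans hi)
  have hmin : 𝒯.tMin j ≤ 𝒯.tMax i := not_lt.1 fun h => (htj j h).not_ge htj'.1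
  have hmax : 𝒯.tMax i < 𝒯.tMax j := ht.1.trans_le htj'.2
  have hxj : x ∈ 𝒯.base j := by
    by_contra hx'
    exact hfr j ⟨hj, fun h => hx' (interior_subset h)⟩
  refine ⟨j, (hmin.antisymm (not_lt.1 fun h => ?_)).symm, hxj⟩
  -- otherwise `i` and `j` are both active shortly before `i` ends
  obtain ⟨s, hs1, hs2⟩ := exists_between (max_lt h (𝒯.tMin_lt_tMax i))
  have hij : i ≠ j := by
    rintro rfl
    exact lt_irrefl _ hmax
  exact disjoint_left.1 (disjoint_base_of_mem (t := s) hij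
    ⟨(le_max_right _ _).trans_lt hs1, hs2⟩
    ⟨(le_max_left _ _).trans_lt hs1, hs2.trans hmax⟩) hx hxj

/-- The bases of the elements which end when the element `j` starts cover the bottom of `j`. -/
theorem exists_mem_base_of_lt_tMin {j : Fin 𝒯.N} (hj : 0 < 𝒯.tMin j) {x : Space d}
    (hx : x ∈ 𝒯.base j) (hfr : ∀ i, x ∉ frontier (𝒯.base i)) :
    ∃ i, 𝒯.tMax i = 𝒯.tMin j ∧ x ∈ 𝒯.base i := by
  have hjT : 𝒯.tMin j < T := (𝒯.tMin_lt_tMax j).trans_le (𝒯.tMax_le j)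
  have hev : ∀ᶠ t in 𝓝[<] (𝒯.tMin j), ∀ i, 𝒯.tMax i < 𝒯.tMin j → 𝒯.tMax i < t := by
    refine eventually_all.2 fun i => ?_
    by_cases hi : 𝒯.tMax i < 𝒯.tMin j
    · filter_upwards [Ioo_mem_nhdsLT hi] with t ht _ using ht.1
    · exact Eventually.of_forall fun t h => absurd h hi
  obtain ⟨t, hti, ht⟩ := (hev.and (Ioo_mem_nhdsLT hj)).exists
  obtain ⟨i, hi, hti'⟩ := exists_mem_closure_base (𝒯 := 𝒯) (subset_closure (𝒯.base_subset j hx))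
    ⟨ht.1.le, ht.2.le.trans hjT.le⟩ (hj.trans hjT)
  have hmax : 𝒯.tMin j ≤ 𝒯.tMax i := not_lt.1 fun h => (hti i h).not_ge hti'.2
  have hmin : 𝒯.tMin i < 𝒯.tMin j := hti'.1.trans_lt ht.2
  have hxi : x ∈ 𝒯.base i := by
    by_contra hx'
    exact hfr i ⟨hi, fun h => hx' (interior_subset h)⟩
  refine ⟨i, (hmax.antisymm (not_lt.1 fun h => ?_)).symm, hxi⟩
  -- otherwise `i` and `j` are both active shortly after `j` starts
  obtain ⟨s, hs1, hs2⟩ := exists_between (lt_min h (𝒯.tMin_lt_tMax j))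
  have hij : i ≠ j := by
    rintro rfl
    exact lt_irrefl _ hmin
  exact disjoint_left.1 (disjoint_base_of_mem (t := s) hij
    ⟨hmin.trans hs1, hs2.trans_le (min_le_left _ _)⟩
    ⟨hs1, hs2.trans_le (min_le_right _ _)⟩) hxi hx

theorem ae_notMem_frontier_base : ∀ᵐ x : Space d, ∀ j, x ∉ frontier (𝒯.base j) :=
  ae_all_iff.2 fun j => measure_eq_zero_iff_ae_notMem.1 (𝒯.base_polytope j).volume_frontier

theorem setIntegral_eq_sum_inter {B : Set (Space d)} (hB : MeasurableSet B) (S : Finset (Fin 𝒯.N))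
    (hdisj : (S : Set (Fin 𝒯.N)).Pairwise fun i j => Disjoint (𝒯.base i) (𝒯.base j))
    (hcov : ∀ x ∈ B, (∀ j, x ∉ frontier (𝒯.base j)) → ∃ j ∈ S, x ∈ 𝒯.base j)
    {f : Space d → ℝ} (hf : IntegrableOn f B) :
    ∫ x in B, f x = ∑ j ∈ S, ∫ x in B ∩ 𝒯.base j, f x := by
  rw [← integral_biUnion_finset]
  · refine setIntegral_congr_set ?_
    filter_upwards [ae_notMem_frontier_base (𝒯 := 𝒯)] with x hx
    refine propext ⟨fun hxB => ?_, fun h => ?_⟩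
    · obtain ⟨j, hj, hxj⟩ := hcov x hxB hx
      exact mem_iUnion₂.2 ⟨j, hj, hxB, hxj⟩
    · obtain ⟨j, -, hxj⟩ := mem_iUnion₂.1 h
      exact hxj.1
  · exact fun j _ => hB.inter (𝒯.base_polytope j).2.1.measurableSet
  · exact fun i hi j hj hij => (hdisj hi hj hij).mono inter_subset_right inter_subset_right
  · exact fun j _ => hf.mono_set inter_subset_left

/-- Up to a null set, the top of an element is at the final time or splits into space-like
facets. -/
theorem setIntegral_top {i : Fin 𝒯.N} {f : Space d → ℝ} (hf : IntegrableOn f (𝒯.base i)) :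
    ∫ x in 𝒯.base i, f x = (if 𝒯.tMax i = T then ∫ x in 𝒯.base i, f x else 0) +
      ∑ j, if 𝒯.tMax i = 𝒯.tMin j then ∫ x in 𝒯.base i ∩ 𝒯.base j, f x else 0 := by
  split_ifs with hT
  · rw [Finset.sum_eq_zero, add_zero]
    intro j _
    rw [if_neg]
    intro h
    have := (𝒯.tMin_lt_tMax j).trans_le (𝒯.tMax_le j)
    linarith
  · rw [zero_add, ← Finset.sum_filter]
    refine setIntegral_eq_sum_inter (𝒯.base_polytope i).2.1.measurableSet _ ?_ ?_ hf
    · intro j hj k hk hjk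
      simp only [Finset.coe_filter, Finset.mem_univ, true_and, mem_ofPred_eq] at hj hk
      obtain ⟨s, hs1, hs2⟩ := exists_between (lt_min (hj ▸ 𝒯.tMin_lt_tMax j :
        𝒯.tMax i < 𝒯.tMax j) (hk ▸ 𝒯.tMin_lt_tMax k : 𝒯.tMax i < 𝒯.tMax k))
      exact disjoint_base_of_mem (t := s) hjk ⟨hj ▸ hs1, hs2.trans_le (min_le_left _ _)⟩
        ⟨hk ▸ hs1, hs2.trans_le (min_le_right _ _)⟩
    · intro x hx hfr
      obtain ⟨j, hj, hxj⟩ := exists_mem_base_of_tMax_lt (lt_of_le_of_ne (𝒯.tMax_le i) hT) hx hfr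
      exact ⟨j, by simpa using hj, hxj⟩

/-- Up to a null set, the bottom of an element is at the initial time or splits into space-like
facets. -/
theorem setIntegral_bottom {j : Fin 𝒯.N} {f : Space d → ℝ} (hf : IntegrableOn f (𝒯.base j)) :
    ∫ x in 𝒯.base j, f x = (if 𝒯.tMin j = 0 then ∫ x in 𝒯.base j, f x else 0) +
      ∑ i, if 𝒯.tMax i = 𝒯.tMin j then ∫ x in 𝒯.base i ∩ 𝒯.base j, f x else 0 := by
  simp_rw [inter_comm _ (𝒯.base j)]
  split_ifs with h0
  · rw [Finset.sum_eq_zero, add_zero]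
    intro i _
    rw [if_neg]
    intro h
    have := (𝒯.tMin_nonneg i).trans_lt (𝒯.tMin_lt_tMax i)
    linarith
  · rw [zero_add, ← Finset.sum_filter]
    refine setIntegral_eq_sum_inter (𝒯.base_polytope j).2.1.measurableSet _ ?_ ?_ hf
    · intro i hi k hk hik
      simp only [Finset.coe_filter, Finset.mem_univ, true_and, mem_ofPred_eq] at hi hk
      obtain ⟨s, hs1, hs2⟩ := exists_between (max_lt (hi ▸ 𝒯.tMin_lt_tMax i :
        𝒯.tMin i < 𝒯.tMin j) (hk ▸ 𝒯.tMin_lt_tMax k : 𝒯.tMin k < 𝒯.tMin j))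
      exact disjoint_base_of_mem (t := s) hik ⟨(le_max_left _ _).trans_lt hs1, hi.symm ▸ hs2⟩
        ⟨(le_max_right _ _).trans_lt hs1, hk.symm ▸ hs2⟩
    · intro x hx hfr
      obtain ⟨i, hi, hxi⟩ := exists_mem_base_of_lt_tMin
        (lt_of_le_of_ne (𝒯.tMin_nonneg j) (Ne.symm h0)) hx hfr
      exact ⟨i, by simpa using hi, hxi⟩

theorem sq_jumpFunctional (u : 𝒯.Broken) : jumpFunctional T u ^ 2 =
    1 / 2 * ((∑ i, if 𝒯.tMax i = T then ∫ x in 𝒯.base i, topTrace u i x ^ 2 else 0)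
    + (∑ i, ∑ j, if 𝒯.tMax i = 𝒯.tMin j then
        ∫ x in 𝒯.base i ∩ 𝒯.base j, timeJump u i j x ^ 2 else 0)
    + ∑ i, if 𝒯.tMin i = 0 then ∫ x in 𝒯.base i, bottomTrace u i x ^ 2 else 0) := by
  refine Real.sq_sqrt ?_
  have h : ∀ (B : Set (Space d)) (f : Space d → ℝ), 0 ≤ ∫ x in B, f x ^ 2 := fun B f =>
    integral_nonneg fun x => sq_nonneg _
  have hi : ∀ (p : Prop) [Decidable p] (r : ℝ), 0 ≤ r → 0 ≤ if p then r else 0 := by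
    intro p _ r hr
    split_ifs <;> simp [hr]
  refine mul_nonneg (by norm_num) (add_nonneg (add_nonneg ?_ ?_) ?_)
  · exact Finset.sum_nonneg fun i _ => hi _ _ (h _ _)
  · exact Finset.sum_nonneg fun i _ => Finset.sum_nonneg fun j _ => hi _ _ (h _ _)
  · exact Finset.sum_nonneg fun i _ => hi _ _ (h _ _)

/-- Integration by parts in time on each element turns the diagonal of the form `m_h` into the
upwind-jump functional: the space-like facets at the top of an element are, up to null sets, those
at the bottoms of the elements above it. -/
theorem mForm_self {u : 𝒯.Broken} (hu : ∀ i, u i ∈ H1 (𝒯.elem i)) :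
    mForm u u = jumpFunctional T u ^ 2 := by
  have ht : ∀ i j, MemLp (topTrace u i) 2 (volume.restrict (𝒯.base i ∩ 𝒯.base j)) := fun i j =>
    (memLp_topTrace (hu i)).mono_measure (Measure.restrict_mono inter_subset_left le_rfl)
  have hb : ∀ i j, MemLp (bottomTrace u j) 2 (volume.restrict (𝒯.base i ∩ 𝒯.base j)) := fun i j =>
    (memLp_bottomTrace (hu j)).mono_measure (Measure.restrict_mono inter_subset_right le_rfl)
  have hfacet : ∀ i j, ∫ x in 𝒯.base i ∩ 𝒯.base j, bottomTrace u j x * timeJump u i j x =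
      1 / 2 * ((∫ x in 𝒯.base i ∩ 𝒯.base j, topTrace u i x ^ 2) -
        (∫ x in 𝒯.base i ∩ 𝒯.base j, bottomTrace u j x ^ 2) -
        ∫ x in 𝒯.base i ∩ 𝒯.base j, timeJump u i j x ^ 2) := by
    intro i j
    have h1 : Integrable (fun x => topTrace u i x ^ 2) (volume.restrict (𝒯.base i ∩ 𝒯.base j)) :=
      (ht i j).integrable_sq
    have h2 : Integrable (fun x => bottomTrace u j x ^ 2) (volume.restrict (𝒯.base i ∩ 𝒯.base j)) :=
      (hb i j).integrable_sq
    have h3 : Integrable (fun x => timeJump u i j x ^ 2) (volume.restrict (𝒯.base i ∩ 𝒯.base j)) :=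
      ((ht i j).sub (hb i j)).integrable_sq
    have h12 : Integrable (fun x => topTrace u i x ^ 2 - bottomTrace u j x ^ 2)
        (volume.restrict (𝒯.base i ∩ 𝒯.base j)) := h1.sub h2
    rw [← integral_sub h1 h2, ← integral_sub h12 h3, ← integral_const_mul]
    refine integral_congr_ae (Eventually.of_forall fun x => ?_)
    simp only [timeJump]
    ring
  have hfacet' : ∀ i j, (if 𝒯.tMax i = 𝒯.tMin j then
      ∫ x in 𝒯.base i ∩ 𝒯.base j, bottomTrace u j x * timeJump u i j x else 0) = 1 / 2 *
      ((if 𝒯.tMax i = 𝒯.tMin j then ∫ x in 𝒯.base i ∩ 𝒯.base j, topTrace u i x ^ 2 else 0) -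
      (if 𝒯.tMax i = 𝒯.tMin j then ∫ x in 𝒯.base i ∩ 𝒯.base j, bottomTrace u j x ^ 2 else 0) -
      if 𝒯.tMax i = 𝒯.tMin j then ∫ x in 𝒯.base i ∩ 𝒯.base j, timeJump u i j x ^ 2 else 0) := by
    intro i j
    split_ifs
    · exact hfacet i j
    · simp
  have hparts : ∀ i, ∫ z in 𝒯.elem i, weakDeriv (𝒯.elem i) (timeDir d) (u i) z * u i z =
      1 / 2 * ((∫ x in 𝒯.base i, topTrace u i x ^ 2) - ∫ x in 𝒯.base i, bottomTrace u i x ^ 2) :=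
    fun i => integral_weakDeriv_time_mul_self (𝒯.base_polytope i) (𝒯.tMin_lt_tMax i) (hu i)
  have htop : ∑ i, ∫ x in 𝒯.base i, topTrace u i x ^ 2 = _ :=
    Finset.sum_congr rfl fun i _ => setIntegral_top (memLp_topTrace (hu i)).integrable_sq
  have hbot : ∑ i, ∫ x in 𝒯.base i, bottomTrace u i x ^ 2 = _ :=
    Finset.sum_congr rfl fun i _ => setIntegral_bottom (memLp_bottomTrace (hu i)).integrable_sq
  rw [Finset.sum_add_distrib] at htop hbot
  rw [Finset.sum_comm (f := fun j i => if 𝒯.tMax i = 𝒯.tMin j then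
    ∫ x in 𝒯.base i ∩ 𝒯.base j, bottomTrace u j x ^ 2 else 0)] at hbot
  rw [sq_jumpFunctional, mForm]
  simp_rw [hparts, hfacet', ← Finset.mul_sum, Finset.sum_sub_distrib, ← pow_two]
  rw [htop, hbot]
  ring

theorem mForm_smul_add_right {u v w : 𝒯.Broken} (hu : ∀ i, u i ∈ H1 (𝒯.elem i))
    (hv : ∀ i, v i ∈ H1 (𝒯.elem i)) (hw : ∀ i, w i ∈ H1 (𝒯.elem i)) (k : ℝ)
    (hvw : ∀ i, (k • v + w) i ∈ H1 (𝒯.elem i)) :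
    mForm u (k • v + w) = k * mForm u v + mForm u w := by
  have hb : ∀ i, bottomTrace (k • v + w) i =ᵐ[volume.restrict (𝒯.base i)]
      fun x => k * bottomTrace v i x + bottomTrace w i x := fun i =>
    ae_time_trace_smul_add (𝒯.base_polytope i)
      (isCollar_bottom (𝒯.base_polytope i) (𝒯.tMin_lt_tMax i)) (hv i) (hw i) k (hvw i)
  have e1 : ∀ i, ∫ z in 𝒯.elem i, weakDeriv (𝒯.elem i) (timeDir d) (u i) z * (k • v + w) i z =
      k * (∫ z in 𝒯.elem i, weakDeriv (𝒯.elem i) (timeDir d) (u i) z * v i z) +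
      ∫ z in 𝒯.elem i, weakDeriv (𝒯.elem i) (timeDir d) (u i) z * w i z := by
    intro i
    rw [← integral_const_mul, ← integral_add]
    · refine integral_congr_ae ?_
      filter_upwards [Lp.coeFn_add (k • v i) (w i), Lp.coeFn_smul k (v i)] with z h1 h2
      have : (k • v + w) i z = k * v i z + w i z := by
        change (k • v i + w i : L2 _) z = _
        rw [h1, Pi.add_apply, h2, Pi.smul_apply, smul_eq_mul]
      simp only [this]
      ring
    · exact ((Lp.memLp _).integrable_mul (Lp.memLp (v i))).const_mul k
    · exact (Lp.memLp _).integrable_mul (Lp.memLp (w i))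
  have e2 : ∀ i j, ∫ x in 𝒯.base i ∩ 𝒯.base j, bottomTrace (k • v + w) j x * timeJump u i j x =
      k * (∫ x in 𝒯.base i ∩ 𝒯.base j, bottomTrace v j x * timeJump u i j x) +
      ∫ x in 𝒯.base i ∩ 𝒯.base j, bottomTrace w j x * timeJump u i j x := by
    intro i j
    have hle : volume.restrict (𝒯.base i ∩ 𝒯.base j) ≤ volume.restrict (𝒯.base j) :=
      Measure.restrict_mono inter_subset_right le_rfl
    have hJ : MemLp (timeJump u i j) 2 (volume.restrict (𝒯.base i ∩ 𝒯.base j)) :=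
      ((memLp_topTrace (hu i)).mono_measure (Measure.restrict_mono inter_subset_left le_rfl)).sub
        ((memLp_bottomTrace (hu j)).mono_measure hle)
    rw [← integral_const_mul, ← integral_add]
    · refine integral_congr_ae ?_
      filter_upwards [ae_mono hle (hb j)] with x hx
      rw [hx]
      ring
    · exact (((memLp_bottomTrace (hv j)).mono_measure hle).integrable_mul hJ).const_mul k
    · exact ((memLp_bottomTrace (hw j)).mono_measure hle).integrable_mul hJ
  have e3 : ∀ i, ∫ x in 𝒯.base i, bottomTrace u i x * bottomTrace (k • v + w) i x =
      k * (∫ x in 𝒯.base i, bottomTrace u i x * bottomTrace v i x) +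
      ∫ x in 𝒯.base i, bottomTrace u i x * bottomTrace w i x := by
    intro i
    rw [← integral_const_mul, ← integral_add]
    · refine integral_congr_ae ?_
      filter_upwards [hb i] with x hx
      rw [hx]
      ring
    · exact ((memLp_bottomTrace (hu i)).integrable_mul (memLp_bottomTrace (hv i))).const_mul k
    · exact (memLp_bottomTrace (hu i)).integrable_mul (memLp_bottomTrace (hw i))
  have ite_lin : ∀ (p : Prop) [Decidable p] (a b : ℝ), (if p then k * a + b else 0) =
      k * (if p then a else 0) + if p then b else 0 := by
    intro p _ a b
    split_ifs <;> simp
  simp only [mForm, e1, e2, e3, ite_lin, Finset.sum_add_distrib, ← Finset.mul_sum]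
  ring

end PrismaticMesh

/-! ### Bilinear forms on finite-dimensional subspaces -/

/-- A form which is definite on a finite-dimensional subspace represents all linear functionals. -/
theorem existsUnique_of_definite {X : Type*} [AddCommGroup X] [Module ℝ X] {W : Submodule ℝ X}
    [FiniteDimensional ℝ W] {B : X → X → ℝ} {f : X → ℝ}
    (hl : ∀ (k : ℝ), ∀ x ∈ W, ∀ y ∈ W, ∀ z ∈ W, B (k • x + y) z = k * B x z + B y z)
    (hr : ∀ (k : ℝ), ∀ x ∈ W, ∀ y ∈ W, ∀ z ∈ W, B x (k • y + z) = k * B x y + B x z)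
    (hf : ∀ (k : ℝ), ∀ x ∈ W, ∀ y ∈ W, f (k • x + y) = k * f x + f y)
    (hdef : ∀ x ∈ W, B x x = 0 → x = 0) : ∃! x, x ∈ W ∧ ∀ y ∈ W, B x y = f y := by
  have mk : ∀ g : X → ℝ, (∀ (k : ℝ), ∀ x ∈ W, ∀ y ∈ W, g (k • x + y) = k * g x + g y) →
      ∃ L : W →ₗ[ℝ] ℝ, ∀ x : W, L x = g x := by
    intro g hg
    have h0 : g 0 = 0 := by
      have := hg 1 0 W.zero_mem 0 W.zero_mem
      simp only [smul_zero, add_zero, one_mul] at this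
      linarith
    refine ⟨⟨⟨fun x => g x, fun x y => ?_⟩, fun k x => ?_⟩, fun x => rfl⟩
    · simpa using hg 1 x x.2 y y.2
    · simpa [h0] using hg k x x.2 0 W.zero_mem
  choose b hb using fun x : W => mk (B x) (fun k y hy z hz => hr k x x.2 y hy z hz)
  obtain ⟨φ, hφ⟩ := mk f hf
  have h00 : ∀ z ∈ W, B 0 z = 0 := fun z hz => by
    have := hl 1 0 W.zero_mem 0 W.zero_mem z hz
    simp only [smul_zero, add_zero, one_mul] at this
    linarith
  let b' : W →ₗ[ℝ] Module.Dual ℝ W :=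
    { toFun := b
      map_add' := fun x y => LinearMap.ext fun z => by
        simpa [hb] using hl 1 x x.2 y y.2 z z.2
      map_smul' := fun k x => LinearMap.ext fun z => by
        simpa [hb, h00 z z.2] using hl k x x.2 0 W.zero_mem z z.2 }
  have hinj : Function.Injective b' := by
    rw [← LinearMap.ker_eq_bot, LinearMap.ker_eq_bot']
    intro x hx
    have : b x x = 0 := by
      change b' x x = 0
      rw [hx]
      rfl
    rw [hb] at this
    exact Subtype.ext (hdef x x.2 this)
  obtain ⟨x, hx⟩ := (LinearMap.injective_iff_surjective_of_finrank_eq_finrank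
    (Subspace.dual_finrank_eq (K := ℝ) (V := W)).symm).1 hinj φ
  have hx' : ∀ y ∈ W, B x y = f y := fun y hy => by
    have : b x ⟨y, hy⟩ = φ ⟨y, hy⟩ := by rw [← hx]; rfl
    rwa [hb, hφ] at this
  refine ⟨x, ⟨x.2, hx'⟩, fun y hy => ?_⟩
  have : b' ⟨y, hy.1⟩ = b' x := LinearMap.ext fun z => by
    change b _ z = b _ z
    rw [hb, hb, hy.2 z z.2, hx' z z.2]
  exact congrArg Subtype.val (hinj this)

theorem finiteDimensional_submodule_pi {ι : Type*} [Finite ι] {W : ι → Type*}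
    [∀ i, AddCommGroup (W i)] [∀ i, Module ℝ (W i)] (S : ∀ i, Submodule ℝ (W i))
    (hS : ∀ i, FiniteDimensional ℝ (S i)) : FiniteDimensional ℝ (Submodule.pi univ S) := by
  let f : Submodule.pi univ S →ₗ[ℝ] ∀ i, S i :=
    { toFun := fun x i => ⟨x.1 i, x.2 i (mem_univ i)⟩
      map_add' := fun _ _ => rfl
      map_smul' := fun _ _ => rfl }
  exact FiniteDimensional.of_injective f fun x y h =>
    Subtype.ext (funext fun i => congrArg Subtype.val (congrFun h i))

/-! ### Traces of broken functions on the time-like facets -/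

theorem MeasureTheory.MemLp.integrable_inner {X : Type*} [MeasurableSpace X] {μ : Measure X} {d : ℕ}
    {f g : X → Space d} (hf : MemLp f 2 μ) (hg : MemLp g 2 μ) :
    Integrable (fun x => inner ℝ (f x) (g x)) μ :=
  (hf.norm.integrable_mul hg.norm).mono' (hf.1.inner hg.1)
    (Eventually.of_forall fun x => norm_inner_le_norm (f x) (g x))

theorem integral_eq_mul_add {X : Type*} [MeasurableSpace X] {μ : Measure X} {f g h : X → ℝ} {k : ℝ}
    (hf : Integrable f μ) (hg : Integrable g μ) (hh : ∀ᵐ x ∂μ, h x = k * f x + g x) :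
    ∫ x, h x ∂μ = k * ∫ x, f x ∂μ + ∫ x, g x ∂μ := by
  rw [integral_congr_ae hh, integral_add (hf.const_mul k) hg, integral_const_mul]

namespace PrismaticMesh

variable {d : ℕ} {Ω : Set (Space d)} {T : ℝ} {𝒯 : PrismaticMesh Ω T} {i j : Fin 𝒯.N}

theorem memLp_sideTrace {u : 𝒯.Broken} (hu : u i ∈ H1 (𝒯.elem i)) : MemLp (sideTrace u i) 2
    (lateralMeasure (frontier (𝒯.base i)) (Ioo (𝒯.tMin i) (𝒯.tMax i))) :=
  memLp_trace_lateral (𝒯.base_polytope i) hu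

theorem ae_sideTrace_smul_add {u v : 𝒯.Broken} (hu : u i ∈ H1 (𝒯.elem i))
    (hv : v i ∈ H1 (𝒯.elem i)) (k : ℝ) (hw : (k • u + v) i ∈ H1 (𝒯.elem i)) :
    ∀ᵐ z ∂lateralMeasure (frontier (𝒯.base i)) (Ioo (𝒯.tMin i) (𝒯.tMax i)),
      sideTrace (k • u + v) i z = k * sideTrace u i z + sideTrace v i z :=
  ae_trace_smul_add (𝒯.base_polytope i) hu hv k hw

theorem sideTraceVec_eq_sum (r : 𝒯.BrokenVec) (i : Fin 𝒯.N) (z : SpaceTime d) :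
    sideTraceVec r i z =
      ∑ k, trace (r i k) z (𝒯.normal i z, 0) • EuclideanSpace.single k (1 : ℝ) := by
  ext k
  simp [sideTraceVec, Pi.single_apply]

theorem memLp_sideTraceVec {r : 𝒯.BrokenVec} (hr : ∀ k, r i k ∈ H1 (𝒯.elem i)) :
    MemLp (sideTraceVec r i) 2
      (lateralMeasure (frontier (𝒯.base i)) (Ioo (𝒯.tMin i) (𝒯.tMax i))) := by
  have : sideTraceVec r i = fun z =>
      ∑ k, trace (r i k) z (𝒯.normal i z, 0) • EuclideanSpace.single k (1 : ℝ) :=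
    funext (sideTraceVec_eq_sum r i)
  rw [this]
  refine memLp_finsetSum _ fun k _ => ?_
  have hk := memLp_trace_lateral (𝒯.base_polytope i) (hr k)
  refine hk.of_le (hk.1.smul aestronglyMeasurable_const) (Eventually.of_forall fun z => ?_)
  rw [norm_smul, PiLp.norm_single, norm_one, mul_one]
  rfl

theorem ae_sideTraceVec_smul_add {r s : 𝒯.BrokenVec} (hr : ∀ k, r i k ∈ H1 (𝒯.elem i))
    (hs : ∀ k, s i k ∈ H1 (𝒯.elem i)) (c : ℝ) (hw : ∀ k, (c • r + s) i k ∈ H1 (𝒯.elem i)) :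
    ∀ᵐ z ∂lateralMeasure (frontier (𝒯.base i)) (Ioo (𝒯.tMin i) (𝒯.tMax i)),
      sideTraceVec (c • r + s) i z = c • sideTraceVec r i z + sideTraceVec s i z := by
  filter_upwards [ae_all_iff.2 fun k =>
    ae_trace_smul_add (𝒯.base_polytope i) (hr k) (hs k) c (hw k)] with z hz
  ext k
  exact hz k

theorem memLp_sideTrace_smul_normal {u : 𝒯.Broken} (hu : u i ∈ H1 (𝒯.elem i)) :
    MemLp (fun z => sideTrace u i z • 𝒯.normal i z) 2
      (lateralMeasure (frontier (𝒯.base i)) (Ioo (𝒯.tMin i) (𝒯.tMax i))) := by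
  refine (memLp_sideTrace hu).of_le ((memLp_sideTrace hu).1.smul
    (aestronglyMeasurable_outwardNormal (𝒯.base_polytope i))) ?_
  filter_upwards [ae_isOutwardNormal (𝒯.base_polytope i)] with z hz
  rw [norm_smul, normal, hz.1, mul_one]

theorem memLp_normalJump {u : 𝒯.Broken} (hu : ∀ i, u i ∈ H1 (𝒯.elem i)) (i j : Fin 𝒯.N) :
    MemLp (normalJump u i j) 2 (𝒯.timeFacet i j) :=
  ((memLp_sideTrace_smul_normal (hu i)).mono_measure (timeFacet_le i j)).add
    ((memLp_sideTrace_smul_normal (hu j)).mono_measure (timeFacet_le_right i j))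

theorem ae_normalJump_smul_add {u v : 𝒯.Broken} (hu : ∀ i, u i ∈ H1 (𝒯.elem i))
    (hv : ∀ i, v i ∈ H1 (𝒯.elem i)) (k : ℝ) (hw : ∀ i, (k • u + v) i ∈ H1 (𝒯.elem i))
    (i j : Fin 𝒯.N) : ∀ᵐ z ∂𝒯.timeFacet i j,
      normalJump (k • u + v) i j z = k • normalJump u i j z + normalJump v i j z := by
  filter_upwards [ae_mono (timeFacet_le i j) (ae_sideTrace_smul_add (hu i) (hv i) k (hw i)),
    ae_mono (timeFacet_le_right i j) (ae_sideTrace_smul_add (hu j) (hv j) k (hw j))] with z hi hj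
  rw [normalJump, hi, hj, normalJump, normalJump]
  module

theorem memLp_average {α : SpaceTime d → ℝ} (hαm : Measurable α) (hα : ∀ z, α z ∈ Icc (0 : ℝ) 1)
    {r : 𝒯.BrokenVec} (hr : ∀ i k, r i k ∈ H1 (𝒯.elem i)) (i j : Fin 𝒯.N) :
    MemLp (fun z => average (1 - α z) r i j z) 2 (𝒯.timeFacet i j) := by
  have hi := (memLp_sideTraceVec (hr i)).mono_measure (timeFacet_le i j)
  have hj := (memLp_sideTraceVec (hr j)).mono_measure (timeFacet_le_right i j)
  have key : ∀ {β : SpaceTime d → ℝ} {f : SpaceTime d → Space d}, Measurable β →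
      (∀ z, β z ∈ Icc (0 : ℝ) 1) → MemLp f 2 (𝒯.timeFacet i j) →
      MemLp (fun z => β z • f z) 2 (𝒯.timeFacet i j) := by
    intro β f hβ hβ' hf
    refine hf.of_le (hβ.aestronglyMeasurable.smul hf.1) (Eventually.of_forall fun z => ?_)
    rw [norm_smul, Real.norm_of_nonneg (hβ' z).1]
    exact mul_le_of_le_one_left (norm_nonneg _) (hβ' z).2
  refine MemLp.add (key (by fun_prop) (fun z => ?_) hi) (key (by fun_prop) (fun z => ?_) hj)
  · rw [sub_sub_cancel]
    exact hα z
  · exact ⟨by linarith [(hα z).2], by linarith [(hα z).1]⟩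

theorem ae_average_smul_add {β : SpaceTime d → ℝ} {r s : 𝒯.BrokenVec}
    (hr : ∀ i k, r i k ∈ H1 (𝒯.elem i)) (hs : ∀ i k, s i k ∈ H1 (𝒯.elem i)) (c : ℝ)
    (hw : ∀ i k, (c • r + s) i k ∈ H1 (𝒯.elem i)) (i j : Fin 𝒯.N) : ∀ᵐ z ∂𝒯.timeFacet i j,
      average (β z) (c • r + s) i j z = c • average (β z) r i j z + average (β z) s i j z := by
  filter_upwards [ae_mono (timeFacet_le i j) (ae_sideTraceVec_smul_add (hr i) (hs i) c (hw i)),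
    ae_mono (timeFacet_le_right i j) (ae_sideTraceVec_smul_add (hr j) (hs j) c (hw j))]
    with z hi hj
  rw [average, hi, hj, average, average]
  module

theorem memLp_inner_outwardNormal (hΩ : IsPolytope Ω) {r : 𝒯.BrokenVec}
    (hr : ∀ k, r i k ∈ H1 (𝒯.elem i)) :
    MemLp (fun z => inner ℝ (sideTraceVec r i z) (outwardNormal Ω z.1)) 2 (𝒯.dirichletFacet i) := by
  have hle : 𝒯.dirichletFacet i ≤
      lateralMeasure (frontier Ω) (Ioo (𝒯.tMin i) (𝒯.tMax i)) :=
    lateralMeasure_mono inter_subset_right le_rfl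
  have hi := (memLp_sideTraceVec hr).mono_measure (dirichletFacet_le i)
  refine hi.of_le (hi.1.inner ((aestronglyMeasurable_outwardNormal hΩ).mono_measure hle)) ?_
  filter_upwards [ae_mono hle (ae_isOutwardNormal hΩ)] with z hz
  have := norm_inner_le_norm (𝕜 := ℝ) (sideTraceVec r i z) (outwardNormal Ω z.1)
  rwa [hz.1, mul_one] at this

end PrismaticMesh

namespace DiscreteSpaces

variable {d : ℕ} {Ω : Set (Space d)} {T : ℝ} {𝒯 : PrismaticMesh Ω T} {α : SpaceTime d → ℝ}

theorem liftingRhs_smul_add_right (hΩ : IsPolytope Ω) (hαm : Measurable α)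
    (hα : ∀ z, α z ∈ Icc (0 : ℝ) 1) {u : 𝒯.Broken} (hu : ∀ i, u i ∈ H1 (𝒯.elem i))
    {r s : 𝒯.BrokenVec} (hr : ∀ i k, r i k ∈ H1 (𝒯.elem i)) (hs : ∀ i k, s i k ∈ H1 (𝒯.elem i))
    (c : ℝ) (hw : ∀ i k, (c • r + s) i k ∈ H1 (𝒯.elem i)) :
    liftingRhs α u (c • r + s) = c * liftingRhs α u r + liftingRhs α u s := by
  have e1 : ∀ i j, ∫ z, inner ℝ (normalJump u i j z) (average (1 - α z) (c • r + s) i j z)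
      ∂(𝒯.timeFacet i j) =
      c * ∫ z, inner ℝ (normalJump u i j z) (average (1 - α z) r i j z) ∂(𝒯.timeFacet i j) +
      ∫ z, inner ℝ (normalJump u i j z) (average (1 - α z) s i j z) ∂(𝒯.timeFacet i j) := by
    intro i j
    refine integral_eq_mul_add
      ((memLp_normalJump hu i j).integrable_inner (memLp_average hαm hα hr i j))
      ((memLp_normalJump hu i j).integrable_inner (memLp_average hαm hα hs i j)) ?_
    filter_upwards [ae_average_smul_add (β := fun z => 1 - α z) hr hs c hw i j] with z hz
    rw [hz, inner_add_right, inner_smul_right]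
  have e2 : ∀ i, ∫ z, sideTrace u i z * inner ℝ (sideTraceVec (c • r + s) i z)
      (outwardNormal Ω z.1) ∂(𝒯.dirichletFacet i) =
      c * ∫ z, sideTrace u i z * inner ℝ (sideTraceVec r i z) (outwardNormal Ω z.1)
        ∂(𝒯.dirichletFacet i) +
      ∫ z, sideTrace u i z * inner ℝ (sideTraceVec s i z) (outwardNormal Ω z.1)
        ∂(𝒯.dirichletFacet i) := by
    intro i
    have hui := (memLp_sideTrace (hu i)).mono_measure (dirichletFacet_le i)
    refine integral_eq_mul_add (hui.integrable_mul (memLp_inner_outwardNormal hΩ (hr i)))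
      (hui.integrable_mul (memLp_inner_outwardNormal hΩ (hs i))) ?_
    filter_upwards [ae_mono (dirichletFacet_le i)
      (ae_sideTraceVec_smul_add (hr i) (hs i) c (hw i))] with z hz
    rw [hz, inner_add_left, inner_smul_left]
    simp only [RCLike.conj_to_real]
    ring
  simp only [liftingRhs, e1, e2, Finset.sum_add_distrib, ← Finset.mul_sum]
  ring

theorem liftingRhs_smul_add_left (hΩ : IsPolytope Ω) (hαm : Measurable α)
    (hα : ∀ z, α z ∈ Icc (0 : ℝ) 1) {u v : 𝒯.Broken} (hu : ∀ i, u i ∈ H1 (𝒯.elem i))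
    (hv : ∀ i, v i ∈ H1 (𝒯.elem i)) (c : ℝ) (hw : ∀ i, (c • u + v) i ∈ H1 (𝒯.elem i))
    {r : 𝒯.BrokenVec} (hr : ∀ i k, r i k ∈ H1 (𝒯.elem i)) :
    liftingRhs α (c • u + v) r = c * liftingRhs α u r + liftingRhs α v r := by
  have e1 : ∀ i j, ∫ z, inner ℝ (normalJump (c • u + v) i j z) (average (1 - α z) r i j z)
      ∂(𝒯.timeFacet i j) =
      c * ∫ z, inner ℝ (normalJump u i j z) (average (1 - α z) r i j z) ∂(𝒯.timeFacet i j) +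
      ∫ z, inner ℝ (normalJump v i j z) (average (1 - α z) r i j z) ∂(𝒯.timeFacet i j) := by
    intro i j
    refine integral_eq_mul_add
      ((memLp_normalJump hu i j).integrable_inner (memLp_average hαm hα hr i j))
      ((memLp_normalJump hv i j).integrable_inner (memLp_average hαm hα hr i j)) ?_
    filter_upwards [ae_normalJump_smul_add hu hv c hw i j] with z hz
    rw [hz, inner_add_left, inner_smul_left]
    simp
  have e2 : ∀ i, ∫ z, sideTrace (c • u + v) i z * inner ℝ (sideTraceVec r i z)
      (outwardNormal Ω z.1) ∂(𝒯.dirichletFacet i) =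
      c * ∫ z, sideTrace u i z * inner ℝ (sideTraceVec r i z) (outwardNormal Ω z.1)
        ∂(𝒯.dirichletFacet i) +
      ∫ z, sideTrace v i z * inner ℝ (sideTraceVec r i z) (outwardNormal Ω z.1)
        ∂(𝒯.dirichletFacet i) := by
    intro i
    have hri := memLp_inner_outwardNormal hΩ (hr i)
    refine integral_eq_mul_add
      (((memLp_sideTrace (hu i)).mono_measure (dirichletFacet_le i)).integrable_mul hri)
      (((memLp_sideTrace (hv i)).mono_measure (dirichletFacet_le i)).integrable_mul hri) ?_
    filter_upwards [ae_mono (dirichletFacet_le i)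
      (ae_sideTrace_smul_add (hu i) (hv i) c (hw i))] with z hz
    rw [hz]
    ring
  simp only [liftingRhs, e1, e2, Finset.sum_add_distrib, ← Finset.mul_sum]
  ring

end DiscreteSpaces

/-! ### The lifting operator and the LDG gradient -/

theorem Lp_ae_smul_add {d : ℕ} {K : Set (SpaceTime d)} (c : ℝ) (f g : L2 K) :
    ∀ᵐ z ∂volume.restrict K, (c • f + g : L2 K) z = c * f z + g z := by
  filter_upwards [Lp.coeFn_add (c • f) g, Lp.coeFn_smul c f] with z h1 h2
  rw [h1, Pi.add_apply, h2, Pi.smul_apply, smul_eq_mul]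

theorem Lp_eq_zero_of_integral_sum_mul_self {d : ℕ} {K : Set (SpaceTime d)} {p : Fin d → L2 K}
    (h : ∫ z in K, ∑ k, p k z * p k z = 0) : p = 0 := by
  have hi : Integrable (fun z => ∑ k, p k z * p k z) (volume.restrict K) :=
    integrable_finsetSum _ fun k _ => (Lp.memLp (p k)).integrable_mul (Lp.memLp (p k))
  have h0 := (integral_eq_zero_iff_of_nonneg_ae (Eventually.of_forall fun z =>
    Finset.sum_nonneg fun k _ => mul_self_nonneg _) hi).1 h
  funext k
  refine Lp.ext ?_
  filter_upwards [h0, Lp.coeFn_zero ℝ 2 (volume.restrict K)] with z hz hz0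
  have := (Finset.sum_eq_zero_iff_of_nonneg fun k _ => mul_self_nonneg (p k z)).1 hz k
    (Finset.mem_univ k)
  rw [mul_self_eq_zero.1 this]
  exact hz0.symm

namespace DiscreteSpaces

variable {d : ℕ} {Ω : Set (Space d)} {T : ℝ} {𝒯 : PrismaticMesh Ω T} (D : DiscreteSpaces 𝒯)
  {α : SpaceTime d → ℝ}

theorem mem_H1_of_mem_Vh {u : 𝒯.Broken} (hu : u ∈ D.Vh) (i : Fin 𝒯.N) : u i ∈ H1 (𝒯.elem i) :=
  D.V_subset i _ (hu i (mem_univ i))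

theorem mem_H1_of_mem_Mh {r : 𝒯.BrokenVec} (hr : r ∈ D.Mh) (i : Fin 𝒯.N) (k : Fin d) :
    r i k ∈ H1 (𝒯.elem i) :=
  D.M_subset i _ (hr i (mem_univ i)) k

theorem finiteDimensional_Vh : FiniteDimensional ℝ D.Vh :=
  finiteDimensional_submodule_pi D.V D.finite_V

theorem finiteDimensional_Mh : FiniteDimensional ℝ D.Mh :=
  finiteDimensional_submodule_pi D.M D.finite_M

theorem l2Form_smul_add_left (c : ℝ) (r s t : 𝒯.BrokenVec) :
    ∑ i, ∫ z in 𝒯.elem i, ∑ k, (c • r + s) i k z * t i k z =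
      c * (∑ i, ∫ z in 𝒯.elem i, ∑ k, r i k z * t i k z) +
      ∑ i, ∫ z in 𝒯.elem i, ∑ k, s i k z * t i k z := by
  rw [Finset.mul_sum, ← Finset.sum_add_distrib]
  refine Finset.sum_congr rfl fun i _ => integral_eq_mul_add
    (integrable_finsetSum _ fun k _ => (Lp.memLp (r i k)).integrable_mul (Lp.memLp (t i k)))
    (integrable_finsetSum _ fun k _ => (Lp.memLp (s i k)).integrable_mul (Lp.memLp (t i k))) ?_
  filter_upwards [ae_all_iff.2 fun k => Lp_ae_smul_add c (r i k) (s i k)] with z hz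
  rw [Finset.mul_sum, ← Finset.sum_add_distrib]
  refine Finset.sum_congr rfl fun k _ => ?_
  change (c • r i k + s i k : L2 _) z * t i k z = _
  rw [hz k]
  ring

theorem l2Form_comm (r s : 𝒯.BrokenVec) : ∑ i, ∫ z in 𝒯.elem i, ∑ k, r i k z * s i k z =
    ∑ i, ∫ z in 𝒯.elem i, ∑ k, s i k z * r i k z := by
  simp only [mul_comm]

theorem existsUnique_isLifting (hΩ : IsPolytope Ω) (hαm : Measurable α)
    (hα : ∀ z, α z ∈ Icc (0 : ℝ) 1) {u : 𝒯.Broken} (hu : u ∈ D.Vh) :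
    ∃! L, D.IsLifting α u L := by
  have := D.finiteDimensional_Mh
  refine existsUnique_of_definite (W := D.Mh)
    (B := fun L r => ∑ i, ∫ z in 𝒯.elem i, ∑ k, L i k z * r i k z) (f := liftingRhs α u)
    (fun c x _ y _ z _ => l2Form_smul_add_left c x y z) (fun c x _ y _ z _ => ?_)
    (fun c x hx y hy => liftingRhs_smul_add_right hΩ hαm hα (D.mem_H1_of_mem_Vh hu)
      (D.mem_H1_of_mem_Mh hx) (D.mem_H1_of_mem_Mh hy) c
      (D.mem_H1_of_mem_Mh (D.Mh.add_mem (D.Mh.smul_mem c hx) hy))) (fun x _ h => ?_)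
  · rw [l2Form_comm x, l2Form_smul_add_left, l2Form_comm x, l2Form_comm x]
  · have h0 := (Finset.sum_eq_zero_iff_of_nonneg fun i _ => integral_nonneg fun z =>
      Finset.sum_nonneg fun k _ => mul_self_nonneg (x i k z)).1 h
    funext i
    exact Lp_eq_zero_of_integral_sum_mul_self (h0 i (Finset.mem_univ i))

theorem isLifting_lifting (hΩ : IsPolytope Ω) (hαm : Measurable α) (hα : ∀ z, α z ∈ Icc (0 : ℝ) 1)
    {u : 𝒯.Broken} (hu : u ∈ D.Vh) : D.IsLifting α u (D.lifting α u) := by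
  have h := (D.existsUnique_isLifting hΩ hαm hα hu).exists
  rw [lifting, dif_pos h]
  exact h.choose_spec

theorem lifting_smul_add (hΩ : IsPolytope Ω) (hαm : Measurable α) (hα : ∀ z, α z ∈ Icc (0 : ℝ) 1)
    {u v : 𝒯.Broken} (hu : u ∈ D.Vh) (hv : v ∈ D.Vh) (c : ℝ) :
    D.lifting α (c • u + v) = c • D.lifting α u + D.lifting α v := by
  have hw : c • u + v ∈ D.Vh := D.Vh.add_mem (D.Vh.smul_mem c hu) hv
  have h1 := D.isLifting_lifting hΩ hαm hα hu
  have h2 := D.isLifting_lifting hΩ hαm hα hv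
  refine (D.existsUnique_isLifting hΩ hαm hα hw).unique (D.isLifting_lifting hΩ hαm hα hw)
    ⟨D.Mh.add_mem (D.Mh.smul_mem c h1.1) h2.1, fun r hr => ?_⟩
  rw [l2Form_smul_add_left, h1.2 r hr, h2.2 r hr, liftingRhs_smul_add_left hΩ hαm hα
    (D.mem_H1_of_mem_Vh hu) (D.mem_H1_of_mem_Vh hv) c (D.mem_H1_of_mem_Vh hw)
    (D.mem_H1_of_mem_Mh hr)]

theorem ldgGrad_smul_add (hΩ : IsPolytope Ω) (hαm : Measurable α) (hα : ∀ z, α z ∈ Icc (0 : ℝ) 1)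
    {u v : 𝒯.Broken} (hu : u ∈ D.Vh) (hv : v ∈ D.Vh) (c : ℝ) :
    D.ldgGrad α (c • u + v) = c • D.ldgGrad α u + D.ldgGrad α v := by
  funext i k
  have h1 := weakDeriv_smul_add (isOpen_elem i) (D.mem_H1_of_mem_Vh hu i)
    (D.mem_H1_of_mem_Vh hv i) c (spaceDir k)
  have h2 : D.lifting α (c • u + v) i k = c • D.lifting α u i k + D.lifting α v i k := by
    rw [D.lifting_smul_add hΩ hαm hα hu hv c]
    rfl
  change weakDeriv (𝒯.elem i) (spaceDir k) (c • u i + v i) - D.lifting α (c • u + v) i k =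
    c • (weakDeriv (𝒯.elem i) (spaceDir k) (u i) - D.lifting α u i k) +
      (weakDeriv (𝒯.elem i) (spaceDir k) (v i) - D.lifting α v i k)
  rw [h1, h2, smul_sub]
  abel

end DiscreteSpaces

/-! ### The form for the diffusion -/

theorem Matrix.mulVec_dotProduct_comm {d : ℕ} {A : Matrix (Fin d) (Fin d) ℝ} (hA : A.IsSymm)
    (x y : Fin d → ℝ) : A.mulVec x ⬝ᵥ y = A.mulVec y ⬝ᵥ x := by
  rw [dotProduct_comm, Matrix.dotProduct_mulVec, ← Matrix.mulVec_transpose, hA.eq]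

open scoped MatrixOrder Matrix.Norms.L2Operator in
theorem Matrix.norm_sqrt_mulVec_sq {d : ℕ} {A : Matrix (Fin d) (Fin d) ℝ} (hA : A.IsSymm)
    (h : ∀ y : Fin d → ℝ, 0 ≤ y ⬝ᵥ A.mulVec y) (y : Fin d → ℝ) :
    ‖(WithLp.toLp 2 ((CFC.sqrt A).mulVec y) : Space d)‖ ^ 2 = A.mulVec y ⬝ᵥ y := by
  have hpos : 0 ≤ A := Matrix.nonneg_iff_posSemidef.2 (.of_dotProduct_mulVec_nonneg (by
    rw [Matrix.IsHermitian, Matrix.conjTranspose_eq_transpose_of_trivial]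
    exact hA) (by simpa using h))
  have hs : (CFC.sqrt A).transpose = CFC.sqrt A := by
    have := (Matrix.nonneg_iff_posSemidef.1 (CFC.sqrt_nonneg A)).isHermitian
    rwa [Matrix.IsHermitian, Matrix.conjTranspose_eq_transpose_of_trivial] at this
  rw [EuclideanSpace.real_norm_sq_eq]
  have h1 : A.mulVec y ⬝ᵥ y = (CFC.sqrt A).mulVec y ⬝ᵥ (CFC.sqrt A).mulVec y := by
    rw [Matrix.dotProduct_mulVec, ← Matrix.mulVec_transpose, hs, Matrix.mulVec_mulVec,
      CFC.sqrt_mul_sqrt_self A hpos]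
  rw [h1]
  simp [dotProduct, pow_two]

namespace PrismaticMesh

variable {d : ℕ} {Ω : Set (Space d)} {T : ℝ} {𝒯 : PrismaticMesh Ω T}
  {κ : SpaceTime d → Matrix (Fin d) (Fin d) ℝ}

theorem elem_subset (i : Fin 𝒯.N) : 𝒯.elem i ⊆ Ω ×ˢ Ioo 0 T := fun _ hz =>
  ⟨𝒯.base_subset i hz.1, (𝒯.tMin_nonneg i).trans_lt hz.2.1, hz.2.2.trans_le (𝒯.tMax_le i)⟩

theorem ae_elem (i : Fin 𝒯.N) : ∀ᵐ z ∂volume.restrict (𝒯.elem i), z ∈ Ω ×ˢ Ioo 0 T := by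
  filter_upwards [ae_restrict_mem (isOpen_elem i).measurableSet] with z hz using elem_subset i hz

theorem integrable_diffusion (hκ : IsDiffusionTensor Ω T κ) {i : Fin 𝒯.N}
    (p q : Fin d → L2 (𝒯.elem i)) : Integrable
      (fun z => (κ z).mulVec (fun k => p k z) ⬝ᵥ fun k => q k z) (volume.restrict (𝒯.elem i)) := by
  obtain ⟨C, hC⟩ := hκ.bounded
  simp only [dotProduct, Matrix.mulVec, Finset.sum_mul]
  refine integrable_finsetSum _ fun k _ => integrable_finsetSum _ fun l _ => ?_
  simp only [mul_assoc]
  refine Integrable.bdd_mul (c := C) ((Lp.memLp (p l)).integrable_mul (Lp.memLp (q k)))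
    (hκ.measurable k l).aestronglyMeasurable ?_
  filter_upwards [ae_elem i] with z hz using hC z hz k l

theorem timeFacet_le_lateralSkeleton {i j : Fin 𝒯.N} (hij : j ∈ Finset.Ioi i) :
    𝒯.timeFacet i j ≤ 𝒯.lateralSkeleton := by
  have h1 : 𝒯.timeFacet i j ≤ ∑ j ∈ Finset.Ioi i, 𝒯.timeFacet i j :=
    Finset.single_le_sum (f := fun j => 𝒯.timeFacet i j) (fun _ _ => Measure.zero_le _) hij
  have h2 : ∑ j ∈ Finset.Ioi i, 𝒯.timeFacet i j ≤ ∑ i, ∑ j ∈ Finset.Ioi i, 𝒯.timeFacet i j :=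
    Finset.single_le_sum (f := fun i => ∑ j ∈ Finset.Ioi i, 𝒯.timeFacet i j)
      (fun _ _ => Measure.zero_le _) (Finset.mem_univ i)
  exact (h1.trans h2).trans (Measure.le_add_right le_rfl)

theorem dirichletFacet_le_lateralSkeleton (i : Fin 𝒯.N) :
    𝒯.dirichletFacet i ≤ 𝒯.lateralSkeleton :=
  (Finset.single_le_sum (f := fun i => 𝒯.dirichletFacet i) (fun _ _ => Measure.zero_le _)
    (Finset.mem_univ i)).trans (Measure.le_add_left le_rfl)

theorem integrable_timeFacet {η : SpaceTime d → ℝ} (hη : MemLp η ⊤ 𝒯.lateralSkeleton)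
    {u v : 𝒯.Broken} (hu : ∀ i, u i ∈ H1 (𝒯.elem i)) (hv : ∀ i, v i ∈ H1 (𝒯.elem i))
    {i j : Fin 𝒯.N} (hij : j ∈ Finset.Ioi i) : Integrable
      (fun z => η z * inner ℝ (normalJump u i j z) (normalJump v i j z)) (𝒯.timeFacet i j) :=
  ((memLp_normalJump hu i j).integrable_inner (memLp_normalJump hv i j)).mul_of_top_right
    (hη.mono_measure (timeFacet_le_lateralSkeleton hij))

theorem integrable_dirichletFacet {η : SpaceTime d → ℝ} (hη : MemLp η ⊤ 𝒯.lateralSkeleton)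
    {u v : 𝒯.Broken} (hu : ∀ i, u i ∈ H1 (𝒯.elem i)) (hv : ∀ i, v i ∈ H1 (𝒯.elem i))
    (i : Fin 𝒯.N) : Integrable
      (fun z => η z * (sideTrace u i z * sideTrace v i z)) (𝒯.dirichletFacet i) :=
  Integrable.mul_of_top_right (((memLp_sideTrace (hu i)).mono_measure
    (dirichletFacet_le i)).integrable_mul ((memLp_sideTrace (hv i)).mono_measure
    (dirichletFacet_le i))) (hη.mono_measure (dirichletFacet_le_lateralSkeleton i))

end PrismaticMesh

namespace DiscreteSpaces

variable {d : ℕ} {Ω : Set (Space d)} {T : ℝ} {𝒯 : PrismaticMesh Ω T} (D : DiscreteSpaces 𝒯)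
  {κ : SpaceTime d → Matrix (Fin d) (Fin d) ℝ} {α η : SpaceTime d → ℝ}

theorem aForm_comm (hκ : IsDiffusionTensor Ω T κ) (u v : 𝒯.Broken) :
    D.aForm κ α η u v = D.aForm κ α η v u := by
  have e1 : ∀ i, ∫ z in 𝒯.elem i,
      (κ z).mulVec (fun k => D.ldgGrad α u i k z) ⬝ᵥ (fun k => D.ldgGrad α v i k z) =
      ∫ z in 𝒯.elem i,
      (κ z).mulVec (fun k => D.ldgGrad α v i k z) ⬝ᵥ fun k => D.ldgGrad α u i k z := by
    intro i
    refine integral_congr_ae ?_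
    filter_upwards [ae_elem i] with z hz
    exact Matrix.mulVec_dotProduct_comm (hκ.symm z hz) _ _
  simp only [aForm, e1]
  congr 1
  · congr 1
    simp only [real_inner_comm]
  · simp only [mul_comm (sideTrace u _ _)]

theorem aForm_smul_add_left (hΩ : IsPolytope Ω) (hκ : IsDiffusionTensor Ω T κ)
    (hαm : Measurable α) (hα : ∀ z, α z ∈ Icc (0 : ℝ) 1) (hη : MemLp η ⊤ 𝒯.lateralSkeleton)
    (c : ℝ) {u v w : 𝒯.Broken} (hu : u ∈ D.Vh) (hv : v ∈ D.Vh) (hw : w ∈ D.Vh) :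
    D.aForm κ α η (c • u + v) w = c * D.aForm κ α η u w + D.aForm κ α η v w := by
  have huv : c • u + v ∈ D.Vh := D.Vh.add_mem (D.Vh.smul_mem c hu) hv
  have hu1 := D.mem_H1_of_mem_Vh hu
  have hv1 := D.mem_H1_of_mem_Vh hv
  have hw1 := D.mem_H1_of_mem_Vh hw
  have huv1 := D.mem_H1_of_mem_Vh huv
  have e1 : ∀ i, ∫ z in 𝒯.elem i,
      (κ z).mulVec (fun k => D.ldgGrad α (c • u + v) i k z) ⬝ᵥ (fun k => D.ldgGrad α w i k z) =
      c * (∫ z in 𝒯.elem i,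
        (κ z).mulVec (fun k => D.ldgGrad α u i k z) ⬝ᵥ fun k => D.ldgGrad α w i k z) +
      ∫ z in 𝒯.elem i,
        (κ z).mulVec (fun k => D.ldgGrad α v i k z) ⬝ᵥ fun k => D.ldgGrad α w i k z := by
    intro i
    refine integral_eq_mul_add (integrable_diffusion hκ _ _) (integrable_diffusion hκ _ _) ?_
    filter_upwards [ae_all_iff.2 fun k =>
      Lp_ae_smul_add c (D.ldgGrad α u i k) (D.ldgGrad α v i k)] with z hz
    have : (fun k => D.ldgGrad α (c • u + v) i k z) =
        c • (fun k => D.ldgGrad α u i k z) + fun k => D.ldgGrad α v i k z := by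
      funext k
      rw [D.ldgGrad_smul_add hΩ hαm hα hu hv c]
      exact hz k
    rw [this, Matrix.mulVec_add, Matrix.mulVec_smul, add_dotProduct, smul_dotProduct, smul_eq_mul]
  have e2 : ∑ i, ∑ j ∈ Finset.Ioi i,
      ∫ z, η z * inner ℝ (normalJump (c • u + v) i j z) (normalJump w i j z) ∂(𝒯.timeFacet i j) =
      ∑ i, ∑ j ∈ Finset.Ioi i,
      (c * (∫ z, η z * inner ℝ (normalJump u i j z) (normalJump w i j z) ∂(𝒯.timeFacet i j)) +
      ∫ z, η z * inner ℝ (normalJump v i j z) (normalJump w i j z) ∂(𝒯.timeFacet i j)) := by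
    refine Finset.sum_congr rfl fun i _ => Finset.sum_congr rfl fun j hj => ?_
    refine integral_eq_mul_add (integrable_timeFacet hη hu1 hw1 hj)
      (integrable_timeFacet hη hv1 hw1 hj) ?_
    filter_upwards [ae_normalJump_smul_add hu1 hv1 c huv1 i j] with z hz
    rw [hz, inner_add_left, inner_smul_left]
    simp only [RCLike.conj_to_real]
    ring
  have e3 : ∀ i,
      ∫ z, η z * (sideTrace (c • u + v) i z * sideTrace w i z) ∂(𝒯.dirichletFacet i) =
      c * (∫ z, η z * (sideTrace u i z * sideTrace w i z) ∂(𝒯.dirichletFacet i)) +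
      ∫ z, η z * (sideTrace v i z * sideTrace w i z) ∂(𝒯.dirichletFacet i) := by
    intro i
    refine integral_eq_mul_add (integrable_dirichletFacet hη hu1 hw1 i)
      (integrable_dirichletFacet hη hv1 hw1 i) ?_
    filter_upwards [ae_mono (dirichletFacet_le i)
      (ae_sideTrace_smul_add (hu1 i) (hv1 i) c (huv1 i))] with z hz
    rw [hz]
    ring
  simp only [aForm, e1, e2, e3, Finset.sum_add_distrib, ← Finset.mul_sum]
  ring

theorem ldgNorm_eq_sqrt_aForm (hκ : IsDiffusionTensor Ω T κ)
    (hη_pos : ∃ c > 0, ∀ᵐ z ∂𝒯.lateralSkeleton, c ≤ η z) (u : 𝒯.Broken) :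
    D.ldgNorm κ α η u = √(D.aForm κ α η u u) := by
  obtain ⟨c, hc, hcη⟩ := hη_pos
  obtain ⟨θ, hθ, hell⟩ := hκ.elliptic
  rw [ldgNorm, aForm]
  refine congrArg Real.sqrt (congrArg₂ (· + ·) (congrArg₂ (· + ·) ?_ ?_) ?_)
  · refine Finset.sum_congr rfl fun i _ => integral_congr_ae ?_
    filter_upwards [ae_elem i] with z hz
    refine Matrix.norm_sqrt_mulVec_sq (hκ.symm z hz) (fun y => (?_ : (0 : ℝ) ≤ _).trans
      (hell z hz y)) _
    exact mul_nonneg hθ.le (Finset.sum_nonneg fun k _ => mul_self_nonneg _)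
  · refine Finset.sum_congr rfl fun i _ => Finset.sum_congr rfl fun j hj => integral_congr_ae ?_
    filter_upwards [ae_mono (timeFacet_le_lateralSkeleton hj) hcη] with z hz
    rw [norm_smul, mul_pow, Real.norm_eq_abs, sq_abs, Real.sq_sqrt (hc.le.trans hz),
      real_inner_self_eq_norm_sq]
  · refine Finset.sum_congr rfl fun i _ => integral_congr_ae ?_
    filter_upwards [ae_mono (dirichletFacet_le_lateralSkeleton i) hcη] with z hz
    rw [mul_pow, Real.sq_sqrt (hc.le.trans hz), pow_two]

/-- The diffusion form is a sum of nonnegative terms; these vanish only if the LDG gradient, the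
jumps and the Dirichlet traces do. -/
theorem aForm_self_nonneg_and_eq_zero_imp (hκ : IsDiffusionTensor Ω T κ)
    (hη : MemLp η ⊤ 𝒯.lateralSkeleton)
    (hη_pos : ∃ c > 0, ∀ᵐ z ∂𝒯.lateralSkeleton, c ≤ η z) {u : 𝒯.Broken}
    (hu : ∀ i, u i ∈ H1 (𝒯.elem i)) :
    0 ≤ D.aForm κ α η u u ∧ (D.aForm κ α η u u = 0 → D.ldgGrad α u = 0 ∧
      (∀ i j, i < j → ∀ᵐ z ∂𝒯.timeFacet i j, normalJump u i j z = 0) ∧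
      ∀ i, ∀ᵐ z ∂𝒯.dirichletFacet i, sideTrace u i z = 0) := by
  obtain ⟨c, hc, hcη⟩ := hη_pos
  obtain ⟨θ, hθ, hell⟩ := hκ.elliptic
  have hsq : ∀ y : Fin d → ℝ, 0 ≤ y ⬝ᵥ y := fun y => Finset.sum_nonneg fun k _ => mul_self_nonneg _
  have p1 : ∀ i, 0 ≤ᵐ[volume.restrict (𝒯.elem i)] fun z =>
      (κ z).mulVec (fun k => D.ldgGrad α u i k z) ⬝ᵥ fun k => D.ldgGrad α u i k z := by
    intro i
    filter_upwards [ae_elem i] with z hz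
    rw [dotProduct_comm]
    exact (mul_nonneg hθ.le (hsq _)).trans (hell z hz _)
  have p2 : ∀ i, ∀ j ∈ Finset.Ioi i, 0 ≤ᵐ[𝒯.timeFacet i j] fun z =>
      η z * inner ℝ (normalJump u i j z) (normalJump u i j z) := by
    intro i j hj
    filter_upwards [ae_mono (timeFacet_le_lateralSkeleton hj) hcη] with z hz
    exact mul_nonneg (hc.le.trans hz) real_inner_self_nonneg
  have p3 : ∀ i, 0 ≤ᵐ[𝒯.dirichletFacet i] fun z => η z * (sideTrace u i z * sideTrace u i z) := by
    intro i
    filter_upwards [ae_mono (dirichletFacet_le_lateralSkeleton i) hcη] with z hz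
    exact mul_nonneg (hc.le.trans hz) (mul_self_nonneg _)
  have q1 := fun i => integral_nonneg_of_ae (p1 i)
  have q2 := fun i j (hj : j ∈ Finset.Ioi i) => integral_nonneg_of_ae (p2 i j hj)
  have q3 := fun i => integral_nonneg_of_ae (p3 i)
  have s1 := Finset.sum_nonneg fun i (_ : i ∈ Finset.univ) => q1 i
  have s2 := Finset.sum_nonneg fun i (_ : i ∈ Finset.univ) => Finset.sum_nonneg (q2 i)
  have s3 := Finset.sum_nonneg fun i (_ : i ∈ Finset.univ) => q3 i
  refine ⟨add_nonneg (add_nonneg s1 s2) s3, fun h0 => ?_⟩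
  have t1 := fun i => (Finset.sum_eq_zero_iff_of_nonneg fun i _ => q1 i).1
    (by rw [aForm] at h0; linarith) i (Finset.mem_univ i)
  have t2 := fun i => (Finset.sum_eq_zero_iff_of_nonneg fun i _ => Finset.sum_nonneg (q2 i)).1
    (by rw [aForm] at h0; linarith) i (Finset.mem_univ i)
  have t3 := fun i => (Finset.sum_eq_zero_iff_of_nonneg fun i _ => q3 i).1
    (by rw [aForm] at h0; linarith) i (Finset.mem_univ i)
  refine ⟨funext fun i => Lp_eq_zero_of_integral_sum_mul_self ?_, fun i j hij => ?_, fun i => ?_⟩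
  · have h1 := (integral_eq_zero_iff_of_nonneg_ae (p1 i) (integrable_diffusion hκ _ _)).1 (t1 i)
    refine integral_eq_zero_of_ae ?_
    filter_upwards [h1, ae_elem i] with z h1 hz
    have h2 := hell z hz fun k => D.ldgGrad α u i k z
    rw [dotProduct_comm _ ((κ z).mulVec _)] at h2
    have h3 := h2.trans h1.le
    exact le_antisymm (nonpos_of_mul_nonpos_right h3 hθ) (hsq _)
  · have hj : j ∈ Finset.Ioi i := Finset.mem_Ioi.2 hij
    have h1 := (integral_eq_zero_iff_of_nonneg_ae (p2 i j hj) (integrable_timeFacet hη hu hu hj)).1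
      ((Finset.sum_eq_zero_iff_of_nonneg (q2 i)).1 (t2 i) j hj)
    filter_upwards [h1, ae_mono (timeFacet_le_lateralSkeleton hj) hcη] with z h1 hz
    exact inner_self_eq_zero.1 ((mul_eq_zero.1 h1).resolve_left (hc.trans_le hz).ne')
  · have h1 := (integral_eq_zero_iff_of_nonneg_ae (p3 i) (integrable_dirichletFacet hη hu hu i)).1
      (t3 i)
    filter_upwards [h1, ae_mono (dirichletFacet_le_lateralSkeleton i) hcη] with z h1 hz
    exact mul_self_eq_zero.1 ((mul_eq_zero.1 h1).resolve_left (hc.trans_le hz).ne')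

/-- The diffusion form is definite: where it vanishes the lifting has zero data, hence the broken
gradient vanishes too. -/
theorem eq_zero_of_aForm_self_eq_zero (hd : 1 ≤ d) (hΩ : IsPolytope Ω)
    (hκ : IsDiffusionTensor Ω T κ) (hαm : Measurable α) (hα : ∀ z, α z ∈ Icc (0 : ℝ) 1)
    (hη : MemLp η ⊤ 𝒯.lateralSkeleton) (hη_pos : ∃ c > 0, ∀ᵐ z ∂𝒯.lateralSkeleton, c ≤ η z)
    {u : 𝒯.Broken} (hu : u ∈ D.Vh) (h : D.aForm κ α η u u = 0) : u = 0 := by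
  have hu1 := D.mem_H1_of_mem_Vh hu
  obtain ⟨hgrad, hjump, hdir⟩ := (D.aForm_self_nonneg_and_eq_zero_imp (α := α) hκ hη hη_pos hu1).2 h
  have hlift : D.lifting α u = 0 := by
    refine (D.existsUnique_isLifting hΩ hαm hα hu).unique (D.isLifting_lifting hΩ hαm hα hu)
      ⟨D.Mh.zero_mem, fun r _ => ?_⟩
    have h0 := l2Form_smul_add_left (𝒯 := 𝒯) 1 0 0 r
    simp only [smul_zero, add_zero, one_mul] at h0
    have h1 : liftingRhs α u r = 0 := by
      rw [liftingRhs, Finset.sum_eq_zero fun i _ => Finset.sum_eq_zero fun j hj => ?_,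
        Finset.sum_eq_zero fun i _ => ?_, add_zero]
      · refine integral_eq_zero_of_ae ?_
        filter_upwards [hdir i] with z hz
        simp [hz]
      · refine integral_eq_zero_of_ae ?_
        filter_upwards [hjump i j (Finset.mem_Ioi.1 hj)] with z hz
        simp [hz]
    rw [h1]
    linarith
  refine eq_zero_of_spatial_gradient_eq_zero hd hΩ u hu1 (fun i k => ?_) hjump hdir
  have := congrFun (congrFun hgrad i) k
  simp only [ldgGrad, hlift] at this
  simpa [weakGrad] using this

end DiscreteSpaces

/-! ### Inf-sup stability -/

namespace DiscreteSpaces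

variable {d : ℕ} {Ω : Set (Space d)} {T : ℝ} {𝒯 : PrismaticMesh Ω T} (D : DiscreteSpaces 𝒯)
  {κ : SpaceTime d → Matrix (Fin d) (Fin d) ℝ} {α η : SpaceTime d → ℝ}

theorem existsUnique_isNewton (hd : 1 ≤ d) (hΩ : IsPolytope Ω) (hκ : IsDiffusionTensor Ω T κ)
    (hαm : Measurable α) (hα : ∀ z, α z ∈ Icc (0 : ℝ) 1) (hη : MemLp η ⊤ 𝒯.lateralSkeleton)
    (hη_pos : ∃ c > 0, ∀ᵐ z ∂𝒯.lateralSkeleton, c ≤ η z) {u : 𝒯.Broken} (hu : u ∈ D.Vh) :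
    ∃! w, D.IsNewton κ α η u w := by
  have := D.finiteDimensional_Vh
  refine existsUnique_of_definite (W := D.Vh) (B := D.aForm κ α η) (f := mForm u)
    (fun c x hx y hy z hz => D.aForm_smul_add_left hΩ hκ hαm hα hη c hx hy hz)
    (fun c x hx y hy z hz => ?_)
    (fun c x hx y hy => mForm_smul_add_right (D.mem_H1_of_mem_Vh hu) (D.mem_H1_of_mem_Vh hx)
      (D.mem_H1_of_mem_Vh hy) c (D.mem_H1_of_mem_Vh (D.Vh.add_mem (D.Vh.smul_mem c hx) hy)))
    (fun x hx h => D.eq_zero_of_aForm_self_eq_zero hd hΩ hκ hαm hα hη hη_pos hx h)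
  rw [D.aForm_comm hκ x, D.aForm_smul_add_left hΩ hκ hαm hα hη c hy hz hx, D.aForm_comm hκ x,
    D.aForm_comm hκ x]

end DiscreteSpaces

/-- Cauchy–Schwarz for a nonnegative symmetric form on a subspace. -/
theorem abs_le_sqrt_mul_sqrt_of_nonneg {X : Type*} [AddCommGroup X] [Module ℝ X]
    {W : Submodule ℝ X} {B : X → X → ℝ}
    (hl : ∀ (k : ℝ), ∀ x ∈ W, ∀ y ∈ W, ∀ z ∈ W, B (k • x + y) z = k * B x z + B y z)
    (hs : ∀ x y, B x y = B y x) (h0 : ∀ x ∈ W, 0 ≤ B x x) {x y : X} (hx : x ∈ W) (hy : y ∈ W) :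
    |B x y| ≤ √(B x x) * √(B y y) := by
  rw [← Real.sqrt_mul (h0 x hx), ← Real.sqrt_sq_eq_abs]
  refine Real.sqrt_le_sqrt ?_
  have key : ∀ k : ℝ, 0 ≤ B x x * (k * k) + 2 * B x y * k + B y y := by
    intro k
    have hw : k • x + y ∈ W := W.add_mem (W.smul_mem k hx) hy
    have h := h0 _ hw
    rw [hl k x hx y hy _ hw, hs x, hs y, hl k x hx y hy x hx, hl k x hx y hy y hy, hs y x] at h
    linarith
  have := discrim_le_zero key
  rw [discrim] at this
  nlinarith

theorem mainTheorem1 {d : ℕ} (hd : 1 ≤ d)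
    (Ω : Set (Space d)) (hΩ : IsPolytope Ω) (T : ℝ) (hT : 0 < T)
    (κ : SpaceTime d → Matrix (Fin d) (Fin d) ℝ) (hκ : IsDiffusionTensor Ω T κ)
    (𝒯 : PrismaticMesh Ω T) (D : DiscreteSpaces 𝒯) (hD : D.LocallyCompatible)
    (α : SpaceTime d → ℝ) (hαm : Measurable α) (hα : ∀ z, α z ∈ Set.Icc (0 : ℝ) 1)
    (η : SpaceTime d → ℝ) (hη : MeasureTheory.MemLp η ⊤ 𝒯.lateralSkeleton)
    (hη_pos : ∃ c > 0, ∀ᵐ z ∂𝒯.lateralSkeleton, c ≤ η z) :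
    (∀ u ∈ D.Vh, ∃! L, D.IsLifting α u L) ∧
    (∀ u ∈ D.Vh, ∃! w, D.IsNewton κ α η u w) ∧
    (∀ u ∈ D.Vh, u ≠ 0 → 0 < D.ldgNorm κ α η u) ∧
    ∀ u ∈ D.Vh,
      BddAbove {q : ℝ | ∃ v ∈ D.Vh, v ≠ 0 ∧ q = D.bForm κ α η u v / D.ldgNorm κ α η v} ∧
      1 / (2 * √2) * D.ldgNewtonNorm κ α η u ≤
        sSup {q : ℝ | ∃ v ∈ D.Vh, v ≠ 0 ∧ q = D.bForm κ α η u v / D.ldgNorm κ α η v} := by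
  have newton_unique : ∀ u ∈ D.Vh, ∃! w, D.IsNewton κ α η u w := fun u hu =>
    D.existsUnique_isNewton hd hΩ hκ hαm hα hη hη_pos hu
  have norm_eq := D.ldgNorm_eq_sqrt_aForm (α := α) hκ hη_pos
  have nonneg : ∀ u ∈ D.Vh, 0 ≤ D.aForm κ α η u u := fun u hu =>
    (D.aForm_self_nonneg_and_eq_zero_imp hκ hη hη_pos (D.mem_H1_of_mem_Vh hu)).1
  have lin : ∀ (c : ℝ), ∀ x ∈ D.Vh, ∀ y ∈ D.Vh, ∀ z ∈ D.Vh,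
      D.aForm κ α η (c • x + y) z = c * D.aForm κ α η x z + D.aForm κ α η y z :=
    fun c x hx y hy z hz => D.aForm_smul_add_left hΩ hκ hαm hα hη c hx hy hz
  have norm_pos : ∀ u ∈ D.Vh, u ≠ 0 → 0 < D.ldgNorm κ α η u := fun u hu hu0 => by
    rw [norm_eq, Real.sqrt_pos]
    exact lt_of_le_of_ne (nonneg u hu) fun h =>
      hu0 (D.eq_zero_of_aForm_self_eq_zero hd hΩ hκ hαm hα hη hη_pos hu h.symm)
  refine ⟨fun u hu => D.existsUnique_isLifting hΩ hαm hα hu, newton_unique, norm_pos,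
    fun u hu => ?_⟩
  set N := D.newton κ α η u with hNdef
  have hN : D.IsNewton κ α η u N := by
    rw [hNdef, DiscreteSpaces.newton, dif_pos (newton_unique u hu).exists]
    exact (newton_unique u hu).exists.choose_spec
  set p := u + N with hp
  have hpV : p ∈ D.Vh := D.Vh.add_mem hu hN.1
  have add_left : ∀ z ∈ D.Vh, D.aForm κ α η p z = D.aForm κ α η u z + D.aForm κ α η N z := by
    intro z hz
    simpa using lin 1 u hu N hN.1 z hz
  -- the form `B_h(u, ·)` is represented by `u + N u` in the inner product `A_h`
  have hB : ∀ v ∈ D.Vh, D.bForm κ α η u v = D.aForm κ α η p v := fun v hv => by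
    rw [DiscreteSpaces.bForm, add_left v hv, hN.2 v hv, add_comm]
  have hbdd : BddAbove {q : ℝ | ∃ v ∈ D.Vh, v ≠ 0 ∧
      q = D.bForm κ α η u v / D.ldgNorm κ α η v} := by
    refine ⟨√(D.aForm κ α η p p), ?_⟩
    rintro q ⟨v, hv, hv0, rfl⟩
    rw [div_le_iff₀ (norm_pos v hv hv0), hB v hv, norm_eq]
    exact (le_abs_self _).trans (abs_le_sqrt_mul_sqrt_of_nonneg lin (D.aForm_comm hκ) nonneg hpV hv)
  refine ⟨hbdd, ?_⟩
  have hpp : D.aForm κ α η p p = D.aForm κ α η u u + 2 * jumpFunctional T u ^ 2 +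
      D.aForm κ α η N N := by
    rw [add_left p hpV, D.aForm_comm hκ u p, D.aForm_comm hκ N p, add_left u hu, add_left N hN.1,
      D.aForm_comm hκ u N, hN.2 u hu, mForm_self (D.mem_H1_of_mem_Vh hu)]
    ring
  have hle : D.ldgNewtonNorm κ α η u ≤ √(D.aForm κ α η p p) := by
    rw [DiscreteSpaces.ldgNewtonNorm, norm_eq, norm_eq, Real.sq_sqrt (nonneg u hu),
      Real.sq_sqrt (nonneg _ hN.1)]
    refine Real.sqrt_le_sqrt ?_
    rw [hpp]
    nlinarith [sq_nonneg (jumpFunctional T u)]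
  have hconst : 1 / (2 * √2) ≤ (1 : ℝ) := by
    rw [div_le_one (by positivity)]
    have : (1 : ℝ) ≤ √2 := Real.one_le_sqrt.2 (by norm_num)
    linarith
  refine (mul_le_of_le_one_left (Real.sqrt_nonneg _) hconst).trans (hle.trans ?_)
  by_cases hp0 : p = 0
  · -- all quotients vanish, or there are none
    have h0 : ∀ v ∈ D.Vh, D.aForm κ α η 0 v = 0 := fun v hv => by
      have := lin 1 0 D.Vh.zero_mem 0 D.Vh.zero_mem v hv
      simp only [smul_zero, add_zero, one_mul] at this
      linarith
    rw [hp0, h0 0 D.Vh.zero_mem, Real.sqrt_zero]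
    refine Real.sSup_nonneg ?_
    rintro q ⟨v, hv, -, rfl⟩
    rw [hB v hv, hp0, h0 v hv, zero_div]
  · refine le_csSup hbdd ⟨p, hpV, hp0, ?_⟩
    rw [hB p hpV, norm_eq, Real.div_sqrt]
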